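/- A \emph{conic} is a point $[f]$ of the projective space of the vector space of real ternary quadratic forms; it is \emph{proper} if $f$ is non-degenerate, and \emph{non-empty} if $f$ has a zero in $\mathbb{RP}^2$. A \emph{pair} is an unordered pair of distinct proper non-empty conics. Two couples (ordered pairs) of distinct proper conics are \emph{rigidly isotopic} if they are connected by a path in the space of couples of distinct proper conics along which, for each $m\ge 1$, the number of real and the number of imaginary intersection points of multiplicity $m$ in $\mathbb{CP}^2$ do not change. Two pairs are \emph{equivalent} if, after ordering each of them suitably, they are rigidly isotopic (rigid isotopy and exchange of the two conics). A \emph{pencil} is a line in the projective space of conics that contains a proper conic; its degenerate conics cut it into \emph{arcs}, the connected components of the set of its proper conics, and on each arc either all conics are empty or all are non-empty. \emph{Orbits} of pencils are taken under the action of $PGL(3,\mathbb{R})$. There are exactly $14$ equivalence classes of pairs. The pairs $\{[f],[g]\}$ in the following table are representatives, one for each class: \[ \begin{array}{|c|c|c|} \hline \text{class} & f & g\\ \hline \mathsf{IN} & 3x^2-2y^2-z^2 & 3x^2-y^2-2z^2\\ \mathsf{IS} & 3x^2-2y^2-z^2 & x^2-2y^2+z^2\\ \mathsf{IaN} & x^2+y^2+z^2+3xz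 & x^2+y^2+z^2+4xz\\ \mathsf{IaS} & x^2+y^2+z^2+3xz & x^2+y^2+z^2-3xz\\ \mathsf{IbN} & x^2+y^2-z^2+xz & x^2+y^2-z^2-xz\\ \mathsf{IIN} & yz+xy-xz & yz+2xy-2xz\\ \mathsf{IIS} & yz+xy-xz & yz-xy+xz\\ \mathsf{IIaN} & y^2+z^2+xz & y^2+z^2+2xz\\ \mathsf{IIaS} & y^2+z^2+xz & y^2+z^2-xz\\ \mathsf{IIIN} & xz+y^2 & xz+2y^2\\ \mathsf{IIIS} & xz+y^2 & xz-y^2\\ \mathsf{IIIaN} & x^2+y^2-z^2 & x^2+y^2-2z^2\\ \mathsf{IVN} & xz-y^2+xy & xz-y^2-2xy\\ \mathsf{VN} & xz-y^2-x^2 & xz-y^2+x^2\\ \hline \end{array} \] In each line the pencil generated by the pair lies in the orbit named by the first part of the name of the class, where the orbits $\mathsf{I}$, $\mathsf{Ia}$, $\mathsf{Ib}$, $\mathsf{II}$, $\mathsf{IIa}$, $\mathsf{III}$, $\mathsf{IIIa}$, $\mathsf{IV}$, $\mathsf{V}$ are those of the pencils generated by $(x^2-y^2,\,x^2-z^2)$,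 $(x^2+y^2+z^2,\,xz)$, $(x^2+y^2-z^2,\,xz)$, $(yz,\,x(y-z))$, $(y^2+z^2,\,xz)$, $(xz,\,y^2)$, $(x^2+y^2,\,z^2)$, $(xz-y^2,\,xy)$, $(xz-y^2,\,x^2)$ respectively; and the two conics are on a same arc of their pencil if the name ends in $\mathsf{N}$, on distinct arcs if it ends in $\mathsf{S}$. Moreover, let $W$ be a pencil containing a proper conic. If $W$ has at least two arcs of non-empty conics, then there are exactly two classes of pairs generating pencils in the orbit of $W$: the class $N$ of all such pairs whose two conics are on a same arc of the pencil they generate, and the class $S$ of all such pairs whose two conics are on distinct arcs; both classes contain pairs that generate $W$ itself. Otherwise all pairs generating pencils in the orbit of $W$ form one single class, and it contains pairs that generate $W$ itself. -/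

import Mathlib

open scoped LinearAlgebra.Projectivization

namespace TwoConics

/-! ### Ternary quadratic forms and conics -/

/-- The space of real ternary quadratic forms `v ↦ vᵀ A v`, each given by its symmetric matrix `A`,
with the topology of a subspace of the space of matrices. -/
def ternaryForms : Submodule ℝ (Matrix (Fin 3) (Fin 3) ℝ) where
  carrier := {A | A.IsSymm}
  add_mem' ha hb := ha.add hb
  zero_mem' := Matrix.isSymm_zero
  smul_mem' r _ ha := ha.smul r

/-- Real ternary quadratic forms. -/
abbrev TernaryForm : Type := ternaryForms

/-- The form `a x² + b y² + c z² + d xy + e xz + k yz`. -/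
noncomputable def form (a b c d e k : ℝ) : TernaryForm :=
  ⟨!![a, d / 2, e / 2; d / 2, b, k / 2; e / 2, k / 2, c], by
    show Matrix.IsSymm _
    ext i j
    fin_cases i <;> fin_cases j <;> rfl⟩

/-- The value of a quadratic form at a vector. -/
noncomputable def value (q : TernaryForm) (v : Fin 3 → ℝ) : ℝ := v ⬝ᵥ (q.1.mulVec v)

/-- The discriminant of a form: the determinant of its matrix. -/
noncomputable def disc (q : TernaryForm) : ℝ := q.1.det

theorem value_form (a b c d e k x y z : ℝ) :
    value (form a b c d e k) ![x, y, z] =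
      a * x ^ 2 + b * y ^ 2 + c * z ^ 2 + d * (x * y) + e * (x * z) + k * (y * z) := by
  simp [value, form, dotProduct, Matrix.mulVec, Fin.sum_univ_three]
  ring

theorem disc_form (a b c d e k : ℝ) :
    disc (form a b c d e k) =
      a * b * c + d * e * k / 4 - a * k ^ 2 / 4 - b * e ^ 2 / 4 - c * d ^ 2 / 4 := by
  simp [disc, form, Matrix.det_fin_three]
  ring

theorem ne_zero_of_disc {q : TernaryForm} (h : disc q ≠ 0) : q ≠ 0 := by
  rintro rfl
  exact h (by simp [disc])

/-- (Algebraic) real projective conics: the points of the projective space of the space of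
ternary quadratic forms. -/
abbrev Conic : Type := ℙ ℝ TernaryForm

/-- The projective space of ternary forms has the quotient topology. -/
instance : TopologicalSpace Conic :=
  inferInstanceAs (TopologicalSpace (Quotient (projectivizationSetoid ℝ TernaryForm)))

/-- A conic is proper if it comes from a non-degenerate form. -/
def IsProper (C : Conic) : Prop := disc C.rep ≠ 0

/-- The zero locus of a conic in the real projective plane. -/
def realLocus (C : Conic) : Set (ℙ ℝ (Fin 3 → ℝ)) := {p | value C.rep p.rep = 0}

/-- A conic is non-empty if it has a real point. -/
def IsNonempty (C : Conic) : Prop := (realLocus C).Nonempty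

/-! ### Intersection multiplicities -/

/-- The form, as a homogeneous polynomial of degree two with complex coefficients. -/
noncomputable def toPoly (q : TernaryForm) : MvPolynomial (Fin 3) ℂ :=
  ∑ i, ∑ j, MvPolynomial.C ((q.1 i j : ℝ) : ℂ) * (MvPolynomial.X i * MvPolynomial.X j)

/-- The homogeneous prime ideal of `ℂ[X₀, X₁, X₂]` of a point `p` of the complex projective plane:
the polynomials that vanish on the line `ℂ p`, that is, the kernel of the map `Xᵢ ↦ pᵢ T` to
`ℂ[T]`. -/
noncomputable def pointIdeal (p : ℙ ℂ (Fin 3 → ℂ)) : Ideal (MvPolynomial (Fin 3) ℂ) :=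
  RingHom.ker (MvPolynomial.aeval (R := ℂ)
    (fun i => Polynomial.C (p.rep i) * Polynomial.X)).toRingHom

instance (p : ℙ ℂ (Fin 3 → ℂ)) : (pointIdeal p).IsPrime := RingHom.ker_isPrime _

/-- With `S = ℂ[X₀, X₁, X₂]` and `𝔭` the homogeneous prime ideal of `p`: the length of
`S_𝔭 / J S_𝔭` over `S_𝔭`. -/
noncomputable def localLength (p : ℙ ℂ (Fin 3 → ℂ)) (J : Ideal (MvPolynomial (Fin 3) ℂ)) : ℕ∞ :=
  Module.length (Localization.AtPrime (pointIdeal p))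
    (Localization.AtPrime (pointIdeal p) ⧸
      J.map (algebraMap (MvPolynomial (Fin 3) ℂ) (Localization.AtPrime (pointIdeal p))))

/-- The intersection multiplicity of the conics `[f]` and `[g]` at a point `p` of the complex
projective plane: the length of `S_𝔭 / (f, g) S_𝔭`. It is `0` when `p` is not a common point. -/
noncomputable def multiplicity (C D : Conic) (p : ℙ ℂ (Fin 3 → ℂ)) : ℕ∞ :=
  localLength p (Ideal.span {toPoly C.rep, toPoly D.rep})

/-- A point of the complex projective plane is real if it has real homogeneous coordinates. -/
def IsRealPoint (p : ℙ ℂ (Fin 3 → ℂ)) : Prop :=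
  ∃ (v : Fin 3 → ℝ) (hv : (fun i => (v i : ℂ)) ≠ 0),
    p = Projectivization.mk ℂ (fun i => (v i : ℂ)) hv

/-- The number of real intersection points of multiplicity `m` (used for `m ≥ 1`). -/
noncomputable def realCount (x : Conic × Conic) (m : ℕ) : ℕ∞ :=
  {p : ℙ ℂ (Fin 3 → ℂ) | IsRealPoint p ∧ multiplicity x.1 x.2 p = m}.encard

/-- The number of imaginary intersection points of multiplicity `m` (used for `m ≥ 1`). -/
noncomputable def imagCount (x : Conic × Conic) (m : ℕ) : ℕ∞ :=
  {p : ℙ ℂ (Fin 3 → ℂ) | ¬ IsRealPoint p ∧ multiplicity x.1 x.2 p = m}.encard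

/-- The two couples have the same numbers of real and of imaginary intersections of each
multiplicity. -/
def SameIntersections (x y : Conic × Conic) : Prop :=
  ∀ m : ℕ, 1 ≤ m → realCount x m = realCount y m ∧ imagCount x m = imagCount y m

/-! ### Rigid isotopy and classes of pairs -/

/-- Two couples are rigidly isotopic if they are connected by a path in the space of couples of
distinct proper conics along which the numbers of real and of imaginary intersections of each
multiplicity do not change. -/
def RigidlyIsotopic (x y : Conic × Conic) : Prop :=
  ∃ γ : Path x y, ∀ t : unitInterval,
    ((γ t).1 ≠ (γ t).2 ∧ IsProper (γ t).1 ∧ IsProper (γ t).2) ∧ SameIntersections x (γ t)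

/-- Unordered pairs of distinct proper non-empty conics. -/
def ConicPair : Type :=
  {s : Sym2 Conic // ¬ s.IsDiag ∧ ∀ C ∈ s, IsProper C ∧ IsNonempty C}

/-- Equivalence of unordered pairs: rigid isotopy and exchange of the two conics. -/
def PairEquiv (s t : ConicPair) : Prop :=
  ∃ C D C' D' : Conic, s.1 = s(C, D) ∧ t.1 = s(C', D') ∧ RigidlyIsotopic (C, D) (C', D')

theorem SameIntersections.symm {x y : Conic × Conic} (h : SameIntersections x y) :
    SameIntersections y x := fun m hm => ⟨(h m hm).1.symm, (h m hm).2.symm⟩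

theorem SameIntersections.trans {x y z : Conic × Conic} (h : SameIntersections x y)
    (h' : SameIntersections y z) : SameIntersections x z :=
  fun m hm => ⟨(h m hm).1.trans (h' m hm).1, (h m hm).2.trans (h' m hm).2⟩

theorem SameIntersections.swap {x y : Conic × Conic} (h : SameIntersections x y) :
    SameIntersections x.swap y.swap := by
  have key : ∀ (z : Conic × Conic) (p : ℙ ℂ (Fin 3 → ℂ)),
      multiplicity z.swap.1 z.swap.2 p = multiplicity z.1 z.2 p := by
    intro z p
    simp only [multiplicity, Prod.fst_swap, Prod.snd_swap,
      Set.pair_comm (toPoly z.2.rep) (toPoly z.1.rep)]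
  intro m hm
  have := h m hm
  simpa only [realCount, imagCount, key] using this

theorem RigidlyIsotopic.iff_joinedIn {x y : Conic × Conic} :
    RigidlyIsotopic x y ↔
      JoinedIn {z | (z.1 ≠ z.2 ∧ IsProper z.1 ∧ IsProper z.2) ∧ SameIntersections x z} x y :=
  Iff.rfl

theorem RigidlyIsotopic.symm {x y : Conic × Conic} (h : RigidlyIsotopic x y) :
    RigidlyIsotopic y x := by
  obtain ⟨γ, hγ⟩ := h
  have hy : SameIntersections x y := by simpa using (hγ 1).2
  exact ⟨γ.symm, fun t => ⟨(hγ (unitInterval.symm t)).1,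
    hy.symm.trans (hγ (unitInterval.symm t)).2⟩⟩

theorem RigidlyIsotopic.trans {x y z : Conic × Conic} (h : RigidlyIsotopic x y)
    (h' : RigidlyIsotopic y z) : RigidlyIsotopic x z := by
  have hy : SameIntersections x y := by
    obtain ⟨γ, hγ⟩ := h
    simpa using (hγ 1).2
  rw [RigidlyIsotopic.iff_joinedIn] at h h' ⊢
  exact h.trans (h'.mono fun w hw => ⟨hw.1, hy.trans hw.2⟩)

theorem RigidlyIsotopic.swap {x y : Conic × Conic} (h : RigidlyIsotopic x y) :
    RigidlyIsotopic x.swap y.swap := by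
  obtain ⟨γ, hγ⟩ := h
  exact ⟨γ.map continuous_swap, fun t =>
    ⟨⟨(hγ t).1.1.symm, (hγ t).1.2.2, (hγ t).1.2.1⟩, (hγ t).2.swap⟩⟩

theorem RigidlyIsotopic.refl {x : Conic × Conic}
    (h : x.1 ≠ x.2 ∧ IsProper x.1 ∧ IsProper x.2) : RigidlyIsotopic x x :=
  ⟨Path.refl x, fun _ => ⟨h, fun _ _ => ⟨rfl, rfl⟩⟩⟩

theorem pairEquiv_equivalence : Equivalence PairEquiv where
  refl := by
    rintro ⟨s, hs, hs'⟩
    induction s using Sym2.ind with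
    | _ C D =>
      exact ⟨C, D, C, D, rfl, rfl, RigidlyIsotopic.refl
        ⟨by simpa using hs, (hs' C (Sym2.mem_mk_left C D)).1, (hs' D (Sym2.mem_mk_right C D)).1⟩⟩
  symm := by
    rintro s t ⟨C, D, C', D', h, h', H⟩
    exact ⟨C', D', C, D, h', h, H.symm⟩
  trans := by
    rintro s t u ⟨C, D, C', D', h, h', H⟩ ⟨E, F, E', F', k, k', K⟩
    rw [h', Sym2.eq_iff] at k
    rcases k with ⟨rfl, rfl⟩ | ⟨rfl, rfl⟩
    · exact ⟨C, D, E', F', h, k', H.trans K⟩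
    · exact ⟨C, D, F', E', h, k'.trans Sym2.eq_swap, H.trans K.swap⟩

instance pairSetoid : Setoid ConicPair := ⟨PairEquiv, pairEquiv_equivalence⟩

/-- The equivalence classes of pairs of proper non-empty conics. -/
abbrev PairClass : Type := Quotient pairSetoid

/-! ### Pencils, their orbits and their arcs -/

/-- A non-degenerate pencil: a plane in the space of forms, that contains a non-degenerate form. -/
def IsNondegeneratePencil (W : Submodule ℝ TernaryForm) : Prop :=
  Module.finrank ℝ W = 2 ∧ ∃ q ∈ W, disc q ≠ 0

/-- The linear change of variables `q ↦ q ∘ P` on forms. -/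
noncomputable def changeVars (P : Matrix.GeneralLinearGroup (Fin 3) ℝ) :
    TernaryForm →ₗ[ℝ] TernaryForm where
  toFun q := ⟨P.1.transpose * q.1 * P.1, by
    have hq : q.1.transpose = q.1 := q.2
    show Matrix.transpose _ = _
    rw [Matrix.transpose_mul, Matrix.transpose_mul, Matrix.transpose_transpose, hq,
      Matrix.mul_assoc]⟩
  map_add' q r := Subtype.ext (by simp [Matrix.mul_add, Matrix.add_mul])
  map_smul' a q := Subtype.ext (by simp)

/-- Two pencils are in the same orbit under the projective group `PGL(3, ℝ)`. -/
def SameOrbit (W W' : Submodule ℝ TernaryForm) : Prop :=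
  ∃ P : Matrix.GeneralLinearGroup (Fin 3) ℝ, W.map (changeVars P) = W'

/-- The pencil generated by a pair of conics. -/
noncomputable def pencil (s : ConicPair) : Submodule ℝ TernaryForm := ⨆ C ∈ s.1, C.submodule

/-- The proper conics of a pencil: the projective line minus the degenerate conics. -/
def properConics (W : Submodule ℝ TernaryForm) : Set Conic := {C | C.submodule ≤ W ∧ IsProper C}

/-- The arcs into which the degenerate conics cut a pencil: the connected components of the set
of its proper conics. -/
def arcs (W : Submodule ℝ TernaryForm) : Set (Set Conic) :=
  {A | ∃ C ∈ properConics W, A = connectedComponentIn (properConics W) C}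

/-- The arcs of non-empty conics. -/
def nonemptyArcs (W : Submodule ℝ TernaryForm) : Set (Set Conic) :=
  {A ∈ arcs W | ∀ C ∈ A, IsNonempty C}

/-- The two conics are on a same arc of the pencil that they generate. -/
def OnSameArc (s : ConicPair) : Prop := ∃ A ∈ arcs (pencil s), ∀ C ∈ s.1, C ∈ A

/-- The two conics are on distinct arcs of the pencil that they generate. -/
def OnDistinctArcs (s : ConicPair) : Prop :=
  ∃ C D : Conic, s.1 = s(C, D) ∧
    ∃ A ∈ arcs (pencil s), ∃ B ∈ arcs (pencil s), A ≠ B ∧ C ∈ A ∧ D ∈ B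

/-! ### Names of orbits and of classes, and their representatives -/

/-- Names of the nine orbits of non-degenerate pencils. -/
inductive OrbitName
  | I | Ia | Ib | II | IIa | III | IIIa | IV | V

/-- Levy's representatives of the orbits of pencils. -/
noncomputable def OrbitName.levy : OrbitName → Submodule ℝ TernaryForm
  | .I => Submodule.span ℝ {form 1 (-1) 0 0 0 0, form 1 0 (-1) 0 0 0}
  | .Ia => Submodule.span ℝ {form 1 1 1 0 0 0, form 0 0 0 0 1 0}
  | .Ib => Submodule.span ℝ {form 1 1 (-1) 0 0 0, form 0 0 0 0 1 0}
  | .II => Submodule.span ℝ {form 0 0 0 0 0 1, form 0 0 0 1 (-1) 0}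
  | .IIa => Submodule.span ℝ {form 0 1 1 0 0 0, form 0 0 0 0 1 0}
  | .III => Submodule.span ℝ {form 0 0 0 0 1 0, form 0 1 0 0 0 0}
  | .IIIa => Submodule.span ℝ {form 1 1 0 0 0 0, form 0 0 1 0 0 0}
  | .IV => Submodule.span ℝ {form 0 (-1) 0 0 1 0, form 0 0 0 1 0 0}
  | .V => Submodule.span ℝ {form 0 (-1) 0 0 1 0, form 1 0 0 0 0 0}

/-- Names of the classes of pairs. -/
inductive ClassName
  | IN | IS | IaN | IaS | IbN | IIN | IIS | IIaN | IIaS | IIIN | IIIS | IIIaN | IVN | VN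

/-- The orbit part of the name of a class. -/
def ClassName.orbit : ClassName → OrbitName
  | .IN | .IS => .I
  | .IaN | .IaS => .Ia
  | .IbN => .Ib
  | .IIN | .IIS => .II
  | .IIaN | .IIaS => .IIa
  | .IIIN | .IIIS => .III
  | .IIIaN => .IIIa
  | .IVN => .IV
  | .VN => .V

/-- The classes whose name ends in `S` (separated); the others end in `N` (neighbors). -/
def ClassName.IsSeparated : ClassName → Prop
  | .IS | .IaS | .IIS | .IIaS | .IIIS => True
  | _ => False

/-- First form of the representative of a class. -/
noncomputable def ClassName.f : ClassName → TernaryForm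
  | .IN => form 3 (-2) (-1) 0 0 0
  | .IS => form 3 (-2) (-1) 0 0 0
  | .IaN => form 1 1 1 0 3 0
  | .IaS => form 1 1 1 0 3 0
  | .IbN => form 1 1 (-1) 0 1 0
  | .IIN => form 0 0 0 1 (-1) 1
  | .IIS => form 0 0 0 1 (-1) 1
  | .IIaN => form 0 1 1 0 1 0
  | .IIaS => form 0 1 1 0 1 0
  | .IIIN => form 0 1 0 0 1 0
  | .IIIS => form 0 1 0 0 1 0
  | .IIIaN => form 1 1 (-1) 0 0 0
  | .IVN => form 0 (-1) 0 1 1 0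
  | .VN => form (-1) (-1) 0 0 1 0

/-- Second form of the representative of a class. -/
noncomputable def ClassName.g : ClassName → TernaryForm
  | .IN => form 3 (-1) (-2) 0 0 0
  | .IS => form 1 (-2) 1 0 0 0
  | .IaN => form 1 1 1 0 4 0
  | .IaS => form 1 1 1 0 (-3) 0
  | .IbN => form 1 1 (-1) 0 (-1) 0
  | .IIN => form 0 0 0 2 (-2) 1
  | .IIS => form 0 0 0 (-1) 1 1
  | .IIaN => form 0 1 1 0 2 0
  | .IIaS => form 0 1 1 0 (-1) 0
  | .IIIN => form 0 2 0 0 1 0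
  | .IIIS => form 0 (-1) 0 0 1 0
  | .IIIaN => form 1 1 (-2) 0 0 0
  | .IVN => form 0 (-1) 0 (-2) 1 0
  | .VN => form 1 (-1) 0 0 1 0

theorem ClassName.disc_f (c : ClassName) : disc c.f ≠ 0 := by
  cases c <;> rw [ClassName.f, disc_form] <;> norm_num

theorem ClassName.disc_g (c : ClassName) : disc c.g ≠ 0 := by
  cases c <;> rw [ClassName.g, disc_form] <;> norm_num

theorem isProper_mk {q : TernaryForm} (h : disc q ≠ 0) :
    IsProper (Projectivization.mk ℝ q (ne_zero_of_disc h)) := by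
  obtain ⟨a, ha⟩ := Projectivization.exists_smul_eq_mk_rep ℝ q (ne_zero_of_disc h)
  have hdet : disc (a • q) = (a : ℝ) ^ 3 * disc q := by
    have : (a • q).1 = (a : ℝ) • q.1 := rfl
    simp [disc, this]
  rw [IsProper, ← ha, hdet]
  exact mul_ne_zero (pow_ne_zero _ a.ne_zero) h

theorem isNonempty_mk {q : TernaryForm} (hq : q ≠ 0) {v : Fin 3 → ℝ} (hv : v ≠ 0)
    (h : value q v = 0) : IsNonempty (Projectivization.mk ℝ q hq) := by
  obtain ⟨a, ha⟩ := Projectivization.exists_smul_eq_mk_rep ℝ q hq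
  obtain ⟨b, hb⟩ := Projectivization.exists_smul_eq_mk_rep ℝ v hv
  refine ⟨Projectivization.mk ℝ v hv, ?_⟩
  have h1 : (a • q).1 = (a : ℝ) • q.1 := rfl
  have h2 : b • v = (b : ℝ) • v := rfl
  show value _ _ = 0
  rw [← ha, ← hb, value, h1, h2, Matrix.smul_mulVec, Matrix.mulVec_smul]
  simp only [smul_dotProduct, dotProduct_smul, smul_eq_mul]
  rw [value] at h
  simp [h]

theorem vec_ne_zero {x y z : ℝ} (h : x ≠ 0 ∨ y ≠ 0 ∨ z ≠ 0) : (![x, y, z] : Fin 3 → ℝ) ≠ 0 := by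
  intro h0
  have h1 := congrFun h0 0
  have h2 := congrFun h0 1
  have h3 := congrFun h0 2
  simp at h1 h2 h3
  tauto

theorem ClassName.point_f (c : ClassName) :
    ∃ x y z : ℝ, (x ≠ 0 ∨ y ≠ 0 ∨ z ≠ 0) ∧ value c.f ![x, y, z] = 0 := by
  cases c <;> simp only [ClassName.f, value_form]
  · exact ⟨1, 1, 1, by norm_num, by norm_num⟩
  · exact ⟨1, 1, 1, by norm_num, by norm_num⟩
  · exact ⟨1, 1, -1, by norm_num, by norm_num⟩
  · exact ⟨1, 1, -1, by norm_num, by norm_num⟩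
  · exact ⟨0, 1, 1, by norm_num, by norm_num⟩
  · exact ⟨1, 0, 0, by norm_num, by norm_num⟩
  · exact ⟨1, 0, 0, by norm_num, by norm_num⟩
  · exact ⟨1, 0, 0, by norm_num, by norm_num⟩
  · exact ⟨1, 0, 0, by norm_num, by norm_num⟩
  · exact ⟨1, 0, 0, by norm_num, by norm_num⟩
  · exact ⟨1, 0, 0, by norm_num, by norm_num⟩
  · exact ⟨1, 0, 1, by norm_num, by norm_num⟩
  · exact ⟨1, 0, 0, by norm_num, by norm_num⟩
  · exact ⟨0, 0, 1, by norm_num, by norm_num⟩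

theorem ClassName.point_g (c : ClassName) :
    ∃ x y z : ℝ, (x ≠ 0 ∨ y ≠ 0 ∨ z ≠ 0) ∧ value c.g ![x, y, z] = 0 := by
  cases c <;> simp only [ClassName.g, value_form]
  · exact ⟨1, 1, 1, by norm_num, by norm_num⟩
  · exact ⟨1, 1, 1, by norm_num, by norm_num⟩
  · refine ⟨1, √2, -1, by norm_num, ?_⟩
    rw [Real.sq_sqrt (by norm_num)]
    norm_num
  · exact ⟨1, 1, 1, by norm_num, by norm_num⟩
  · exact ⟨0, 1, 1, by norm_num, by norm_num⟩
  · exact ⟨1, 0, 0, by norm_num, by norm_num⟩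
  · exact ⟨1, 0, 0, by norm_num, by norm_num⟩
  · exact ⟨1, 0, 0, by norm_num, by norm_num⟩
  · exact ⟨1, 0, 0, by norm_num, by norm_num⟩
  · exact ⟨1, 0, 0, by norm_num, by norm_num⟩
  · exact ⟨1, 0, 0, by norm_num, by norm_num⟩
  · exact ⟨1, 1, 1, by norm_num, by norm_num⟩
  · exact ⟨1, 0, 0, by norm_num, by norm_num⟩
  · exact ⟨0, 0, 1, by norm_num, by norm_num⟩

theorem ClassName.not_smul (c : ClassName) (a : ℝ) : a • c.g ≠ c.f := by
  intro h
  have e (i j : Fin 3) : a * c.g.1 i j = c.f.1 i j :=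
    congrFun (congrFun (congrArg Subtype.val h) i) j
  have h00 := e 0 0
  have h11 := e 1 1
  have h22 := e 2 2
  have h01 := e 0 1
  have h02 := e 0 2
  have h12 := e 1 2
  cases c <;> simp [ClassName.f, ClassName.g, form] at h00 h11 h22 h01 h02 h12 <;> linarith

/-- The representative `{[f], [g]}` of a class. -/
noncomputable def ClassName.rep (c : ClassName) : ConicPair :=
  ⟨s(Projectivization.mk ℝ c.f (ne_zero_of_disc c.disc_f),
      Projectivization.mk ℝ c.g (ne_zero_of_disc c.disc_g)), by
    refine ⟨?_, ?_⟩
    · rw [Sym2.mk_isDiag_iff, Projectivization.mk_eq_mk_iff']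
      rintro ⟨a, ha⟩
      exact c.not_smul a ha
    · intro C hC
      rcases Sym2.mem_iff.1 hC with rfl | rfl
      · obtain ⟨x, y, z, h, h'⟩ := c.point_f
        exact ⟨isProper_mk c.disc_f, isNonempty_mk _ (vec_ne_zero h) h'⟩
      · obtain ⟨x, y, z, h, h'⟩ := c.point_g
        exact ⟨isProper_mk c.disc_g, isNonempty_mk _ (vec_ne_zero h) h'⟩⟩

end TwoConics

namespace TwoConics

/-! ### Linear algebra of forms and pencils -/

/-! Two distinct proper conics span a pencil, and their intersection points with multiplicities are
the base points of that pencil. The classification amounts to the statement that a pair has two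
invariants under rigid isotopy and exchange, the orbit of its pencil and whether its conics share an
arc of it, and that these two are complete (`equiv_iff`).

Orbits. The discriminant is odd on a pencil, so it vanishes at some nonzero member, which after a
linear change of variables is a pair of real lines, a pair of conjugate lines or a double line. The
position of the base points on these lines then brings the pencil to one of nine normal forms
(`exists_sameOrbit_levy`). The numbers of real and imaginary base points of each multiplicity tell
the nine apart (`OrbitName.eq_of_sameBasePoints`). Multiplicities greater than one are never
computed: it is enough to know which points are simple and, for the three orbits without simple base
points, that some multiplicities are finite and positive. As a rigid isotopy keeps these numbers, it
keeps the orbit.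

Arcs. Except in the orbit `Ib`, the discriminant of the pencil of `C` and `D` is a product of real
linear forms `ℓ i`, and the conics share an arc exactly when all ratios `r i = ℓ i C / ℓ i D` have
the same sign. The roots of the cubic `disc (C + s D)` are the real numbers `-r i`, so this is a
condition on the signs of its coefficients (`Aligned`), which vary continuously with the couple.
Because the roots are real and nonzero, the weak sign conditions already imply the strict ones; the
condition is therefore open and closed along a rigid isotopy (`SameArc.of_rigidlyIsotopic`). In `Ib`
there is only one arc.

Completeness. `PGL(3, ℝ)` is connected, so changes of variables act by rigid isotopies
(`isIsotopicMove`) and a pair can be moved into a named pencil. There the two parameters slide along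
intervals of nondegenerate forms as long as they stay distinct, and the symmetries of the pencil
identify arcs with one another. What remains is one pair on a same arc and, if at least two arcs are
non-empty, one pair on distinct arcs (`isRepresented_levy`). Non-empty proper conics are those of
indefinite forms; definite and indefinite forms being separated by open conditions, emptiness is
constant on arcs. -/

theorem form_eta (q : TernaryForm) :
    form (q.1 0 0) (q.1 1 1) (q.1 2 2) (2 * q.1 0 1) (2 * q.1 0 2) (2 * q.1 1 2) = q := by
  have h : ∀ i j, q.1 i j = q.1 j i := fun i j => congrFun (congrFun q.2 j) i
  apply Subtype.ext
  ext i j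
  fin_cases i <;> fin_cases j <;> simp [form, h 1 0, h 2 0, h 2 1]

theorem exists_eq_form (q : TernaryForm) : ∃ a b c d e k, q = form a b c d e k :=
  ⟨_, _, _, _, _, _, (form_eta q).symm⟩

theorem smul_form (r a b c d e k : ℝ) :
    r • form a b c d e k = form (r * a) (r * b) (r * c) (r * d) (r * e) (r * k) := by
  apply Subtype.ext
  ext i j
  show r * (form a b c d e k).1 i j = _
  fin_cases i <;> fin_cases j <;> simp [form] <;> ring

theorem form_add_form (a b c d e k a' b' c' d' e' k' : ℝ) :
    form a b c d e k + form a' b' c' d' e' k' =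
      form (a + a') (b + b') (c + c') (d + d') (e + e') (k + k') := by
  apply Subtype.ext
  ext i j
  show (form a b c d e k).1 i j + (form a' b' c' d' e' k').1 i j = _
  fin_cases i <;> fin_cases j <;> simp [form] <;> ring

theorem form_inj {a b c d e k a' b' c' d' e' k' : ℝ} :
    form a b c d e k = form a' b' c' d' e' k' ↔
      a = a' ∧ b = b' ∧ c = c' ∧ d = d' ∧ e = e' ∧ k = k' := by
  constructor
  · intro h
    have e (i j : Fin 3) := congrFun (congrFun (congrArg Subtype.val h) i) j
    have h00 := e 0 0
    have h11 := e 1 1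
    have h22 := e 2 2
    have h01 := e 0 1
    have h02 := e 0 2
    have h12 := e 1 2
    simp [form] at h00 h11 h22 h01 h02 h12
    refine ⟨?_, ?_, ?_, ?_, ?_, ?_⟩ <;> linarith
  · rintro ⟨rfl, rfl, rfl, rfl, rfl, rfl⟩
    rfl

theorem form_eq_zero {a b c d e k : ℝ} :
    form a b c d e k = 0 ↔ a = 0 ∧ b = 0 ∧ c = 0 ∧ d = 0 ∧ e = 0 ∧ k = 0 := by
  have : (0 : TernaryForm) = form 0 0 0 0 0 0 := by
    rw [← zero_smul ℝ (form 0 0 0 0 0 0), smul_form]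
    simp
  rw [this, form_inj]

/-- The substitution `q ↦ q ∘ M` for a matrix `M`, invertible or not. -/
noncomputable def subst (M : Matrix (Fin 3) (Fin 3) ℝ) (q : TernaryForm) : TernaryForm :=
  ⟨M.transpose * q.1 * M, by
    have hq : q.1.transpose = q.1 := q.2
    show Matrix.transpose _ = _
    rw [Matrix.transpose_mul, Matrix.transpose_mul, Matrix.transpose_transpose, hq,
      Matrix.mul_assoc]⟩

theorem changeVars_eq_subst (P : Matrix.GeneralLinearGroup (Fin 3) ℝ) (q : TernaryForm) :
    changeVars P q = subst P.1 q := rfl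

theorem subst_subst (M N : Matrix (Fin 3) (Fin 3) ℝ) (q : TernaryForm) :
    subst N (subst M q) = subst (M * N) q :=
  Subtype.ext (by simp [subst, Matrix.mul_assoc])

theorem subst_one (q : TernaryForm) : subst 1 q = q := Subtype.ext (by simp [subst])

theorem subst_add (M : Matrix (Fin 3) (Fin 3) ℝ) (q r : TernaryForm) :
    subst M (q + r) = subst M q + subst M r :=
  Subtype.ext (by simp [subst, Matrix.mul_add, Matrix.add_mul])

theorem subst_smul (M : Matrix (Fin 3) (Fin 3) ℝ) (a : ℝ) (q : TernaryForm) :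
    subst M (a • q) = a • subst M q := Subtype.ext (by simp [subst])

theorem disc_subst (M : Matrix (Fin 3) (Fin 3) ℝ) (q : TernaryForm) :
    disc (subst M q) = M.det ^ 2 * disc q := by
  simp [disc, subst]
  ring

theorem disc_smul (a : ℝ) (q : TernaryForm) : disc (a • q) = a ^ 3 * disc q := by
  have : (a • q).1 = a • q.1 := rfl
  simp [disc, this]

theorem value_subst (M : Matrix (Fin 3) (Fin 3) ℝ) (q : TernaryForm) (v : Fin 3 → ℝ) :
    value (subst M q) v = value q (M.mulVec v) := by
  simp only [value, subst]
  rw [← Matrix.mulVec_mulVec, ← Matrix.mulVec_mulVec, Matrix.dotProduct_mulVec,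
    Matrix.vecMul_transpose]

theorem value_smul (a : ℝ) (q : TernaryForm) (v : Fin 3 → ℝ) :
    value (a • q) v = a * value q v := by
  have : (a • q).1 = a • q.1 := rfl
  simp [value, this, Matrix.smul_mulVec]

theorem value_smul_vec (a : ℝ) (q : TernaryForm) (v : Fin 3 → ℝ) :
    value q (a • v) = a ^ 2 * value q v := by
  simp [value, Matrix.mulVec_smul]
  ring

theorem subst_form (p₀ p₁ p₂ q₀ q₁ q₂ r₀ r₁ r₂ a b c d e k : ℝ) :
    subst !![p₀, p₁, p₂; q₀, q₁, q₂; r₀, r₁, r₂] (form a b c d e k) =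
      form (a * p₀ ^ 2 + b * q₀ ^ 2 + c * r₀ ^ 2 + d * p₀ * q₀ + e * p₀ * r₀ + k * q₀ * r₀)
        (a * p₁ ^ 2 + b * q₁ ^ 2 + c * r₁ ^ 2 + d * p₁ * q₁ + e * p₁ * r₁ + k * q₁ * r₁)
        (a * p₂ ^ 2 + b * q₂ ^ 2 + c * r₂ ^ 2 + d * p₂ * q₂ + e * p₂ * r₂ + k * q₂ * r₂)
        (2 * a * p₀ * p₁ + 2 * b * q₀ * q₁ + 2 * c * r₀ * r₁ + d * (p₀ * q₁ + p₁ * q₀)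
          + e * (p₀ * r₁ + p₁ * r₀) + k * (q₀ * r₁ + q₁ * r₀))
        (2 * a * p₀ * p₂ + 2 * b * q₀ * q₂ + 2 * c * r₀ * r₂ + d * (p₀ * q₂ + p₂ * q₀)
          + e * (p₀ * r₂ + p₂ * r₀) + k * (q₀ * r₂ + q₂ * r₀))
        (2 * a * p₁ * p₂ + 2 * b * q₁ * q₂ + 2 * c * r₁ * r₂ + d * (p₁ * q₂ + p₂ * q₁)
          + e * (p₁ * r₂ + p₂ * r₁) + k * (q₁ * r₂ + q₂ * r₁)) := by
  apply Subtype.ext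
  ext i j
  fin_cases i <;> fin_cases j <;>
    simp [subst, form, Matrix.mul_apply, Fin.sum_univ_three] <;> ring

theorem subst_inv_subst {M : Matrix (Fin 3) (Fin 3) ℝ} (hM : M.det ≠ 0) (q : TernaryForm) :
    subst M⁻¹ (subst M q) = q := by
  rw [subst_subst, Matrix.mul_nonsing_inv _ (isUnit_iff_ne_zero.2 hM), subst_one]

theorem changeVars_comp (P Q : Matrix.GeneralLinearGroup (Fin 3) ℝ) :
    (changeVars Q).comp (changeVars P) = changeVars (P * Q) :=
  LinearMap.ext fun q => subst_subst P.1 Q.1 q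

theorem changeVars_one : changeVars 1 = LinearMap.id := LinearMap.ext subst_one

theorem SameOrbit.refl (W : Submodule ℝ TernaryForm) : SameOrbit W W :=
  ⟨1, by rw [changeVars_one, Submodule.map_id]⟩

theorem SameOrbit.symm {W W' : Submodule ℝ TernaryForm} (h : SameOrbit W W') :
    SameOrbit W' W := by
  obtain ⟨P, rfl⟩ := h
  refine ⟨P⁻¹, ?_⟩
  rw [← Submodule.map_comp, changeVars_comp, mul_inv_cancel, changeVars_one, Submodule.map_id]

theorem SameOrbit.trans {W W' W'' : Submodule ℝ TernaryForm} (h : SameOrbit W W')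
    (h' : SameOrbit W' W'') : SameOrbit W W'' := by
  obtain ⟨P, rfl⟩ := h
  obtain ⟨Q, rfl⟩ := h'
  exact ⟨P * Q, by rw [← Submodule.map_comp, changeVars_comp]⟩

/-- The plane spanned by two forms. -/
abbrev span₂ (f g : TernaryForm) : Submodule ℝ TernaryForm := Submodule.span ℝ {f, g}

theorem mem_span₂ {f g q : TernaryForm} : q ∈ span₂ f g ↔ ∃ a b : ℝ, a • f + b • g = q :=
  Submodule.mem_span_pair

theorem span₂_comm (f g : TernaryForm) : span₂ f g = span₂ g f := by
  rw [span₂, Set.pair_comm]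

theorem span₂_eq_of_combination {f g f' g' : TernaryForm} {a b c d : ℝ} (h : a * d - b * c ≠ 0)
    (hf : f' = a • f + b • g) (hg : g' = c • f + d • g) : span₂ f' g' = span₂ f g := by
  apply le_antisymm
  · rw [Submodule.span_le]
    rintro q (rfl | rfl)
    · exact mem_span₂.2 ⟨a, b, hf.symm⟩
    · exact mem_span₂.2 ⟨c, d, hg.symm⟩
  · have he : (a * d - b * c) * (a * d - b * c)⁻¹ = 1 := mul_inv_cancel₀ h
    set e := (a * d - b * c)⁻¹
    rw [Submodule.span_le]
    rintro q (rfl | rfl)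
    · refine mem_span₂.2 ⟨d * e, -b * e, ?_⟩
      rw [hf, hg]
      match_scalars
      · linear_combination he
      · ring
    · refine mem_span₂.2 ⟨-c * e, a * e, ?_⟩
      rw [hf, hg]
      match_scalars
      · ring
      · linear_combination he

theorem map_changeVars_span₂ (P : Matrix.GeneralLinearGroup (Fin 3) ℝ) (f g : TernaryForm) :
    (span₂ f g).map (changeVars P) = span₂ (changeVars P f) (changeVars P g) := by
  rw [Submodule.map_span, Set.image_pair]

theorem sameOrbit_span₂_subst {M : Matrix (Fin 3) (Fin 3) ℝ} (hM : M.det ≠ 0)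
    (f g : TernaryForm) : SameOrbit (span₂ f g) (span₂ (subst M f) (subst M g)) :=
  ⟨Matrix.GeneralLinearGroup.mkOfDetNeZero M hM, map_changeVars_span₂ _ _ _⟩

theorem sameOrbit_of_subst {M : Matrix (Fin 3) (Fin 3) ℝ} (hM : M.det ≠ 0)
    {f g f' g' : TernaryForm} {a b c d : ℝ} (h : a * d - b * c ≠ 0)
    (hf : subst M f = a • f' + b • g') (hg : subst M g = c • f' + d • g') :
    SameOrbit (span₂ f g) (span₂ f' g') := by
  rw [← span₂_eq_of_combination h hf hg]
  exact sameOrbit_span₂_subst hM f g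

theorem finrank_span₂ {f g : TernaryForm} (h : LinearIndependent ℝ ![f, g]) :
    Module.finrank ℝ (span₂ f g) = 2 := by
  have := finrank_span_eq_card h
  rwa [Matrix.range_cons, Matrix.range_cons, Matrix.range_empty, Set.union_empty,
    Set.singleton_union, Fintype.card_fin] at this

/-- A pencil is spanned by any two independent members. -/
theorem eq_span₂ {W : Submodule ℝ TernaryForm} (hW : Module.finrank ℝ W = 2) {f g : TernaryForm}
    (hf : f ∈ W) (hg : g ∈ W) (h : LinearIndependent ℝ ![f, g]) : W = span₂ f g := by
  symm
  apply Submodule.eq_of_le_of_finrank_eq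
  · rw [Submodule.span_le]
    rintro q (rfl | rfl) <;> assumption
  · rw [finrank_span₂ h, hW]


/-! ### Orbits of pencils -/

theorem exists_sq_of_pos {a : ℝ} (h : 0 < a) : ∃ r : ℝ, r ≠ 0 ∧ a = r ^ 2 :=
  ⟨√a, (Real.sqrt_pos.2 h).ne', (Real.sq_sqrt h.le).symm⟩

theorem exists_neg_sq_of_neg {a : ℝ} (h : a < 0) : ∃ r : ℝ, r ≠ 0 ∧ a = -r ^ 2 := by
  obtain ⟨r, hr, e⟩ := exists_sq_of_pos (neg_pos.2 h)
  exact ⟨r, hr, by linarith⟩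

theorem sameOrbit_swap_xz (a b c d e k a' b' c' d' e' k' : ℝ) :
    SameOrbit (span₂ (form a b c d e k) (form a' b' c' d' e' k'))
      (span₂ (form c b a k e d) (form c' b' a' k' e' d')) := by
  refine sameOrbit_of_subst (M := !![0, 0, 1; 0, 1, 0; 1, 0, 0]) (a := 1) (b := 0) (c := 0)
    (d := 1) ?_ ?_ ?_ ?_
  · simp [Matrix.det_fin_three]
  · norm_num
  all_goals
    rw [subst_form, smul_form, smul_form, form_add_form, form_inj]
    refine ⟨?_, ?_, ?_, ?_, ?_, ?_⟩ <;> ring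

/-- With `x = (X + Z)/r`, `y = 2Y`, `z = (X - Z)/s` the first form becomes `4Y² - 2X² - 2Z²` and
`xz` becomes a multiple of `X² - Z²`. -/
theorem sameOrbit_diag_xz_of_neg_neg {r s : ℝ} (hr : r ≠ 0) (hs : s ≠ 0) :
    SameOrbit (span₂ (form (-r ^ 2) 1 (-s ^ 2) 0 0 0) (form 0 0 0 0 1 0)) OrbitName.I.levy := by
  refine sameOrbit_of_subst (M := !![1 / r, 0, 1 / r; 0, 2, 0; 1 / s, 0, -1 / s])
    (a := -4) (b := 2) (c := 0) (d := 1 / (r * s)) ?_ ?_ ?_ ?_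
  · simp [Matrix.det_fin_three]
    field_simp
    norm_num
  · field_simp
    norm_num [hr, hs]
  all_goals
    rw [subst_form, smul_form, smul_form, form_add_form, form_inj]
    refine ⟨?_, ?_, ?_, ?_, ?_, ?_⟩ <;> field_simp <;> ring

theorem sameOrbit_diag_xz_of_pos_pos {r s : ℝ} (hr : r ≠ 0) (hs : s ≠ 0) :
    SameOrbit (span₂ (form (r ^ 2) 1 (s ^ 2) 0 0 0) (form 0 0 0 0 1 0)) OrbitName.Ia.levy := by
  refine sameOrbit_of_subst (M := !![1 / r, 0, 0; 0, 1, 0; 0, 0, 1 / s])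
    (a := 1) (b := 0) (c := 0) (d := 1 / (r * s)) ?_ ?_ ?_ ?_
  · simp [Matrix.det_fin_three]
    exact ⟨hr, hs⟩
  · field_simp
    norm_num [hr, hs]
  all_goals
    rw [subst_form, smul_form, smul_form, form_add_form, form_inj]
    refine ⟨?_, ?_, ?_, ?_, ?_, ?_⟩ <;> field_simp <;> ring

theorem sameOrbit_diag_xz_of_pos_neg {r s : ℝ} (hr : r ≠ 0) (hs : s ≠ 0) :
    SameOrbit (span₂ (form (r ^ 2) 1 (-s ^ 2) 0 0 0) (form 0 0 0 0 1 0)) OrbitName.Ib.levy := by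
  refine sameOrbit_of_subst (M := !![1 / r, 0, 0; 0, 1, 0; 0, 0, 1 / s])
    (a := 1) (b := 0) (c := 0) (d := 1 / (r * s)) ?_ ?_ ?_ ?_
  · simp [Matrix.det_fin_three]
    exact ⟨hr, hs⟩
  · field_simp
    norm_num [hr, hs]
  all_goals
    rw [subst_form, smul_form, smul_form, form_add_form, form_inj]
    refine ⟨?_, ?_, ?_, ?_, ?_, ?_⟩ <;> field_simp <;> ring

theorem sameOrbit_diag_xz_of_pos_zero {r : ℝ} (hr : r ≠ 0) :
    SameOrbit (span₂ (form (r ^ 2) 1 0 0 0 0) (form 0 0 0 0 1 0)) OrbitName.IIa.levy := by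
  refine sameOrbit_of_subst (M := !![0, 0, 1 / r; 0, 1, 0; 1, 0, 0])
    (a := 1) (b := 0) (c := 0) (d := 1 / r) ?_ ?_ ?_ ?_
  · simp [Matrix.det_fin_three]
    exact hr
  · field_simp
    norm_num [hr]
  all_goals
    rw [subst_form, smul_form, smul_form, form_add_form, form_inj]
    refine ⟨?_, ?_, ?_, ?_, ?_, ?_⟩ <;> field_simp <;> ring

theorem sameOrbit_diag_xz_of_neg_zero {r : ℝ} (hr : r ≠ 0) :
    SameOrbit (span₂ (form (-r ^ 2) 1 0 0 0 0) (form 0 0 0 0 1 0)) OrbitName.II.levy := by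
  refine sameOrbit_of_subst (M := !![0, 1 / (2 * r), -1 / (2 * r); 0, 1 / 2, 1 / 2; 1, 0, 0])
    (a := 1) (b := 0) (c := 0) (d := 1 / (2 * r)) ?_ ?_ ?_ ?_
  · simp [Matrix.det_fin_three]
    field_simp
    norm_num
  · field_simp
    norm_num [hr]
  all_goals
    rw [subst_form, smul_form, smul_form, form_add_form, form_inj]
    refine ⟨?_, ?_, ?_, ?_, ?_, ?_⟩ <;> field_simp <;> ring

/-- The base points on the line `z = 0` satisfy `y² = -a x²`: they are real, imaginary or coincident
according to the sign of `a`; likewise for `c` on the line `x = 0`. Up to the exchange of the two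
lines this leaves six cases. -/
theorem exists_sameOrbit_diag_xz (a c : ℝ) :
    ∃ o : OrbitName, SameOrbit (span₂ (form a 1 c 0 0 0) (form 0 0 0 0 1 0)) o.levy := by
  rcases lt_trichotomy a 0 with ha | rfl | ha
  · obtain ⟨r, hr, rfl⟩ := exists_neg_sq_of_neg ha
    rcases lt_trichotomy c 0 with hc | rfl | hc
    · obtain ⟨s, hs, rfl⟩ := exists_neg_sq_of_neg hc
      exact ⟨_, sameOrbit_diag_xz_of_neg_neg hr hs⟩
    · exact ⟨_, sameOrbit_diag_xz_of_neg_zero hr⟩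
    · obtain ⟨s, hs, rfl⟩ := exists_sq_of_pos hc
      exact ⟨_, (sameOrbit_swap_xz ..).trans (sameOrbit_diag_xz_of_pos_neg hs hr)⟩
  · rcases lt_trichotomy c 0 with hc | rfl | hc
    · obtain ⟨s, hs, rfl⟩ := exists_neg_sq_of_neg hc
      exact ⟨_, (sameOrbit_swap_xz ..).trans (sameOrbit_diag_xz_of_neg_zero hs)⟩
    · refine ⟨.III, ?_⟩
      rw [span₂_comm]
      exact SameOrbit.refl _
    · obtain ⟨s, hs, rfl⟩ := exists_sq_of_pos hc
      exact ⟨_, (sameOrbit_swap_xz ..).trans (sameOrbit_diag_xz_of_pos_zero hs)⟩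
  · obtain ⟨r, hr, rfl⟩ := exists_sq_of_pos ha
    rcases lt_trichotomy c 0 with hc | rfl | hc
    · obtain ⟨s, hs, rfl⟩ := exists_neg_sq_of_neg hc
      exact ⟨_, sameOrbit_diag_xz_of_pos_neg hr hs⟩
    · exact ⟨_, sameOrbit_diag_xz_of_pos_zero hr⟩
    · obtain ⟨s, hs, rfl⟩ := exists_sq_of_pos hc
      exact ⟨_, sameOrbit_diag_xz_of_pos_pos hr hs⟩

/-- The point `(0, 1, 0)` where the lines cross is a base point, and the tangent of the conic there
is the line `x = 0`. -/
theorem sameOrbit_IV_of_xz {a c d e : ℝ} (hc : c ≠ 0) (hd : d ≠ 0) :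
    SameOrbit (span₂ (form a 0 c d e 0) (form 0 0 0 0 1 0)) OrbitName.IV.levy := by
  refine sameOrbit_of_subst (M := !![1, 0, 0; -a / d, -e / d, -c / d; 0, 1, 0])
    (a := -c) (b := 0) (c := 0) (d := 1) ?_ ?_ ?_ ?_
  · simp [Matrix.det_fin_three]
    exact ⟨hc, hd⟩
  · simpa using hc
  all_goals
    rw [subst_form, smul_form, smul_form, form_add_form, form_inj]
    refine ⟨?_, ?_, ?_, ?_, ?_, ?_⟩ <;> field_simp <;> ring

/-- Again the crossing point `(0, 1, 0)` is a base point, but the tangent `dx + kz = 0` of the conic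
is neither of the two lines. -/
theorem sameOrbit_II_of_xz {a c d e k : ℝ} (hd : d ≠ 0) (hk : k ≠ 0) :
    SameOrbit (span₂ (form a 0 c d e k) (form 0 0 0 0 1 0)) OrbitName.II.levy := by
  refine sameOrbit_of_subst (M := !![0, 1 / d, 0; 1, -a / d ^ 2, c / k ^ 2; 0, 0, -1 / k])
    (a := c / k ^ 2 + a / d ^ 2 - e / (d * k)) (b := 1) (c := -1 / (d * k)) (d := 0) ?_ ?_ ?_ ?_
  · simp [Matrix.det_fin_three]
    exact ⟨hd, hk⟩
  · simp
    exact ⟨hd, hk⟩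
  all_goals
    rw [subst_form, smul_form, smul_form, form_add_form, form_inj]
    refine ⟨?_, ?_, ?_, ?_, ?_, ?_⟩ <;> field_simp <;> ring

/-- Pencils that contain a pair of real lines. -/
theorem exists_sameOrbit_levy_of_xz {f : TernaryForm} (hf : disc f ≠ 0) :
    ∃ o : OrbitName, SameOrbit (span₂ f (form 0 0 0 0 1 0)) o.levy := by
  obtain ⟨a, b, c, d, e, k, rfl⟩ := exists_eq_form f
  rw [disc_form] at hf
  -- The alternative is whether the crossing point `(0, 1, 0)` of the lines is a base point. If it
  -- is not, completing the square in `y` and dropping the multiple of `xz` gives the diagonal case.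
  by_cases hb : b = 0
  · subst hb
    by_cases hd : d = 0
    · subst hd
      have ha : a ≠ 0 := by
        rintro rfl
        exact hf (by ring)
      have hk : k ≠ 0 := by
        rintro rfl
        exact hf (by ring)
      exact ⟨_, (sameOrbit_swap_xz ..).trans (sameOrbit_IV_of_xz ha hk)⟩
    · by_cases hk : k = 0
      · subst hk
        have hc : c ≠ 0 := by
          rintro rfl
          exact hf (by ring)
        exact ⟨_, sameOrbit_IV_of_xz hc hd⟩
      · exact ⟨_, sameOrbit_II_of_xz hd hk⟩
  · obtain ⟨o, ho⟩ := exists_sameOrbit_diag_xz ((a - d ^ 2 / (4 * b)) / b)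
      ((c - k ^ 2 / (4 * b)) / b)
    refine ⟨o, SameOrbit.trans ?_ ho⟩
    refine sameOrbit_of_subst (M := !![1, 0, 0; -d / (2 * b), 1, -k / (2 * b); 0, 0, 1])
      (a := b) (b := e - d * k / (2 * b)) (c := 0) (d := 1) ?_ ?_ ?_ ?_
    · simp [Matrix.det_fin_three]
    · simpa using hb
    all_goals
      rw [subst_form, smul_form, smul_form, form_add_form, form_inj]
      refine ⟨?_, ?_, ?_, ?_, ?_, ?_⟩ <;> field_simp <;> ring

theorem sameOrbit_Ia_of_sum_sq {u w : ℝ} (h : u ^ 2 + w ^ 2 ≠ 0) :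
    SameOrbit (span₂ (form (u ^ 2) 1 (w ^ 2) 0 (2 * u * w) 0) (form 1 0 1 0 0 0))
      OrbitName.Ia.levy := by
  generalize hn : u ^ 2 + w ^ 2 = n at h
  -- The new coordinates satisfy `ux + wz = Y`, `wx - uz = X - Z` and `y = X + Z`. They come from
  -- the real lines `y² = (wx - uz)²` of the pencil.
  refine sameOrbit_of_subst
    (M := !![w / n, u / n, -w / n; 1, 0, 1; -u / n, w / n, u / n])
    (a := 1) (b := 2) (c := 1 / n) (d := -2 / n) ?_ ?_ ?_ ?_
  · simp [Matrix.det_fin_three]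
    field_simp
    intro h0
    apply h
    nlinarith
  · field_simp
    norm_num [h]
  · rw [subst_form, smul_form, smul_form, form_add_form, form_inj]
    refine ⟨?_, ?_, ?_, ?_, ?_, ?_⟩ <;> field_simp <;> simp only [← hn] <;> ring
  · rw [subst_form, smul_form, smul_form, form_add_form, form_inj]
    refine ⟨?_, ?_, ?_, ?_, ?_, ?_⟩ <;> field_simp <;> simp only [← hn] <;> ring

theorem sameOrbit_IIa_of_sum_sq {a c d e k : ℝ} (h : d ^ 2 + k ^ 2 ≠ 0) :
    SameOrbit (span₂ (form a 0 c d e k) (form 1 0 1 0 0 0)) OrbitName.IIa.levy := by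
  generalize hn : d ^ 2 + k ^ 2 = n at h
  -- Here `dx + kz = Z` and `kx - dz = Y`, so the form is `Zy + αY² + βYZ + γZ²`. The middle row `y
  -- = X - βY + (α - γ)Z` turns it into `XZ + α(Y² + Z²)`.
  refine sameOrbit_of_subst
    (M := !![0, k / n, d / n;
      1, -(2 * a * d * k - 2 * c * d * k + e * (k ^ 2 - d ^ 2)) / n ^ 2,
        (a * k ^ 2 + c * d ^ 2 - e * k * d - (a * d ^ 2 + c * k ^ 2 + e * d * k)) / n ^ 2;
      0, -d / n, k / n])
    (a := (a * k ^ 2 + c * d ^ 2 - e * k * d) / n ^ 2) (b := 1) (c := 1 / n) (d := 0) ?_ ?_ ?_ ?_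
  · simp [Matrix.det_fin_three]
    field_simp
    intro h0
    apply h
    nlinarith
  · simpa using h
  · rw [subst_form, smul_form, smul_form, form_add_form, form_inj]
    refine ⟨?_, ?_, ?_, ?_, ?_, ?_⟩ <;> field_simp <;> simp only [← hn] <;> ring
  · rw [subst_form, smul_form, smul_form, form_add_form, form_inj]
    refine ⟨?_, ?_, ?_, ?_, ?_, ?_⟩ <;> field_simp <;> simp only [← hn] <;> ring

/-- A real binary quadratic form minus a multiple of the Euclidean norm is a square. -/
theorem exists_sq_add_smul_norm (a c e : ℝ) :
    ∃ s u w : ℝ, a + s = u ^ 2 ∧ c + s = w ^ 2 ∧ e = 2 * u * w := by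
  -- `D` is the difference of the two eigenvalues `(a + c ± D)/2`; taking `s` to be minus the
  -- smaller one makes the shifted form semidefinite of rank at most one.
  set D := √((a - c) ^ 2 + e ^ 2)
  have hD : D ^ 2 = (a - c) ^ 2 + e ^ 2 := Real.sq_sqrt (by positivity)
  have hD0 : 0 ≤ D := Real.sqrt_nonneg _
  have h1 : |a - c| ≤ D := Real.abs_le_sqrt (by nlinarith [sq_nonneg e])
  have h2 := abs_le.1 h1
  have hu : 0 ≤ (a - c + D) / 2 := by linarith
  have hw : 0 ≤ (c - a + D) / 2 := by linarith
  have hprod : (√((a - c + D) / 2) * √((c - a + D) / 2)) ^ 2 = (e / 2) ^ 2 := by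
    rw [mul_pow, Real.sq_sqrt hu, Real.sq_sqrt hw]
    linear_combination hD / 4
  rcases sq_eq_sq_iff_eq_or_eq_neg.1 hprod with h | h
  · refine ⟨(-(a + c) + D) / 2, √((a - c + D) / 2), √((c - a + D) / 2), ?_, ?_, ?_⟩
    · rw [Real.sq_sqrt hu]; ring
    · rw [Real.sq_sqrt hw]; ring
    · linear_combination -2 * h
  · refine ⟨(-(a + c) + D) / 2, √((a - c + D) / 2), -√((c - a + D) / 2), ?_, ?_, ?_⟩
    · rw [Real.sq_sqrt hu]; ring
    · rw [neg_sq, Real.sq_sqrt hw]; ring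
    · linear_combination 2 * h

/-- Pencils that contain a pair of conjugate imaginary lines. -/
theorem exists_sameOrbit_levy_of_sum_sq {f : TernaryForm} (hf : disc f ≠ 0) :
    ∃ o : OrbitName, SameOrbit (span₂ f (form 1 0 1 0 0 0)) o.levy := by
  obtain ⟨a, b, c, d, e, k, rfl⟩ := exists_eq_form f
  rw [disc_form] at hf
  by_cases hb : b = 0
  · subst hb
    refine ⟨_, sameOrbit_IIa_of_sum_sq fun h => hf ?_⟩
    have hd : d = 0 := by nlinarith
    have hk : k = 0 := by nlinarith
    rw [hd, hk]
    ring
  · obtain ⟨s, u, w, hu, hw, he⟩ := exists_sq_add_smul_norm ((a - d ^ 2 / (4 * b)) / b)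
      ((c - k ^ 2 / (4 * b)) / b) ((e - d * k / (2 * b)) / b)
    have key : SameOrbit (span₂ (form a b c d e k) (form 1 0 1 0 0 0))
        (span₂ (form (u ^ 2) 1 (w ^ 2) 0 (2 * u * w) 0) (form 1 0 1 0 0 0)) := by
      refine sameOrbit_of_subst (M := !![1, 0, 0; -d / (2 * b), 1, -k / (2 * b); 0, 0, 1])
        (a := b) (b := -s * b) (c := 0) (d := 1) ?_ ?_ ?_ ?_
      · simp [Matrix.det_fin_three]
      · simpa using hb
      · rw [subst_form, smul_form, smul_form, form_add_form, form_inj, ← hu, ← hw, ← he]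
        refine ⟨?_, ?_, ?_, ?_, ?_, ?_⟩ <;> field_simp <;> ring
      · rw [subst_form, smul_form, smul_form, form_add_form, form_inj]
        refine ⟨?_, ?_, ?_, ?_, ?_, ?_⟩ <;> ring
    -- If the square vanishes, the first form is `y²` and the pencil also contains a double line.
    by_cases h : u ^ 2 + w ^ 2 = 0
    · have hu0 : u = 0 := by nlinarith
      have hw0 : w = 0 := by nlinarith
      subst hu0 hw0
      refine ⟨.IIIa, key.trans ?_⟩
      refine sameOrbit_of_subst (M := !![1, 0, 0; 0, 0, 1; 0, 1, 0])
        (a := 0) (b := 1) (c := 1) (d := 0) ?_ ?_ ?_ ?_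
      · simp [Matrix.det_fin_three]
      · norm_num
      all_goals
        rw [subst_form, smul_form, smul_form, form_add_form, form_inj]
        refine ⟨?_, ?_, ?_, ?_, ?_, ?_⟩ <;> ring
    · exact ⟨_, key.trans (sameOrbit_Ia_of_sum_sq h)⟩

/-- The base points lie on the double line `z = 0`, where the conic restricts to `px² + qy²`:
tangency at one point if this is a square, at two real points if it is indefinite, at two conjugate
points if it is definite. Nondegeneracy excludes `p = q = 0`. -/
theorem exists_sameOrbit_levy_of_sq_of_diag {p q c e k : ℝ}
    (hf : disc (form p q c 0 e k) ≠ 0) :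
    ∃ o : OrbitName, SameOrbit (span₂ (form p q c 0 e k) (form 0 0 1 0 0 0)) o.levy := by
  rw [disc_form] at hf
  by_cases hq : q = 0
  · subst hq
    have hp : p ≠ 0 := by
      rintro rfl
      exact hf (by ring)
    have hk : k ≠ 0 := by
      rintro rfl
      exact hf (by ring)
    refine ⟨.V, ?_⟩
    refine sameOrbit_of_subst (M := !![0, 1, 0; 0, -e / k, -p / k; 1, 0, 0])
      (a := -p) (b := c) (c := 0) (d := 1) ?_ ?_ ?_ ?_
    · simp [Matrix.det_fin_three]
      exact ⟨hp, hk⟩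
    · simpa using hp
    all_goals
      rw [subst_form, smul_form, smul_form, form_add_form, form_inj]
      refine ⟨?_, ?_, ?_, ?_, ?_, ?_⟩ <;> field_simp <;> ring
  by_cases hp : p = 0
  · subst hp
    have he : e ≠ 0 := by
      rintro rfl
      exact hf (by ring)
    refine ⟨.V, ?_⟩
    refine sameOrbit_of_subst (M := !![0, -k / e, -q / e; 0, 1, 0; 1, 0, 0])
      (a := -q) (b := c) (c := 0) (d := 1) ?_ ?_ ?_ ?_
    · simp [Matrix.det_fin_three]
      exact ⟨hq, he⟩
    · simpa using hq
    all_goals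
      rw [subst_form, smul_form, smul_form, form_add_form, form_inj]
      refine ⟨?_, ?_, ?_, ?_, ?_, ?_⟩ <;> field_simp <;> ring
  rcases lt_or_gt_of_ne (div_ne_zero hp hq) with h | h
  · obtain ⟨r, hr, h⟩ := exists_neg_sq_of_neg h
    obtain rfl : p = -r ^ 2 * q := by
      rw [← h]
      field_simp
    refine ⟨.III, ?_⟩
    refine sameOrbit_of_subst (M := !![1, e / (2 * r ^ 2 * q), 1; r, -k / (2 * q), -r; 0, 1, 0])
      (a := -4 * r ^ 2 * q) (b := c - k ^ 2 / (4 * q) + e ^ 2 / (4 * r ^ 2 * q)) (c := 0) (d := 1)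
      ?_ ?_ ?_ ?_
    · simp [Matrix.det_fin_three]
      intro h0
      apply hr
      linarith
    · simpa using ⟨hr, hq⟩
    all_goals
      rw [subst_form, smul_form, smul_form, form_add_form, form_inj]
      refine ⟨?_, ?_, ?_, ?_, ?_, ?_⟩ <;> field_simp <;> ring
  · obtain ⟨r, hr, h⟩ := exists_sq_of_pos h
    obtain rfl : p = r ^ 2 * q := by
      rw [← h]
      field_simp
    refine ⟨.IIIa, ?_⟩
    refine sameOrbit_of_subst (M := !![1, 0, -e / (2 * r ^ 2 * q); 0, r, -k / (2 * q); 0, 0, 1])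
      (a := r ^ 2 * q) (b := c - k ^ 2 / (4 * q) - e ^ 2 / (4 * r ^ 2 * q)) (c := 0) (d := 1)
      ?_ ?_ ?_ ?_
    · simpa [Matrix.det_fin_three] using hr
    · simpa using ⟨hr, hq⟩
    all_goals
      rw [subst_form, smul_form, smul_form, form_add_form, form_inj]
      refine ⟨?_, ?_, ?_, ?_, ?_, ?_⟩ <;> field_simp <;> ring

/-- Pencils that contain a double line. -/
theorem exists_sameOrbit_levy_of_sq {f : TernaryForm} (hf : disc f ≠ 0) :
    ∃ o : OrbitName, SameOrbit (span₂ f (form 0 0 1 0 0 0)) o.levy := by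
  obtain ⟨a, b, c, d, e, k, rfl⟩ := exists_eq_form f
  -- A basis of the line `z = 0` that is orthogonal for the restriction of the form.
  have key : ∃ p q r s : ℝ, p * s - q * r ≠ 0 ∧
      2 * a * p * q + 2 * b * r * s + d * (p * s + q * r) = 0 := by
    by_cases ha : a = 0
    · by_cases hb : b = 0
      · exact ⟨1, 1, 1, -1, by norm_num, by rw [ha, hb]; ring⟩
      · exact ⟨1, 0, -d / (2 * b), 1, by norm_num, by field_simp; ring⟩
    · exact ⟨1, -d / (2 * a), 0, 1, by norm_num, by field_simp; ring⟩
  obtain ⟨p, q, r, s, h, h0⟩ := key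
  have hM : (!![p, q, 0; r, s, 0; 0, 0, 1] : Matrix (Fin 3) (Fin 3) ℝ).det ≠ 0 := by
    simpa [Matrix.det_fin_three] using h
  have hf' : disc (subst !![p, q, 0; r, s, 0; 0, 0, 1] (form a b c d e k)) ≠ 0 := by
    rw [disc_subst]
    exact mul_ne_zero (pow_ne_zero _ hM) hf
  have hS := sameOrbit_span₂_subst hM (form a b c d e k) (form 0 0 1 0 0 0)
  -- Written in the exact shape of the `xy` coefficient in `subst_form`, so that it can be rewritten
  -- to `0`.
  have hxy : 2 * a * p * q + 2 * b * r * s + 2 * c * 0 * 0 + d * (p * s + q * r)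
      + e * (p * 0 + q * 0) + k * (r * 0 + s * 0) = 0 := by linear_combination h0
  have hg : subst !![p, q, 0; r, s, 0; 0, 0, 1] (form 0 0 1 0 0 0) = form 0 0 1 0 0 0 := by
    rw [subst_form, form_inj]
    refine ⟨?_, ?_, ?_, ?_, ?_, ?_⟩ <;> ring
  rw [hg] at hS
  rw [subst_form, hxy] at hf' hS
  obtain ⟨o, ho⟩ := exists_sameOrbit_levy_of_sq_of_diag hf'
  exact ⟨o, hS.trans ho⟩


/-! ### Degenerate members of a pencil -/

theorem continuous_disc : Continuous disc :=
  Continuous.matrix_det continuous_subtype_val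

/-- A plane of forms contains a degenerate form. -/
theorem exists_degenerate {f g : TernaryForm} (h : LinearIndependent ℝ ![f, g]) :
    ∃ q ∈ span₂ f g, q ≠ 0 ∧ disc q = 0 := by
  -- Half a turn in the plane leads from `f` to `-f`, and the discriminant, being cubic, changes
  -- sign on the way.
  let F : ℝ → TernaryForm := fun t => Real.cos t • f + Real.sin t • g
  have hF : Continuous fun t => disc (F t) :=
    continuous_disc.comp ((Real.continuous_cos.smul continuous_const).add
      (Real.continuous_sin.smul continuous_const))
  have h0 : F 0 = f := by simp [F]
  have hpi : disc (F Real.pi) = -disc f := by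
    have : F Real.pi = (-1 : ℝ) • f := by simp [F]
    rw [this, disc_smul]
    ring
  have hmem : (0 : ℝ) ∈ Set.uIcc (disc (F 0)) (disc (F Real.pi)) := by
    rw [h0, hpi, Set.mem_uIcc]
    rcases le_total 0 (disc f) with h | h
    · exact Or.inr ⟨by linarith, h⟩
    · exact Or.inl ⟨h, by linarith⟩
  obtain ⟨t, -, ht⟩ := intermediate_value_uIcc hF.continuousOn hmem
  refine ⟨F t, mem_span₂.2 ⟨_, _, rfl⟩, fun hz => ?_, ht⟩
  obtain ⟨hc, hs⟩ := LinearIndependent.pair_iff.1 h _ _ hz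
  have := Real.sin_sq_add_cos_sq t
  rw [hc, hs] at this
  norm_num at this

/-- Principal axes. -/
theorem exists_subst_diag (q : TernaryForm) :
    ∃ M : Matrix (Fin 3) (Fin 3) ℝ, M.det ≠ 0 ∧ ∃ a b c, subst M q = form a b c 0 0 0 := by
  have hq : q.1.IsHermitian := q.2
  let U := hq.eigenvectorUnitary
  refine ⟨U.1, ?_, hq.eigenvalues 0, hq.eigenvalues 1, hq.eigenvalues 2, ?_⟩
  · have h : star U.1 * U.1 = 1 := Unitary.coe_star_mul_self U
    intro h0
    have := congrArg Matrix.det h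
    rw [Matrix.det_mul, h0, Matrix.det_one, mul_zero] at this
    exact zero_ne_one this
  · have h := hq.conjStarAlgAut_star_eigenvectorUnitary
    rw [Unitary.conjStarAlgAut_star_apply] at h
    apply Subtype.ext
    have h' : U.1.transpose * q.1 * U.1 = Matrix.diagonal hq.eigenvalues := h
    show U.1.transpose * q.1 * U.1 = _
    rw [h']
    ext i j
    fin_cases i <;> fin_cases j <;> simp [form]

theorem exists_subst_of_xz_diag {a c : ℝ} (h : a ≠ 0 ∨ c ≠ 0) :
    ∃ M : Matrix (Fin 3) (Fin 3) ℝ, M.det ≠ 0 ∧ ∃ r : ℝ, r ≠ 0 ∧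
      (subst M (form a 0 c 0 0 0) = r • form 0 0 0 0 1 0 ∨
        subst M (form a 0 c 0 0 0) = r • form 1 0 1 0 0 0 ∨
        subst M (form a 0 c 0 0 0) = r • form 0 0 1 0 0 0) := by
  by_cases ha : a = 0
  · subst ha
    have hc : c ≠ 0 := by tauto
    refine ⟨1, by simp, c, hc, Or.inr (Or.inr ?_)⟩
    rw [subst_one, smul_form]
    simp
  by_cases hc : c = 0
  · subst hc
    refine ⟨!![0, 0, 1; 0, 1, 0; 1, 0, 0], by simp [Matrix.det_fin_three], a, ha,
      Or.inr (Or.inr ?_)⟩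
    rw [subst_form, smul_form, form_inj]
    refine ⟨?_, ?_, ?_, ?_, ?_, ?_⟩ <;> ring
  rcases lt_or_gt_of_ne (div_ne_zero ha hc) with h | h
  · obtain ⟨r, hr, h⟩ := exists_neg_sq_of_neg h
    obtain rfl : a = -r ^ 2 * c := by
      rw [← h]
      field_simp
    refine ⟨!![1, 0, 1; 0, 1, 0; r, 0, -r], ?_, -4 * r ^ 2 * c, by simpa using ⟨hr, hc⟩,
      Or.inl ?_⟩
    · simp [Matrix.det_fin_three]
      intro h0
      apply hr
      linarith
    · rw [subst_form, smul_form, form_inj]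
      refine ⟨?_, ?_, ?_, ?_, ?_, ?_⟩ <;> ring
  · obtain ⟨r, hr, h⟩ := exists_sq_of_pos h
    obtain rfl : a = r ^ 2 * c := by
      rw [← h]
      field_simp
    refine ⟨!![1, 0, 0; 0, 1, 0; 0, 0, r], by simpa [Matrix.det_fin_three] using hr,
      r ^ 2 * c, by simpa using ⟨hr, hc⟩, Or.inr (Or.inl ?_)⟩
    rw [subst_form, smul_form, form_inj]
    refine ⟨?_, ?_, ?_, ?_, ?_, ?_⟩ <;> ring

theorem subst_ne_zero {M : Matrix (Fin 3) (Fin 3) ℝ} (hM : M.det ≠ 0) {q : TernaryForm}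
    (hq : q ≠ 0) : subst M q ≠ 0 := by
  intro h
  apply hq
  rw [← subst_inv_subst hM q, h]
  exact Subtype.ext (by simp [subst])

/-- After diagonalization one of the three coefficients is zero; a permutation makes it that of
`y²`, and the signs of the other two decide the type. -/
theorem exists_subst_of_degenerate {q : TernaryForm} (hq : q ≠ 0) (hd : disc q = 0) :
    ∃ M : Matrix (Fin 3) (Fin 3) ℝ, M.det ≠ 0 ∧ ∃ r : ℝ, r ≠ 0 ∧
      (subst M q = r • form 0 0 0 0 1 0 ∨ subst M q = r • form 1 0 1 0 0 0 ∨
        subst M q = r • form 0 0 1 0 0 0) := by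
  obtain ⟨M, hM, a, b, c, h⟩ := exists_subst_diag q
  have hd' := disc_subst M q
  have hz := subst_ne_zero hM hq
  rw [h, hd, disc_form] at hd'
  rw [h, Ne, form_eq_zero] at hz
  have key : ∃ N : Matrix (Fin 3) (Fin 3) ℝ, N.det ≠ 0 ∧ ∃ a' c' : ℝ, (a' ≠ 0 ∨ c' ≠ 0) ∧
      subst N (form a b c 0 0 0) = form a' 0 c' 0 0 0 := by
    have h3 : a * b * c = 0 := by linarith
    rcases mul_eq_zero.1 h3 with h3 | rfl
    · rcases mul_eq_zero.1 h3 with rfl | rfl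
      · refine ⟨!![0, 1, 0; 1, 0, 0; 0, 0, 1], by simp [Matrix.det_fin_three], b, c, by tauto, ?_⟩
        rw [subst_form, form_inj]
        refine ⟨?_, ?_, ?_, ?_, ?_, ?_⟩ <;> ring
      · exact ⟨1, by simp, a, c, by tauto, subst_one _⟩
    · refine ⟨!![1, 0, 0; 0, 0, 1; 0, 1, 0], by simp [Matrix.det_fin_three], a, b, by tauto, ?_⟩
      rw [subst_form, form_inj]
      refine ⟨?_, ?_, ?_, ?_, ?_, ?_⟩ <;> ring
  obtain ⟨N, hN, a', c', hac, h'⟩ := key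
  obtain ⟨K, hK, r, hr, H⟩ := exists_subst_of_xz_diag hac
  refine ⟨M * N * K, ?_, r, hr, ?_⟩
  · rw [Matrix.det_mul, Matrix.det_mul]
    exact mul_ne_zero (mul_ne_zero hM hN) hK
  · rwa [← subst_subst, ← subst_subst, h, h']

/-- A nondegenerate pencil is in the orbit of one of the nine named pencils. -/
theorem exists_sameOrbit_levy {W : Submodule ℝ TernaryForm} (hW : IsNondegeneratePencil W) :
    ∃ o : OrbitName, SameOrbit W o.levy := by
  obtain ⟨h2, f, hf, hfd⟩ := hW
  have key : ∃ g ∈ W, g ≠ 0 ∧ disc g = 0 := by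
    have hne : Submodule.span ℝ {(⟨f, hf⟩ : W)} ≠ ⊤ := by
      intro htop
      have h1 := finrank_span_le_card (R := ℝ) ({(⟨f, hf⟩ : W)} : Set W)
      rw [htop, finrank_top, h2] at h1
      simp at h1
    obtain ⟨⟨r, hr⟩, hrn⟩ := SetLike.exists_not_mem_of_ne_top _ hne rfl
    have hi : LinearIndependent ℝ ![f, r] := by
      rw [LinearIndependent.pair_iff' (ne_zero_of_disc hfd)]
      intro a ha
      exact hrn (Submodule.mem_span_singleton.2 ⟨a, Subtype.ext ha⟩)
    rw [eq_span₂ h2 hf hr hi]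
    exact exists_degenerate hi
  obtain ⟨g, hg, hg0, hgd⟩ := key
  have hi : LinearIndependent ℝ ![g, f] := by
    rw [LinearIndependent.pair_iff' hg0]
    rintro a rfl
    rw [disc_smul, hgd, mul_zero] at hfd
    exact hfd rfl
  rw [eq_span₂ h2 hg hf hi, span₂_comm]
  obtain ⟨M, hM, r, hr, H⟩ := exists_subst_of_degenerate hg0 hgd
  have hS := sameOrbit_span₂_subst hM f g
  have hfd' : disc (subst M f) ≠ 0 := by
    rw [disc_subst]
    exact mul_ne_zero (pow_ne_zero _ hM) hfd
  -- The factor `r` of the normal form of the degenerate member does not change the pencil.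
  have hspan (g₀ : TernaryForm) : span₂ (subst M f) (r • g₀) = span₂ (subst M f) g₀ :=
    span₂_eq_of_combination (a := 1) (b := 0) (c := 0) (d := r) (by simpa using hr)
      (by simp) (by simp)
  rcases H with H | H | H <;> rw [H, hspan] at hS
  · obtain ⟨o, ho⟩ := exists_sameOrbit_levy_of_xz hfd'
    exact ⟨o, hS.trans ho⟩
  · obtain ⟨o, ho⟩ := exists_sameOrbit_levy_of_sum_sq hfd'
    exact ⟨o, hS.trans ho⟩
  · obtain ⟨o, ho⟩ := exists_sameOrbit_levy_of_sq hfd'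
    exact ⟨o, hS.trans ho⟩


/-! ### Intersection multiplicities under changes of variables -/

/-- Length is the Krull dimension of the lattice of submodules, and a bijection that is semilinear
along `e` identifies the two lattices. -/
theorem length_quotient_map_ringEquiv {A B : Type*} [CommRing A] [CommRing B] (e : A ≃+* B)
    (I : Ideal A) :
    Module.length A (A ⧸ I) = Module.length B (B ⧸ I.map (e : A →+* B)) := by
  let E := Ideal.quotientEquiv I (I.map (e : A →+* B)) e rfl
  have : RingHomSurjective (e : A →+* B) := ⟨e.surjective⟩
  let f : (A ⧸ I) →ₛₗ[(e : A →+* B)] (B ⧸ I.map (e : A →+* B)) :=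
    { toFun := E
      map_add' := map_add E
      map_smul' := by
        intro a x
        obtain ⟨x, rfl⟩ := Ideal.Quotient.mk_surjective x
        rw [Algebra.smul_def, Algebra.smul_def, map_mul]
        rfl }
  rw [Module.length, Module.length, WithBot.unbot_inj,
    Order.krullDim_eq_of_orderIso (Submodule.orderIsoMapComapOfBijective f E.bijective)]

theorem eval_aeval_line (v : Fin 3 → ℂ) (F : MvPolynomial (Fin 3) ℂ) (t : ℂ) :
    (MvPolynomial.aeval (R := ℂ) (fun i => Polynomial.C (v i) * Polynomial.X) F).eval t =
      MvPolynomial.eval (t • v) F := by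
  have : (Polynomial.aeval t).comp (MvPolynomial.aeval (R := ℂ)
      (fun i => Polynomial.C (v i) * Polynomial.X)) = MvPolynomial.aeval (t • v) := by
    ext i
    rw [AlgHom.comp_apply, MvPolynomial.aeval_X, MvPolynomial.aeval_X, map_mul,
      Polynomial.aeval_C, Polynomial.aeval_X]
    exact mul_comm _ _
  rw [← Polynomial.coe_aeval_eq_eval, ← MvPolynomial.coe_aeval_eq_eval]
  exact DFunLike.congr_fun this F

/-- Frees `pointIdeal` from the chosen representative `rep`: it is a nonzero multiple of `v`,
absorbed by the parameter `t`, and a complex polynomial in one variable is determined by its values.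
-/
theorem mem_pointIdeal_mk {v : Fin 3 → ℂ} (hv : v ≠ 0) {F : MvPolynomial (Fin 3) ℂ} :
    F ∈ pointIdeal (Projectivization.mk ℂ v hv) ↔ ∀ t : ℂ, MvPolynomial.eval (t • v) F = 0 := by
  obtain ⟨a, ha⟩ := Projectivization.exists_smul_eq_mk_rep ℂ v hv
  have h1 : F ∈ pointIdeal (Projectivization.mk ℂ v hv) ↔
      ∀ t : ℂ, MvPolynomial.eval (t • (a • v)) F = 0 := by
    rw [ha]
    constructor
    · intro h t
      have h' : MvPolynomial.aeval (R := ℂ) (fun i => Polynomial.C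
        ((Projectivization.mk ℂ v hv).rep i) * Polynomial.X) F = 0 := h
      rw [← eval_aeval_line, h', Polynomial.eval_zero]
    · intro h
      show MvPolynomial.aeval (R := ℂ) (fun i => Polynomial.C
        ((Projectivization.mk ℂ v hv).rep i) * Polynomial.X) F = 0
      apply Polynomial.funext
      intro t
      rw [eval_aeval_line, h, Polynomial.eval_zero]
  rw [h1]
  constructor
  · intro h t
    have := h (t * (a : ℂ)⁻¹)
    rwa [Units.smul_def, smul_smul, mul_assoc, inv_mul_cancel₀ a.ne_zero, mul_one] at this
  · intro h t
    rw [Units.smul_def, smul_smul]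
    exact h _

/-- The substitution of variables `F ↦ F ∘ M`. -/
noncomputable def polySubst (M : Matrix (Fin 3) (Fin 3) ℂ) :
    MvPolynomial (Fin 3) ℂ →ₐ[ℂ] MvPolynomial (Fin 3) ℂ :=
  MvPolynomial.aeval fun i => ∑ j, MvPolynomial.C (M i j) * MvPolynomial.X j

theorem eval_polySubst (M : Matrix (Fin 3) (Fin 3) ℂ) (w : Fin 3 → ℂ)
    (F : MvPolynomial (Fin 3) ℂ) :
    MvPolynomial.eval w (polySubst M F) = MvPolynomial.eval (M.mulVec w) F := by
  have : (MvPolynomial.aeval w).comp (polySubst M) =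
      (MvPolynomial.aeval (M.mulVec w) : MvPolynomial (Fin 3) ℂ →ₐ[ℂ] ℂ) := by
    ext i
    simp [polySubst, Matrix.mulVec, dotProduct]
  have h := DFunLike.congr_fun this F
  simpa [MvPolynomial.aeval_eq_eval] using h

/-- An invertible substitution of variables. -/
noncomputable def polyEquiv (M : Matrix (Fin 3) (Fin 3) ℂ) (hM : IsUnit M.det) :
    MvPolynomial (Fin 3) ℂ ≃ₐ[ℂ] MvPolynomial (Fin 3) ℂ :=
  AlgEquiv.ofAlgHom (polySubst M) (polySubst M⁻¹)
    (AlgHom.ext fun F => MvPolynomial.funext fun w => by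
      simp [eval_polySubst, Matrix.mulVec_mulVec, Matrix.nonsing_inv_mul _ hM])
    (AlgHom.ext fun F => MvPolynomial.funext fun w => by
      simp [eval_polySubst, Matrix.mulVec_mulVec, Matrix.mul_nonsing_inv _ hM])

theorem mulVec_ne_zero {M : Matrix (Fin 3) (Fin 3) ℂ} (hM : IsUnit M.det) {v : Fin 3 → ℂ}
    (hv : v ≠ 0) : M.mulVec v ≠ 0 := by
  intro h
  apply hv
  have := congrArg (M⁻¹.mulVec) h
  rwa [Matrix.mulVec_mulVec, Matrix.nonsing_inv_mul _ hM, Matrix.one_mulVec,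
    Matrix.mulVec_zero] at this

/-- `F` vanishes on the line of `M v` exactly when `F ∘ M` vanishes on the line of `v`, so the
substitution induces an isomorphism of the two local rings. -/
theorem localLength_map (M : Matrix (Fin 3) (Fin 3) ℂ) (hM : IsUnit M.det) {v : Fin 3 → ℂ}
    (hv : v ≠ 0) (J : Ideal (MvPolynomial (Fin 3) ℂ)) :
    localLength (Projectivization.mk ℂ v hv) (J.map (polySubst M)) =
      localLength (Projectivization.mk ℂ (M.mulVec v) (mulVec_ne_zero hM hv)) J := by
  let e := (polyEquiv M hM).toRingEquiv
  have he (F : MvPolynomial (Fin 3) ℂ) : e F = polySubst M F := rfl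
  have hI : pointIdeal (Projectivization.mk ℂ (M.mulVec v) (mulVec_ne_zero hM hv)) =
      (pointIdeal (Projectivization.mk ℂ v hv)).comap e := by
    ext F
    rw [Ideal.mem_comap, mem_pointIdeal_mk, mem_pointIdeal_mk]
    simp only [he, eval_polySubst, Matrix.mulVec_smul]
  let E := Localization.localRingEquiv _ _ e hI
  rw [localLength, localLength, length_quotient_map_ringEquiv E]
  have : (J.map (polySubst M)).map (algebraMap (MvPolynomial (Fin 3) ℂ)
      (Localization.AtPrime (pointIdeal (Projectivization.mk ℂ v hv)))) =
      (J.map (algebraMap (MvPolynomial (Fin 3) ℂ) (Localization.AtPrime (pointIdeal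
        (Projectivization.mk ℂ (M.mulVec v) (mulVec_ne_zero hM hv)))))).map
          (E : _ →+* Localization.AtPrime (pointIdeal (Projectivization.mk ℂ v hv))) := by
    rw [Ideal.map_map]
    show (J.map (polySubst M).toRingHom).map _ = _
    rw [Ideal.map_map]
    congr 1
    exact RingHom.ext fun F => (Localization.localRingHom_to_map _ _ _ hI F).symm
  rw [this]

/-- The value of a real form at a complex vector. -/
noncomputable def complexValue (q : TernaryForm) (w : Fin 3 → ℂ) : ℂ :=
  w ⬝ᵥ ((q.1.map ((↑) : ℝ → ℂ)).mulVec w)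

theorem eval_toPoly (q : TernaryForm) (w : Fin 3 → ℂ) :
    MvPolynomial.eval w (toPoly q) = complexValue q w := by
  simp [toPoly, complexValue, dotProduct, Matrix.mulVec, Fin.sum_univ_three]
  ring

/-- The matrix with the same entries, seen as complex numbers. -/
noncomputable def toComplex (M : Matrix (Fin 3) (Fin 3) ℝ) : Matrix (Fin 3) (Fin 3) ℂ :=
  M.map Complex.ofRealHom

theorem toComplex_mul (M N : Matrix (Fin 3) (Fin 3) ℝ) :
    toComplex (M * N) = toComplex M * toComplex N := Matrix.map_mul

theorem isUnit_det_toComplex {M : Matrix (Fin 3) (Fin 3) ℝ} (hM : M.det ≠ 0) :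
    IsUnit (toComplex M).det := by
  have : (toComplex M).det = Complex.ofRealHom M.det := (RingHom.map_det _ _).symm
  rw [this, isUnit_iff_ne_zero]
  simpa using hM

theorem complexValue_subst (M : Matrix (Fin 3) (Fin 3) ℝ) (q : TernaryForm) (w : Fin 3 → ℂ) :
    complexValue (subst M q) w = complexValue q ((toComplex M).mulVec w) := by
  have h (q : TernaryForm) : complexValue q = fun w => w ⬝ᵥ ((toComplex q.1).mulVec w) := rfl
  have ht : toComplex M.transpose = (toComplex M).transpose := rfl
  simp only [h, subst]
  rw [toComplex_mul, toComplex_mul, ht, ← Matrix.mulVec_mulVec, ← Matrix.mulVec_mulVec,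
    Matrix.dotProduct_mulVec, Matrix.vecMul_transpose]

theorem toPoly_subst (M : Matrix (Fin 3) (Fin 3) ℝ) (q : TernaryForm) :
    toPoly (subst M q) = polySubst (toComplex M) (toPoly q) :=
  MvPolynomial.funext fun w => by
    rw [eval_toPoly, complexValue_subst, eval_polySubst, eval_toPoly]

theorem toPoly_combination (a b : ℝ) (f g : TernaryForm) :
    toPoly (a • f + b • g) =
      MvPolynomial.C (a : ℂ) * toPoly f + MvPolynomial.C (b : ℂ) * toPoly g := by
  apply MvPolynomial.funext
  intro w
  simp [eval_toPoly, complexValue, dotProduct, Matrix.mulVec, Fin.sum_univ_three]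
  ring

/-- The homogeneous ideal of the base points of a pencil. -/
noncomputable def pencilIdeal (W : Submodule ℝ TernaryForm) : Ideal (MvPolynomial (Fin 3) ℂ) :=
  Ideal.span (toPoly '' W)

theorem pencilIdeal_span₂ (f g : TernaryForm) :
    pencilIdeal (span₂ f g) = Ideal.span {toPoly f, toPoly g} := by
  apply le_antisymm
  · rw [pencilIdeal, Ideal.span_le]
    rintro _ ⟨q, hq, rfl⟩
    obtain ⟨a, b, rfl⟩ := mem_span₂.1 hq
    rw [toPoly_combination]
    exact Ideal.add_mem _ (Ideal.mul_mem_left _ _ (Ideal.subset_span (by simp)))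
      (Ideal.mul_mem_left _ _ (Ideal.subset_span (by simp)))
  · rw [Ideal.span_le]
    rintro _ (rfl | rfl)
    · exact Ideal.subset_span ⟨f, Submodule.subset_span (by simp), rfl⟩
    · exact Ideal.subset_span ⟨g, Submodule.subset_span (by simp), rfl⟩

theorem pencilIdeal_map (P : Matrix.GeneralLinearGroup (Fin 3) ℝ) (W : Submodule ℝ TernaryForm) :
    pencilIdeal (W.map (changeVars P)) = (pencilIdeal W).map (polySubst (toComplex P.1)) := by
  rw [pencilIdeal, pencilIdeal, Ideal.map_span]
  congr 1
  ext F
  constructor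
  · rintro ⟨_, ⟨q, hq, rfl⟩, rfl⟩
    exact ⟨_, ⟨q, hq, rfl⟩, (toPoly_subst _ _).symm⟩
  · rintro ⟨_, ⟨q, hq, rfl⟩, rfl⟩
    exact ⟨_, ⟨q, hq, rfl⟩, toPoly_subst _ _⟩

/-- The number of real points of multiplicity `m` in the base locus of a pencil. -/
noncomputable def pencilRealCount (W : Submodule ℝ TernaryForm) (m : ℕ) : ℕ∞ :=
  {p : ℙ ℂ (Fin 3 → ℂ) | IsRealPoint p ∧ localLength p (pencilIdeal W) = m}.encard

/-- The number of imaginary points of multiplicity `m` in the base locus of a pencil. -/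
noncomputable def pencilImagCount (W : Submodule ℝ TernaryForm) (m : ℕ) : ℕ∞ :=
  {p : ℙ ℂ (Fin 3 → ℂ) | ¬ IsRealPoint p ∧ localLength p (pencilIdeal W) = m}.encard

theorem submodule_sup_eq_span₂ (C D : Conic) : C.submodule ⊔ D.submodule = span₂ C.rep D.rep := by
  rw [Projectivization.submodule_eq, Projectivization.submodule_eq, ← Submodule.span_union,
    Set.singleton_union]

theorem multiplicity_eq_localLength (C D : Conic) (p : ℙ ℂ (Fin 3 → ℂ)) :
    multiplicity C D p = localLength p (pencilIdeal (C.submodule ⊔ D.submodule)) := by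
  rw [multiplicity, submodule_sup_eq_span₂, pencilIdeal_span₂]

theorem realCount_eq (C D : Conic) (m : ℕ) :
    realCount (C, D) m = pencilRealCount (C.submodule ⊔ D.submodule) m := by
  simp only [realCount, pencilRealCount, multiplicity_eq_localLength]

theorem imagCount_eq (C D : Conic) (m : ℕ) :
    imagCount (C, D) m = pencilImagCount (C.submodule ⊔ D.submodule) m := by
  simp only [imagCount, pencilImagCount, multiplicity_eq_localLength]

theorem isRealPoint_mk_iff {v : Fin 3 → ℂ} (hv : v ≠ 0) :
    IsRealPoint (Projectivization.mk ℂ v hv) ↔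
      ∃ (a : ℂ) (w : Fin 3 → ℝ), v = a • fun i => (w i : ℂ) := by
  constructor
  · rintro ⟨w, hw, h⟩
    obtain ⟨a, ha⟩ := (Projectivization.mk_eq_mk_iff' ℂ _ _ hv hw).1 h
    exact ⟨a, w, ha.symm⟩
  · rintro ⟨a, w, h⟩
    have hw : (fun i => (w i : ℂ)) ≠ 0 := by
      intro h0
      rw [h0, smul_zero] at h
      exact hv h
    exact ⟨w, hw, (Projectivization.mk_eq_mk_iff' ℂ _ _ hv hw).2 ⟨a, h.symm⟩⟩

theorem mulVec_toComplex (M : Matrix (Fin 3) (Fin 3) ℝ) (w : Fin 3 → ℝ) :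
    (toComplex M).mulVec (fun i => (w i : ℂ)) = fun i => ((M.mulVec w i : ℝ) : ℂ) := by
  ext i
  simp [Matrix.mulVec, dotProduct, toComplex]

theorem isRealPoint_mulVec_iff {M : Matrix (Fin 3) (Fin 3) ℝ} (hM : M.det ≠ 0) {v : Fin 3 → ℂ}
    (hv : v ≠ 0) :
    IsRealPoint (Projectivization.mk ℂ ((toComplex M).mulVec v)
      (mulVec_ne_zero (isUnit_det_toComplex hM) hv)) ↔
      IsRealPoint (Projectivization.mk ℂ v hv) := by
  rw [isRealPoint_mk_iff, isRealPoint_mk_iff]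
  constructor
  · rintro ⟨a, w, h⟩
    refine ⟨a, M⁻¹.mulVec w, ?_⟩
    have := congrArg ((toComplex M⁻¹).mulVec) h
    rw [Matrix.mulVec_mulVec, ← toComplex_mul, Matrix.nonsing_inv_mul _ (isUnit_iff_ne_zero.2 hM),
      Matrix.mulVec_smul, mulVec_toComplex] at this
    rw [← this]
    simp [toComplex]
  · rintro ⟨a, w, rfl⟩
    exact ⟨a, M.mulVec w, by rw [Matrix.mulVec_smul, mulVec_toComplex]⟩

/-- The real or imaginary points of given multiplicity move with changes of variables. -/
theorem encard_le_of_map (P : Matrix.GeneralLinearGroup (Fin 3) ℝ) (W : Submodule ℝ TernaryForm)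
    (r : Prop → Prop) (m : ℕ) :
    {p : ℙ ℂ (Fin 3 → ℂ) | r (IsRealPoint p) ∧
      localLength p (pencilIdeal (W.map (changeVars P))) = m}.encard ≤
    {p : ℙ ℂ (Fin 3 → ℂ) | r (IsRealPoint p) ∧ localLength p (pencilIdeal W) = m}.encard := by
  have hP : P.1.det ≠ 0 := P.det.ne_zero
  have hU := isUnit_det_toComplex hP
  have hinj : Function.Injective (toComplex P.1).mulVecLin := by
    rw [← LinearMap.ker_eq_bot, LinearMap.ker_eq_bot']
    intro v hv
    by_contra h
    exact mulVec_ne_zero hU h hv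
  refine Set.encard_le_encard_of_injOn (f := Projectivization.map _ hinj) ?_
    (Projectivization.map_injective _ hinj).injOn
  intro p
  induction p using Projectivization.ind with
  | h v hv =>
    rintro ⟨h1, h2⟩
    rw [Projectivization.map_mk]
    rw [pencilIdeal_map, localLength_map _ hU hv] at h2
    refine ⟨?_, h2⟩
    have := isRealPoint_mulVec_iff hP hv
    have h3 : IsRealPoint (Projectivization.mk ℂ ((toComplex P.1).mulVecLin v)
      (mulVec_ne_zero hU hv)) = IsRealPoint (Projectivization.mk ℂ v hv) := propext this
    show r (IsRealPoint (Projectivization.mk ℂ ((toComplex P.1).mulVecLin v) _))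
    rw [h3]
    exact h1

/-- One inequality serves for both counts and both directions: `r` is `id` for real and `Not` for
imaginary points, and orbits are symmetric. -/
theorem SameOrbit.encard_le {W W' : Submodule ℝ TernaryForm} (h : SameOrbit W W')
    (r : Prop → Prop) (m : ℕ) :
    {p : ℙ ℂ (Fin 3 → ℂ) | r (IsRealPoint p) ∧ localLength p (pencilIdeal W') = m}.encard ≤
    {p : ℙ ℂ (Fin 3 → ℂ) | r (IsRealPoint p) ∧ localLength p (pencilIdeal W) = m}.encard := by
  obtain ⟨P, rfl⟩ := h
  exact encard_le_of_map P W r m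

theorem SameOrbit.pencilRealCount_eq {W W' : Submodule ℝ TernaryForm} (h : SameOrbit W W')
    (m : ℕ) : pencilRealCount W m = pencilRealCount W' m :=
  le_antisymm (h.symm.encard_le id m) (h.encard_le id m)

theorem SameOrbit.pencilImagCount_eq {W W' : Submodule ℝ TernaryForm} (h : SameOrbit W W')
    (m : ℕ) : pencilImagCount W m = pencilImagCount W' m :=
  le_antisymm (h.symm.encard_le Not m) (h.encard_le Not m)

theorem sameIntersections_of_sameOrbit {C D C' D' : Conic}
    (h : SameOrbit (C.submodule ⊔ D.submodule) (C'.submodule ⊔ D'.submodule)) :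
    SameIntersections (C, D) (C', D') := by
  intro m _
  rw [realCount_eq, realCount_eq, imagCount_eq, imagCount_eq]
  exact ⟨h.pencilRealCount_eq m, h.pencilImagCount_eq m⟩


/-! ### Criteria for local lengths -/

theorem mem_pointIdeal_mk_iff_aeval {v : Fin 3 → ℂ} (hv : v ≠ 0) {F : MvPolynomial (Fin 3) ℂ} :
    F ∈ pointIdeal (Projectivization.mk ℂ v hv) ↔
      MvPolynomial.aeval (R := ℂ) (fun i => Polynomial.C (v i) * Polynomial.X) F = 0 := by
  rw [mem_pointIdeal_mk]
  constructor
  · intro h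
    apply Polynomial.funext
    intro t
    rw [eval_aeval_line, h, Polynomial.eval_zero]
  · intro h t
    rw [← eval_aeval_line, h, Polynomial.eval_zero]

theorem mem_map_localization_iff {p : ℙ ℂ (Fin 3 → ℂ)} {J : Ideal (MvPolynomial (Fin 3) ℂ)}
    {F : MvPolynomial (Fin 3) ℂ} :
    algebraMap _ (Localization.AtPrime (pointIdeal p)) F ∈
      J.map (algebraMap (MvPolynomial (Fin 3) ℂ) (Localization.AtPrime (pointIdeal p))) ↔
    ∃ u ∉ pointIdeal p, u * F ∈ J := by
  rw [IsLocalization.algebraMap_mem_map_algebraMap_iff (pointIdeal p).primeCompl]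
  rfl

theorem localLength_eq_zero_iff {p : ℙ ℂ (Fin 3 → ℂ)} {J : Ideal (MvPolynomial (Fin 3) ℂ)} :
    localLength p J = 0 ↔ ¬ J ≤ pointIdeal p := by
  rw [localLength, Module.length_eq_zero_iff, Ideal.Quotient.subsingleton_iff,
    Ideal.eq_top_iff_one, ← map_one (algebraMap (MvPolynomial (Fin 3) ℂ) _),
    mem_map_localization_iff, SetLike.not_le_iff_exists]
  simp only [mul_one]
  exact ⟨fun ⟨u, h, h'⟩ => ⟨u, h', h⟩, fun ⟨u, h, h'⟩ => ⟨u, h', h⟩⟩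

theorem map_pointIdeal (p : ℙ ℂ (Fin 3 → ℂ)) :
    (pointIdeal p).map (algebraMap _ (Localization.AtPrime (pointIdeal p))) =
      IsLocalRing.maximalIdeal (Localization.AtPrime (pointIdeal p)) :=
  Localization.AtPrime.map_eq_maximalIdeal

/-- The ideal of a point is generated by linear forms. -/
theorem pointIdeal_le {v : Fin 3 → ℂ} (hv : v ≠ 0) {k : Fin 3}
    {I : Ideal (MvPolynomial (Fin 3) ℂ)}
    (h : ∀ j, MvPolynomial.X j - MvPolynomial.C (v j) * MvPolynomial.X k ∈ I) :
    pointIdeal (Projectivization.mk ℂ v hv) ≤ I := by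
  intro F hF
  rw [mem_pointIdeal_mk] at hF
  -- `φ` is the projection `w ↦ w k • v` onto the line of `v`. It kills `F`, which vanishes on that
  -- line, and it is the identity modulo `I`.
  let φ : MvPolynomial (Fin 3) ℂ →ₐ[ℂ] MvPolynomial (Fin 3) ℂ :=
    MvPolynomial.aeval fun j => MvPolynomial.C (v j) * MvPolynomial.X k
  have h0 : φ F = 0 := by
    apply MvPolynomial.funext
    intro w
    have : (MvPolynomial.aeval w).comp φ =
        (MvPolynomial.aeval (w k • v) : MvPolynomial (Fin 3) ℂ →ₐ[ℂ] ℂ) := by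
      ext i
      simp [φ, mul_comm]
    rw [← MvPolynomial.coe_aeval_eq_eval, map_zero]
    refine (DFunLike.congr_fun this F).trans ?_
    have := hF (w k)
    rwa [← MvPolynomial.coe_aeval_eq_eval] at this
  have h1 : (Ideal.Quotient.mkₐ ℂ I).comp φ = Ideal.Quotient.mkₐ ℂ I := by
    ext j
    have := Ideal.Quotient.eq.2 (h j)
    rw [AlgHom.comp_apply, Ideal.Quotient.mkₐ_eq_mk, this]
    simp [φ]
  have h2 := DFunLike.congr_fun h1 F
  rw [AlgHom.comp_apply, h0, map_zero] at h2
  exact Ideal.Quotient.eq_zero_iff_mem.1 h2.symm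

/-- The factors `u` become units in the local ring, so `J` generates the maximal ideal there and the
quotient is the residue field. -/
theorem localLength_eq_one {v : Fin 3 → ℂ} (hv : v ≠ 0) {k : Fin 3}
    {J : Ideal (MvPolynomial (Fin 3) ℂ)} (hJ : J ≤ pointIdeal (Projectivization.mk ℂ v hv))
    (h : ∀ j, ∃ u, MvPolynomial.eval v u ≠ 0 ∧
      u * (MvPolynomial.X j - MvPolynomial.C (v j) * MvPolynomial.X k) ∈ J) :
    localLength (Projectivization.mk ℂ v hv) J = 1 := by
  have key : J.map (algebraMap (MvPolynomial (Fin 3) ℂ) (Localization.AtPrime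
      (pointIdeal (Projectivization.mk ℂ v hv)))) = IsLocalRing.maximalIdeal _ := by
    apply le_antisymm
    · rw [← map_pointIdeal]
      exact Ideal.map_mono hJ
    · rw [← map_pointIdeal, Ideal.map_le_iff_le_comap]
      refine pointIdeal_le hv (k := k) fun j => ?_
      obtain ⟨u, hu, hu'⟩ := h j
      refine mem_map_localization_iff.2 ⟨u, fun hmem => hu ?_, hu'⟩
      simpa using (mem_pointIdeal_mk hv).1 hmem 1
  rw [localLength, key, Module.length_eq_one_iff, isSimpleModule_iff_isCoatom]
  exact (IsLocalRing.maximalIdeal.isMaximal _).out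

/-- The first order jet of a polynomial along the line through `v` in the direction of `w`. -/
noncomputable def jet (v w : Fin 3 → ℂ) :
    MvPolynomial (Fin 3) ℂ →ₐ[ℂ] DualNumber (Polynomial ℂ) :=
  MvPolynomial.aeval fun i => TrivSqZeroExt.inl (Polynomial.C (v i) * Polynomial.X) +
    TrivSqZeroExt.inr (Polynomial.C (w i) * Polynomial.X)

theorem fst_jet (v w : Fin 3 → ℂ) (F : MvPolynomial (Fin 3) ℂ) :
    (jet v w F).fst =
      MvPolynomial.aeval (R := ℂ) (fun i => Polynomial.C (v i) * Polynomial.X) F := by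
  have : (TrivSqZeroExt.fstHom ℂ (Polynomial ℂ) (Polynomial ℂ)).comp (jet v w) =
      MvPolynomial.aeval (R := ℂ) (fun i => Polynomial.C (v i) * Polynomial.X) := by
    ext i
    simp [jet]
  exact DFunLike.congr_fun this F

/-- A point where all members of an ideal are critical in a common direction is not simple. -/
theorem localLength_ne_one {v w : Fin 3 → ℂ} (hv : v ≠ 0) {i j : Fin 3}
    (hw : v i * w j - v j * w i ≠ 0) {F G : MvPolynomial (Fin 3) ℂ} (hF : jet v w F = 0)
    (hG : jet v w G = 0) :
    localLength (Projectivization.mk ℂ v hv) (Ideal.span {F, G}) ≠ 1 := by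
  intro h
  rw [localLength, Module.length_eq_one_iff, isSimpleModule_iff_isCoatom] at h
  have hm := IsLocalRing.eq_maximalIdeal (Ideal.isMaximal_def.2 h)
  -- `L` vanishes on the line of `v` but not to first order in the direction `w`. Length one would
  -- put `L` in the localized ideal, hence some `u * L` with `u` nonzero along the line in `(F, G)`,
  -- although the jet kills `(F, G)`.
  let L : MvPolynomial (Fin 3) ℂ :=
    MvPolynomial.C (v i) * MvPolynomial.X j - MvPolynomial.C (v j) * MvPolynomial.X i
  have hL : L ∈ pointIdeal (Projectivization.mk ℂ v hv) := by
    rw [mem_pointIdeal_mk]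
    intro t
    simp [L]
    ring
  have hL' := Ideal.mem_map_of_mem (algebraMap _ (Localization.AtPrime
    (pointIdeal (Projectivization.mk ℂ v hv)))) hL
  rw [map_pointIdeal, ← hm, mem_map_localization_iff] at hL'
  obtain ⟨u, hu, huL⟩ := hL'
  obtain ⟨a, b, hab⟩ := Ideal.mem_span_pair.1 huL
  have hjet : jet v w u * jet v w L = 0 := by
    rw [← map_mul, ← hab, map_add, map_mul, map_mul, hF, hG, mul_zero, mul_zero, add_zero]
  have hs := congrArg TrivSqZeroExt.snd hjet
  have hfst : (jet v w L).fst = 0 := by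
    rw [fst_jet]
    exact (mem_pointIdeal_mk_iff_aeval hv).1 hL
  have hsnd : (jet v w L).snd = Polynomial.C (v i * w j - v j * w i) * Polynomial.X := by
    simp [jet, L, TrivSqZeroExt.algebraMap_eq_inl', sub_mul, mul_assoc]
  rw [TrivSqZeroExt.snd_mul, hfst, hsnd, fst_jet] at hs
  simp only [smul_eq_mul, MulOpposite.op_zero, zero_smul, add_zero, TrivSqZeroExt.snd_zero] at hs
  rcases mul_eq_zero.1 hs with hs | hs
  · exact hu ((mem_pointIdeal_mk_iff_aeval hv).2 hs)
  · rcases mul_eq_zero.1 hs with hs | hs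
    · exact hw (Polynomial.C_eq_zero.1 hs)
    · exact Polynomial.X_ne_zero hs

theorem isArtinianRing_of_isMaximal {R : Type*} [CommRing R] [IsNoetherianRing R]
    (h : ∀ Q : Ideal R, Q.IsPrime → Q.IsMaximal) : IsArtinianRing R :=
  isArtinianRing_iff_isNoetherianRing_krullDimLE_zero.2
    ⟨inferInstance, Ring.krullDimLE_zero_iff.2 h⟩

/-- A prime that contains the localized `J` contains the `n`-th powers of generators of the maximal
ideal, hence is maximal. The quotient is Noetherian of dimension zero, therefore Artinian, and has
finite length. -/
theorem localLength_ne_top {v : Fin 3 → ℂ} (hv : v ≠ 0) {k : Fin 3}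
    {J : Ideal (MvPolynomial (Fin 3) ℂ)} {n : ℕ}
    (h : ∀ j, ∃ u, MvPolynomial.eval v u ≠ 0 ∧
      u * (MvPolynomial.X j - MvPolynomial.C (v j) * MvPolynomial.X k) ^ n ∈ J) :
    localLength (Projectivization.mk ℂ v hv) J ≠ ⊤ := by
  set p := Projectivization.mk ℂ v hv
  set K := J.map (algebraMap (MvPolynomial (Fin 3) ℂ) (Localization.AtPrime (pointIdeal p)))
    with hK
  have hrad (Q : Ideal (Localization.AtPrime (pointIdeal p))) (hQ : Q.IsPrime) (hKQ : K ≤ Q) :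
      Q.IsMaximal := by
    have hle : IsLocalRing.maximalIdeal (Localization.AtPrime (pointIdeal p)) ≤ Q := by
      rw [← map_pointIdeal, Ideal.map_le_iff_le_comap]
      refine pointIdeal_le hv (k := k) fun j => ?_
      obtain ⟨u, hu, hu'⟩ := h j
      have : algebraMap (MvPolynomial (Fin 3) ℂ) (Localization.AtPrime (pointIdeal p))
          ((MvPolynomial.X j - MvPolynomial.C (v j) * MvPolynomial.X k) ^ n) ∈ K :=
        mem_map_localization_iff.2 ⟨u, fun hmem => hu
          (by simpa using (mem_pointIdeal_mk hv).1 hmem 1), hu'⟩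
      rw [map_pow] at this
      exact hQ.mem_of_pow_mem n (hKQ this)
    have := IsLocalRing.le_maximalIdeal hQ.ne_top
    rw [le_antisymm this hle]
    exact IsLocalRing.maximalIdeal.isMaximal _
  have hart : IsArtinianRing (Localization.AtPrime (pointIdeal p) ⧸ K) := by
    have : IsNoetherianRing (Localization.AtPrime (pointIdeal p)) :=
      IsLocalization.isNoetherianRing (pointIdeal p).primeCompl _ inferInstance
    refine isArtinianRing_of_isMaximal (R := Localization.AtPrime (pointIdeal p) ⧸ K) fun Q hQ => ?_
    have h1 := hrad (Q.comap (Ideal.Quotient.mk K)) (Ideal.IsPrime.comap _) (by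
      intro x hx
      rw [Ideal.mem_comap, Ideal.Quotient.eq_zero_iff_mem.2 hx]
      exact Q.zero_mem)
    have h2 := Ideal.map_eq_top_or_isMaximal_of_surjective (Ideal.Quotient.mk K)
      Ideal.Quotient.mk_surjective h1
    rw [Ideal.map_comap_of_surjective _ Ideal.Quotient.mk_surjective] at h2
    exact h2.resolve_left hQ.ne_top
  rw [localLength, ← hK, Module.length_eq_of_surjective
    (R := Localization.AtPrime (pointIdeal p) ⧸ K) Ideal.Quotient.mk_surjective]
  exact Module.length_ne_top


/-! ### Base points of the named pencils -/

theorem toPoly_form (a b c d e k : ℝ) :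
    toPoly (form a b c d e k) = MvPolynomial.C (a : ℂ) * MvPolynomial.X 0 ^ 2 +
      MvPolynomial.C (b : ℂ) * MvPolynomial.X 1 ^ 2 +
      MvPolynomial.C (c : ℂ) * MvPolynomial.X 2 ^ 2 +
      MvPolynomial.C (d : ℂ) * (MvPolynomial.X 0 * MvPolynomial.X 1) +
      MvPolynomial.C (e : ℂ) * (MvPolynomial.X 0 * MvPolynomial.X 2) +
      MvPolynomial.C (k : ℂ) * (MvPolynomial.X 1 * MvPolynomial.X 2) := by
  apply MvPolynomial.funext
  intro w
  rw [eval_toPoly]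
  simp [complexValue, form, dotProduct, Matrix.mulVec, Fin.sum_univ_three]
  ring

theorem ne_zero_of_apply {v : Fin 3 → ℂ} {k : Fin 3} (h : v k = 1) : v ≠ 0 := by
  rintro rfl
  simp at h

/-- The point with given homogeneous coordinates, one of which is `1`. -/
noncomputable def point (k : Fin 3) (v : Fin 3 → ℂ) (h : v k = 1) : ℙ ℂ (Fin 3 → ℂ) :=
  Projectivization.mk ℂ v (ne_zero_of_apply h)

theorem mk_eq_point {w : Fin 3 → ℂ} (hw : w ≠ 0) {k : Fin 3} {v : Fin 3 → ℂ} (h : v k = 1)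
    (e : ∀ j, w j = w k * v j) : Projectivization.mk ℂ w hw = point k v h :=
  (Projectivization.mk_eq_mk_iff' ℂ _ _ _ _).2 ⟨w k, funext fun j => (e j).symm⟩

theorem point_injective {k : Fin 3} {v w : Fin 3 → ℂ} (hv : v k = 1) (hw : w k = 1)
    (h : point k v hv = point k w hw) : v = w := by
  obtain ⟨a, rfl⟩ := (Projectivization.mk_eq_mk_iff' ℂ _ _ _ _).1 h
  have : a = 1 := by simpa [hw] using hv
  rw [this, one_smul]

theorem point_ne_point {k l j : Fin 3} {v w : Fin 3 → ℂ} (hv : v k = 1) (hw : w l = 1)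
    (h : v k * w j ≠ v j * w k) : point k v hv ≠ point l w hw := by
  intro e
  obtain ⟨a, rfl⟩ := (Projectivization.mk_eq_mk_iff' ℂ _ _ _ _).1 e
  apply h
  simp only [Pi.smul_apply, smul_eq_mul]
  ring

theorem isRealPoint_point {k : Fin 3} {v : Fin 3 → ℂ} (h : v k = 1) :
    IsRealPoint (point k v h) ↔ ∀ j, (v j).im = 0 := by
  rw [point, isRealPoint_mk_iff]
  constructor
  · rintro ⟨a, w, rfl⟩ j
    have hk : a * w k = 1 := h
    have hwk : (w k : ℂ) ≠ 0 := right_ne_zero_of_mul (by rw [hk]; exact one_ne_zero)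
    have ha : a = ((w k)⁻¹ : ℝ) := by
      rw [eq_inv_of_mul_eq_one_left hk]
      simp
    simp [ha]
  · intro h0
    refine ⟨1, fun j => (v j).re, funext fun j => ?_⟩
    simp [Complex.ext_iff, h0 j]

theorem le_pointIdeal {F G : MvPolynomial (Fin 3) ℂ} {v : Fin 3 → ℂ} (hv : v ≠ 0)
    (hF : ∀ t : ℂ, MvPolynomial.eval (t • v) F = 0)
    (hG : ∀ t : ℂ, MvPolynomial.eval (t • v) G = 0) :
    Ideal.span {F, G} ≤ pointIdeal (Projectivization.mk ℂ v hv) := by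
  rw [Ideal.span_le]
  rintro _ (rfl | rfl)
  · exact (mem_pointIdeal_mk hv).2 hF
  · exact (mem_pointIdeal_mk hv).2 hG

theorem eval_eq_zero_of_localLength {F G : MvPolynomial (Fin 3) ℂ} {v : Fin 3 → ℂ} {hv : v ≠ 0}
    {m : ℕ} (hm : 1 ≤ m)
    (h : localLength (Projectivization.mk ℂ v hv) (Ideal.span {F, G}) = m) :
    MvPolynomial.eval v F = 0 ∧ MvPolynomial.eval v G = 0 := by
  have hle : Ideal.span {F, G} ≤ pointIdeal (Projectivization.mk ℂ v hv) := by
    by_contra hn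
    rw [localLength_eq_zero_iff.2 hn] at h
    have : m = 0 := by exact_mod_cast h.symm
    omega
  have hF := (mem_pointIdeal_mk hv).1 (hle (Ideal.subset_span (Set.mem_insert F _))) 1
  have hG := (mem_pointIdeal_mk hv).1 (hle (Ideal.subset_span (Set.mem_insert_of_mem F rfl))) 1
  rw [one_smul] at hF hG
  exact ⟨hF, hG⟩

theorem le_encard_of_injective {α : Type*} {n : ℕ} (f : Fin n → α) (hf : Function.Injective f)
    {S : Set α} (h : ∀ i, f i ∈ S) : (n : ℕ∞) ≤ S.encard := by
  have h1 : (Set.range f).encard = n := by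
    rw [← Set.image_univ, hf.encard_image, Set.encard_univ]
    simp
  rw [← h1]
  exact Set.encard_le_encard (by rintro _ ⟨i, rfl⟩; exact h i)

theorem le_encard_of_points {n : ℕ} {k : Fin 3} (v : Fin n → Fin 3 → ℂ) (hv : ∀ i, v i k = 1)
    (hi : Function.Injective v) {S : Set (ℙ ℂ (Fin 3 → ℂ))}
    (h : ∀ i, point k (v i) (hv i) ∈ S) : (n : ℕ∞) ≤ S.encard :=
  le_encard_of_injective (fun i => point k (v i) (hv i))
    (fun _ _ e => hi (point_injective _ _ e)) h

theorem encard_le_two {α : Type*} {S : Set α} {p q : α} (h : S ⊆ {p, q}) : S.encard ≤ 2 :=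
  (Set.encard_le_encard h).trans (Set.encard_insert_le _ _ |>.trans (by
    rw [Set.encard_singleton]; norm_num))

theorem encard_le_three {α : Type*} {S : Set α} {p q r : α} (h : S ⊆ {p, q, r}) :
    S.encard ≤ 3 :=
  (Set.encard_le_encard h).trans (Set.encard_insert_le _ _ |>.trans (by
    have := encard_le_two (Set.Subset.refl ({q, r} : Set α))
    calc _ ≤ (2 : ℕ∞) + 1 := by gcongr
      _ = 3 := by norm_num))

theorem encard_le_one {α : Type*} {S : Set α} {p : α} (h : S ⊆ {p}) : S.encard ≤ 1 :=
  (Set.encard_le_encard h).trans (Set.encard_singleton p).le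

section Points

open MvPolynomial Complex

local notation "x" => (X 0 : MvPolynomial (Fin 3) ℂ)
local notation "y" => (X 1 : MvPolynomial (Fin 3) ℂ)
local notation "z" => (X 2 : MvPolynomial (Fin 3) ℂ)

theorem pencilIdeal_I : pencilIdeal OrbitName.I.levy = Ideal.span {x ^ 2 - y ^ 2, x ^ 2 - z ^ 2} := by
  refine (pencilIdeal_span₂ _ _).trans ?_
  simp [toPoly_form, sub_eq_add_neg]

theorem pencilIdeal_Ia : pencilIdeal OrbitName.Ia.levy =
    Ideal.span {x ^ 2 + y ^ 2 + z ^ 2, x * z} := by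
  refine (pencilIdeal_span₂ _ _).trans ?_
  simp [toPoly_form]

theorem pencilIdeal_Ib : pencilIdeal OrbitName.Ib.levy =
    Ideal.span {x ^ 2 + y ^ 2 - z ^ 2, x * z} := by
  refine (pencilIdeal_span₂ _ _).trans ?_
  simp [toPoly_form, sub_eq_add_neg]

theorem pencilIdeal_II : pencilIdeal OrbitName.II.levy = Ideal.span {y * z, x * y - x * z} := by
  refine (pencilIdeal_span₂ _ _).trans ?_
  simp [toPoly_form, sub_eq_add_neg]

theorem pencilIdeal_IIa : pencilIdeal OrbitName.IIa.levy =
    Ideal.span {y ^ 2 + z ^ 2, x * z} := by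
  refine (pencilIdeal_span₂ _ _).trans ?_
  simp [toPoly_form]

theorem pencilIdeal_III : pencilIdeal OrbitName.III.levy = Ideal.span {x * z, y ^ 2} := by
  refine (pencilIdeal_span₂ _ _).trans ?_
  simp [toPoly_form]

theorem pencilIdeal_IIIa : pencilIdeal OrbitName.IIIa.levy =
    Ideal.span {x ^ 2 + y ^ 2, z ^ 2} := by
  refine (pencilIdeal_span₂ _ _).trans ?_
  simp [toPoly_form]

theorem pencilIdeal_IV : pencilIdeal OrbitName.IV.levy = Ideal.span {x * z - y ^ 2, x * y} := by
  refine (pencilIdeal_span₂ _ _).trans ?_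
  simp [toPoly_form, sub_eq_neg_add]

theorem pencilIdeal_V : pencilIdeal OrbitName.V.levy = Ideal.span {x * z - y ^ 2, x ^ 2} := by
  refine (pencilIdeal_span₂ _ _).trans ?_
  simp [toPoly_form, sub_eq_neg_add]

/-- A lower bound is enough: for each of the other orbits the number of simple real base points is
shown to be at most three. -/
theorem real_count_I : 4 ≤ pencilRealCount OrbitName.I.levy 1 := by
  have key (s t : ℂ) (hs : s = 1 ∨ s = -1) (ht : t = 1 ∨ t = -1) :
      point 0 ![1, s, t] (by simp) ∈ {p : ℙ ℂ (Fin 3 → ℂ) | IsRealPoint p ∧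
        localLength p (pencilIdeal OrbitName.I.levy) = (1 : ℕ)} := by
    have hs2 : s ^ 2 = 1 := by rcases hs with rfl | rfl <;> norm_num
    have ht2 : t ^ 2 = 1 := by rcases ht with rfl | rfl <;> norm_num
    have hs0 : s ≠ 0 := by rcases hs with rfl | rfl <;> norm_num
    have ht0 : t ≠ 0 := by rcases ht with rfl | rfl <;> norm_num
    refine ⟨?_, ?_⟩
    · refine (isRealPoint_point _).2 fun j => ?_
      fin_cases j
      · simp
      · rcases hs with rfl | rfl <;> simp
      · rcases ht with rfl | rfl <;> simp
    · rw [pencilIdeal_I]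
      have hC2 : (C s : MvPolynomial (Fin 3) ℂ) ^ 2 = 1 := by rw [← C_pow, hs2, C_1]
      have hD2 : (C t : MvPolynomial (Fin 3) ℂ) ^ 2 = 1 := by rw [← C_pow, ht2, C_1]
      refine localLength_eq_one _ (k := 0) (le_pointIdeal _ (fun c => ?_) fun c => ?_) ?_
      · simp
        linear_combination -c ^ 2 * hs2
      · simp
        linear_combination -c ^ 2 * ht2
      · intro j
        fin_cases j
        · exact ⟨1, by simp, by simp⟩
        · refine ⟨y + C s * x, by simpa [← two_mul] using hs0,
            Ideal.mem_span_pair.2 ⟨-1, 0, ?_⟩⟩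
          simp
          linear_combination x ^ 2 * hC2
        · refine ⟨z + C t * x, by simpa [← two_mul] using ht0,
            Ideal.mem_span_pair.2 ⟨0, -1, ?_⟩⟩
          simp
          linear_combination x ^ 2 * hD2
  have hne : (1 : ℂ) ≠ -1 := by norm_num
  refine le_encard_of_points (n := 4) (k := 0)
    ![![1, 1, 1], ![1, 1, -1], ![1, -1, 1], ![1, -1, -1]] (fun i => by fin_cases i <;> rfl) ?_ ?_
  · intro i j h
    have h1 := congrFun h 1
    have h2 := congrFun h 2
    fin_cases i <;> fin_cases j <;> simp [hne, hne.symm] at h1 h2 ⊢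
  · intro i
    fin_cases i
    · exact key 1 1 (by simp) (by simp)
    · exact key 1 (-1) (by simp) (by simp)
    · exact key (-1) 1 (by simp) (by simp)
    · exact key (-1) (-1) (by simp) (by simp)

theorem I_ne_neg_I : I ≠ -I := by
  intro h
  have := congrArg Complex.im h
  norm_num at this

/-- The four points `(0, 1, ±i)` and `(±i, 1, 0)`. A lower bound is again enough, apart from the
orbit `I`, which is separated by its real points. -/
theorem imag_count_Ia : 4 ≤ pencilImagCount OrbitName.Ia.levy 1 := by
  have key (s t : ℂ) (h : s = 0 ∧ t ^ 2 = -1 ∨ t = 0 ∧ s ^ 2 = -1) (him : s.im ≠ 0 ∨ t.im ≠ 0) :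
      point 1 ![s, 1, t] (by simp) ∈ {p : ℙ ℂ (Fin 3 → ℂ) | ¬ IsRealPoint p ∧
        localLength p (pencilIdeal OrbitName.Ia.levy) = (1 : ℕ)} := by
    refine ⟨?_, ?_⟩
    · intro h0
      have h1 := (isRealPoint_point _).1 h0 0
      have h2 := (isRealPoint_point _).1 h0 2
      simp at h1 h2
      tauto
    · rw [pencilIdeal_Ia]
      rcases h with ⟨rfl, ht⟩ | ⟨rfl, hs⟩
      · have ht0 : t ≠ 0 := by
          rintro rfl
          norm_num at ht
        have hD2 : (C t : MvPolynomial (Fin 3) ℂ) ^ 2 = -1 := by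
          rw [← C_pow, ht, C_neg, C_1]
        refine localLength_eq_one _ (k := 1) (le_pointIdeal _ (fun c => ?_) fun c => ?_) ?_
        · simp
          linear_combination c ^ 2 * ht
        · simp
        · intro j
          fin_cases j
          · exact ⟨z, by simpa using ht0, Ideal.mem_span_pair.2 ⟨0, 1, by simp; ring⟩⟩
          · exact ⟨1, by simp, by simp⟩
          -- As `t² = -1`, the product is `z(y² + z²)`; the extra factor `z` removes `x²` modulo
          -- `xz`.
          · refine ⟨z * (z + C t * y), by simpa [← two_mul] using ht0,
              Ideal.mem_span_pair.2 ⟨z, -x, ?_⟩⟩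
            simp
            linear_combination z * y ^ 2 * hD2
      · have hs0 : s ≠ 0 := by
          rintro rfl
          norm_num at hs
        have hD2 : (C s : MvPolynomial (Fin 3) ℂ) ^ 2 = -1 := by
          rw [← C_pow, hs, C_neg, C_1]
        refine localLength_eq_one _ (k := 1) (le_pointIdeal _ (fun c => ?_) fun c => ?_) ?_
        · simp
          linear_combination c ^ 2 * hs
        · simp
        · intro j
          fin_cases j
          · refine ⟨x * (x + C s * y), by simpa [← two_mul] using hs0,
              Ideal.mem_span_pair.2 ⟨x, -z, ?_⟩⟩
            simp
            linear_combination x * y ^ 2 * hD2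
          · exact ⟨1, by simp, by simp⟩
          · exact ⟨x, by simpa using hs0, Ideal.mem_span_pair.2 ⟨0, 1, by simp⟩⟩
  refine le_encard_of_points (n := 4) (k := 1)
    ![![0, 1, I], ![0, 1, -I], ![I, 1, 0], ![-I, 1, 0]] (fun i => by fin_cases i <;> rfl) ?_ ?_
  · intro i j h
    have h1 := congrFun h 0
    have h2 := congrFun h 2
    fin_cases i <;> fin_cases j <;>
      simp [I_ne_neg_I, I_ne_neg_I.symm, I_ne_zero, I_ne_zero.symm] at h1 h2 ⊢
  · intro i
    fin_cases i
    · exact key 0 I (by simp) (by simp)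
    · exact key 0 (-I) (by simp) (by simp)
    · exact key I 0 (by simp) (by simp)
    · exact key (-I) 0 (by simp) (by simp)

theorem real_count_Ia {m : ℕ} (hm : 1 ≤ m) : pencilRealCount OrbitName.Ia.levy m = 0 := by
  rw [pencilRealCount, Set.encard_eq_zero, Set.eq_empty_iff_forall_notMem]
  rintro p ⟨⟨v, hv, rfl⟩, h⟩
  rw [pencilIdeal_Ia] at h
  have h1 := (eval_eq_zero_of_localLength hm h).1
  simp only [map_add, map_pow, eval_X] at h1
  have h2 : v 0 ^ 2 + v 1 ^ 2 + v 2 ^ 2 = 0 := by exact_mod_cast h1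
  have h3 (j : Fin 3) (hj : v j ^ 2 ≤ 0) : v j = 0 := pow_eq_zero_iff two_ne_zero |>.1
    (le_antisymm hj (sq_nonneg _))
  have hv0 := h3 0 (by linarith [sq_nonneg (v 1), sq_nonneg (v 2)])
  have hv1 := h3 1 (by linarith [sq_nonneg (v 0), sq_nonneg (v 2)])
  have hv2 := h3 2 (by linarith [sq_nonneg (v 0), sq_nonneg (v 1)])
  apply hv
  ext j
  fin_cases j <;> simp [hv0, hv1, hv2]

theorem real_count_Ib_ge : 2 ≤ pencilRealCount OrbitName.Ib.levy 1 := by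
  have key (t : ℂ) (ht : t = 1 ∨ t = -1) :
      point 1 ![0, 1, t] (by simp) ∈ {p : ℙ ℂ (Fin 3 → ℂ) | IsRealPoint p ∧
        localLength p (pencilIdeal OrbitName.Ib.levy) = (1 : ℕ)} := by
    have ht2 : t ^ 2 = 1 := by rcases ht with rfl | rfl <;> norm_num
    have ht0 : t ≠ 0 := by rcases ht with rfl | rfl <;> norm_num
    refine ⟨?_, ?_⟩
    · refine (isRealPoint_point _).2 fun j => ?_
      fin_cases j
      · simp
      · simp
      · rcases ht with rfl | rfl <;> simp
    · rw [pencilIdeal_Ib]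
      have hD2 : (C t : MvPolynomial (Fin 3) ℂ) ^ 2 = 1 := by rw [← C_pow, ht2, C_1]
      refine localLength_eq_one _ (k := 1) (le_pointIdeal _ (fun c => ?_) fun c => ?_) ?_
      · simp
        linear_combination -c ^ 2 * ht2
      · simp
      · intro j
        fin_cases j
        · exact ⟨z, by simpa using ht0, Ideal.mem_span_pair.2 ⟨0, 1, by simp; ring⟩⟩
        · exact ⟨1, by simp, by simp⟩
        · refine ⟨z * (z + C t * y), by simpa [← two_mul] using ht0,
            Ideal.mem_span_pair.2 ⟨-z, x, ?_⟩⟩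
          simp
          linear_combination z * y ^ 2 * hD2
  have hne : (1 : ℂ) ≠ -1 := by norm_num
  refine le_encard_of_points (n := 2) (k := 1)
    ![![0, 1, 1], ![0, 1, -1]] (fun i => by fin_cases i <;> rfl) ?_ ?_
  · intro i j h
    have h2 := congrFun h 2
    fin_cases i <;> fin_cases j <;> simp [hne, hne.symm] at h2 ⊢
  · intro i
    fin_cases i
    · exact key 1 (by simp)
    · exact key (-1) (by simp)

theorem imag_count_Ib_ge : 2 ≤ pencilImagCount OrbitName.Ib.levy 1 := by
  have key (s : ℂ) (hs : s ^ 2 = -1) (him : s.im ≠ 0) :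
      point 1 ![s, 1, 0] (by simp) ∈ {p : ℙ ℂ (Fin 3 → ℂ) | ¬ IsRealPoint p ∧
        localLength p (pencilIdeal OrbitName.Ib.levy) = (1 : ℕ)} := by
    refine ⟨?_, ?_⟩
    · exact fun h0 => him ((isRealPoint_point _).1 h0 0)
    · rw [pencilIdeal_Ib]
      have hs0 : s ≠ 0 := by
        rintro rfl
        norm_num at hs
      have hD2 : (C s : MvPolynomial (Fin 3) ℂ) ^ 2 = -1 := by
        rw [← C_pow, hs, C_neg, C_1]
      refine localLength_eq_one _ (k := 1) (le_pointIdeal _ (fun c => ?_) fun c => ?_) ?_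
      · simp
        linear_combination c ^ 2 * hs
      · simp
      · intro j
        fin_cases j
        · refine ⟨x * (x + C s * y), by simpa [← two_mul] using hs0,
            Ideal.mem_span_pair.2 ⟨x, z, ?_⟩⟩
          simp
          linear_combination x * y ^ 2 * hD2
        · exact ⟨1, by simp, by simp⟩
        · exact ⟨x, by simpa using hs0, Ideal.mem_span_pair.2 ⟨0, 1, by simp⟩⟩
  refine le_encard_of_points (n := 2) (k := 1)
    ![![I, 1, 0], ![-I, 1, 0]] (fun i => by fin_cases i <;> rfl) ?_ ?_
  · intro i j h
    have h1 := congrFun h 0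
    fin_cases i <;> fin_cases j <;> simp [I_ne_neg_I, I_ne_neg_I.symm] at h1 ⊢
  · intro i
    fin_cases i
    · exact key I (by simp) (by simp)
    · exact key (-I) (by simp) (by simp)

theorem base_points_Ib {v : Fin 3 → ℂ} (hv : v ≠ 0) (h1 : v 0 ^ 2 + v 1 ^ 2 - v 2 ^ 2 = 0)
    (h2 : v 0 = 0 ∨ v 2 = 0) :
    (Projectivization.mk ℂ v hv = point 1 ![0, 1, 1] (by simp) ∨
      Projectivization.mk ℂ v hv = point 1 ![0, 1, -1] (by simp)) ∨
    (Projectivization.mk ℂ v hv = point 1 ![I, 1, 0] (by simp) ∨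
      Projectivization.mk ℂ v hv = point 1 ![-I, 1, 0] (by simp)) := by
  rcases h2 with h2 | h2
  · left
    have : (v 2 - v 1) * (v 2 + v 1) = 0 := by
      rw [h2] at h1
      linear_combination -h1
    rcases mul_eq_zero.1 this with h | h
    · refine Or.inl (mk_eq_point _ _ fun j => ?_)
      fin_cases j
      · simp [h2]
      · simp
      · simp
        linear_combination h
    · refine Or.inr (mk_eq_point _ _ fun j => ?_)
      fin_cases j
      · simp [h2]
      · simp
      · simp
        linear_combination h
  · right
    have : (v 0 - I * v 1) * (v 0 + I * v 1) = 0 := by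
      rw [h2] at h1
      linear_combination h1 - v 1 ^ 2 * I_sq
    rcases mul_eq_zero.1 this with h | h
    · refine Or.inl (mk_eq_point _ _ fun j => ?_)
      fin_cases j
      · simp
        linear_combination h
      · simp
      · simp [h2]
    · refine Or.inr (mk_eq_point _ _ fun j => ?_)
      fin_cases j
      · simp
        linear_combination h
      · simp
      · simp [h2]

theorem real_count_Ib_le {m : ℕ} (hm : 1 ≤ m) : pencilRealCount OrbitName.Ib.levy m ≤ 2 := by
  refine encard_le_two (p := point 1 ![0, 1, 1] (by simp)) (q := point 1 ![0, 1, -1] (by simp)) ?_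
  rintro p ⟨hr, h⟩
  induction p using Projectivization.ind with
  | h v hv =>
    rw [pencilIdeal_Ib] at h
    have h1 := eval_eq_zero_of_localLength hm h
    simp only [map_add, map_sub, map_pow, eval_X, map_mul, mul_eq_zero] at h1
    rcases base_points_Ib hv h1.1 h1.2 with h | h | h
    · exact h
    · rw [h] at hr
      simpa using (isRealPoint_point _).1 hr 0
    · rw [h] at hr
      simpa using (isRealPoint_point _).1 hr 0

theorem imag_count_Ib_le {m : ℕ} (hm : 1 ≤ m) : pencilImagCount OrbitName.Ib.levy m ≤ 2 := by
  refine encard_le_two (p := point 1 ![I, 1, 0] (by simp)) (q := point 1 ![-I, 1, 0] (by simp)) ?_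
  rintro p ⟨hr, h⟩
  induction p using Projectivization.ind with
  | h v hv =>
    rw [pencilIdeal_Ib] at h
    have h1 := eval_eq_zero_of_localLength hm h
    simp only [map_add, map_sub, map_pow, eval_X, map_mul, mul_eq_zero] at h1
    rcases base_points_Ib hv h1.1 h1.2 with (h | h) | h
    · rw [h] at hr
      exact absurd ((isRealPoint_point _).2 fun j => by fin_cases j <;> simp) hr
    · rw [h] at hr
      exact absurd ((isRealPoint_point _).2 fun j => by fin_cases j <;> simp) hr
    · exact h

theorem real_count_II_ge : 2 ≤ pencilRealCount OrbitName.II.levy 1 := by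
  have h1 : point 1 ![0, 1, 0] (by simp) ∈ {p : ℙ ℂ (Fin 3 → ℂ) | IsRealPoint p ∧
        localLength p (pencilIdeal OrbitName.II.levy) = (1 : ℕ)} := by
    refine ⟨?_, ?_⟩
    · refine (isRealPoint_point _).2 fun j => ?_
      fin_cases j <;> simp
    · rw [pencilIdeal_II]
      refine localLength_eq_one _ (k := 1) (le_pointIdeal _ (by simp) (by simp)) ?_
      intro j
      fin_cases j
      · exact ⟨y * y, by simp, Ideal.mem_span_pair.2 ⟨x, y, by simp; ring⟩⟩
      · exact ⟨1, by simp, by simp⟩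
      · exact ⟨y, by simp, Ideal.mem_span_pair.2 ⟨1, 0, by simp⟩⟩
  have h2 : point 2 ![0, 0, 1] (by simp) ∈ {p : ℙ ℂ (Fin 3 → ℂ) | IsRealPoint p ∧
        localLength p (pencilIdeal OrbitName.II.levy) = (1 : ℕ)} := by
    refine ⟨?_, ?_⟩
    · refine (isRealPoint_point _).2 fun j => ?_
      fin_cases j <;> simp
    · rw [pencilIdeal_II]
      refine localLength_eq_one _ (k := 2) (le_pointIdeal _ (by simp) (by simp)) ?_
      intro j
      fin_cases j
      · exact ⟨z * z, by simp, Ideal.mem_span_pair.2 ⟨x, -z, by simp; ring⟩⟩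
      · exact ⟨z, by simp, Ideal.mem_span_pair.2 ⟨1, 0, by simp; ring⟩⟩
      · exact ⟨1, by simp, by simp⟩
  rw [pencilRealCount, ← one_add_one_eq_two, ENat.add_one_le_iff (by simp),
    Set.one_lt_encard_iff]
  exact ⟨_, _, h1, h2, point_ne_point (j := 2) _ _ (by simp)⟩

theorem base_points_II {v : Fin 3 → ℂ} (hv : v ≠ 0) (h1 : v 1 = 0 ∨ v 2 = 0)
    (h2 : v 0 * v 1 - v 0 * v 2 = 0) :
    Projectivization.mk ℂ v hv = point 0 ![1, 0, 0] (by simp) ∨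
      Projectivization.mk ℂ v hv = point 1 ![0, 1, 0] (by simp) ∨
      Projectivization.mk ℂ v hv = point 2 ![0, 0, 1] (by simp) := by
  by_cases h0 : v 0 = 0
  · right
    rcases h1 with h1 | h1
    · refine Or.inr (mk_eq_point _ _ fun j => ?_)
      fin_cases j <;> simp [h0, h1]
    · refine Or.inl (mk_eq_point _ _ fun j => ?_)
      fin_cases j <;> simp [h0, h1]
  · left
    have h3 : v 1 = v 2 := by
      apply mul_left_cancel₀ h0
      linear_combination h2
    have h4 : v 1 = 0 ∧ v 2 = 0 := by
      rcases h1 with h1 | h1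
      · exact ⟨h1, by rw [← h3, h1]⟩
      · exact ⟨by rw [h3, h1], h1⟩
    refine mk_eq_point _ _ fun j => ?_
    fin_cases j <;> simp [h4]

/-- The point `(1, 0, 0)` is not shown to be multiple: at most three simple real points and no
imaginary ones already single out the orbit. -/
theorem real_count_II_le {m : ℕ} (hm : 1 ≤ m) : pencilRealCount OrbitName.II.levy m ≤ 3 := by
  refine encard_le_three (p := point 0 ![1, 0, 0] (by simp))
    (q := point 1 ![0, 1, 0] (by simp)) (r := point 2 ![0, 0, 1] (by simp)) ?_
  rintro p ⟨-, h⟩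
  induction p using Projectivization.ind with
  | h v hv =>
    rw [pencilIdeal_II] at h
    have h1 := eval_eq_zero_of_localLength hm h
    simp only [map_sub, eval_X, map_mul, mul_eq_zero] at h1
    exact base_points_II hv h1.1 h1.2

theorem imag_count_II {m : ℕ} (hm : 1 ≤ m) : pencilImagCount OrbitName.II.levy m = 0 := by
  rw [pencilImagCount, Set.encard_eq_zero, Set.eq_empty_iff_forall_notMem]
  rintro p ⟨hr, h⟩
  apply hr
  induction p using Projectivization.ind with
  | h v hv =>
    rw [pencilIdeal_II] at h
    have h1 := eval_eq_zero_of_localLength hm h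
    simp only [map_sub, eval_X, map_mul, mul_eq_zero] at h1
    rcases base_points_II hv h1.1 h1.2 with h | h | h <;> rw [h] <;>
      refine (isRealPoint_point _).2 fun j => ?_ <;> fin_cases j <;> simp

theorem imag_count_IIa_ge : 2 ≤ pencilImagCount OrbitName.IIa.levy 1 := by
  have key (t : ℂ) (ht : t ^ 2 = -1) (him : t.im ≠ 0) :
      point 1 ![0, 1, t] (by simp) ∈ {p : ℙ ℂ (Fin 3 → ℂ) | ¬ IsRealPoint p ∧
        localLength p (pencilIdeal OrbitName.IIa.levy) = (1 : ℕ)} := by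
    refine ⟨?_, ?_⟩
    · exact fun h0 => him ((isRealPoint_point _).1 h0 2)
    · rw [pencilIdeal_IIa]
      have ht0 : t ≠ 0 := by
        rintro rfl
        norm_num at ht
      have hD2 : (C t : MvPolynomial (Fin 3) ℂ) ^ 2 = -1 := by
        rw [← C_pow, ht, C_neg, C_1]
      refine localLength_eq_one _ (k := 1) (le_pointIdeal _ (fun c => ?_) fun c => ?_) ?_
      · simp
        linear_combination c ^ 2 * ht
      · simp
      · intro j
        fin_cases j
        · exact ⟨z, by simpa using ht0, Ideal.mem_span_pair.2 ⟨0, 1, by simp; ring⟩⟩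
        · exact ⟨1, by simp, by simp⟩
        · refine ⟨z + C t * y, by simpa [← two_mul] using ht0,
            Ideal.mem_span_pair.2 ⟨1, 0, ?_⟩⟩
          simp
          linear_combination y ^ 2 * hD2
  refine le_encard_of_points (n := 2) (k := 1)
    ![![0, 1, I], ![0, 1, -I]] (fun i => by fin_cases i <;> rfl) ?_ ?_
  · intro i j h
    have h1 := congrFun h 2
    fin_cases i <;> fin_cases j <;> simp [I_ne_neg_I, I_ne_neg_I.symm] at h1 ⊢
  · intro i
    fin_cases i
    · exact key I (by simp) (by simp)
    · exact key (-I) (by simp) (by simp)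

theorem base_points_IIa {v : Fin 3 → ℂ} (hv : v ≠ 0) (h1 : v 1 ^ 2 + v 2 ^ 2 = 0)
    (h2 : v 0 = 0 ∨ v 2 = 0) :
    Projectivization.mk ℂ v hv = point 0 ![1, 0, 0] (by simp) ∨
    (Projectivization.mk ℂ v hv = point 1 ![0, 1, I] (by simp) ∨
      Projectivization.mk ℂ v hv = point 1 ![0, 1, -I] (by simp)) := by
  rcases h2 with h2 | h2
  · right
    have : (v 2 - I * v 1) * (v 2 + I * v 1) = 0 := by
      linear_combination h1 - v 1 ^ 2 * I_sq
    rcases mul_eq_zero.1 this with h | h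
    · refine Or.inl (mk_eq_point _ _ fun j => ?_)
      fin_cases j
      · simp [h2]
      · simp
      · simp
        linear_combination h
    · refine Or.inr (mk_eq_point _ _ fun j => ?_)
      fin_cases j
      · simp [h2]
      · simp
      · simp
        linear_combination h
  · left
    have h3 : v 1 = 0 := by simpa [h2] using h1
    refine mk_eq_point _ _ fun j => ?_
    fin_cases j <;> simp [h2, h3]

theorem real_count_IIa_le {m : ℕ} (hm : 1 ≤ m) : pencilRealCount OrbitName.IIa.levy m ≤ 1 := by
  refine encard_le_one (p := point 0 ![1, 0, 0] (by simp)) ?_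
  rintro p ⟨hr, h⟩
  induction p using Projectivization.ind with
  | h v hv =>
    rw [pencilIdeal_IIa] at h
    have h1 := eval_eq_zero_of_localLength hm h
    simp only [map_add, map_pow, eval_X, map_mul, mul_eq_zero] at h1
    rcases base_points_IIa hv h1.1 h1.2 with h | h | h
    · exact h
    · rw [h] at hr
      simpa using (isRealPoint_point _).1 hr 2
    · rw [h] at hr
      simpa using (isRealPoint_point _).1 hr 2

theorem imag_count_IIa_le {m : ℕ} (hm : 1 ≤ m) : pencilImagCount OrbitName.IIa.levy m ≤ 2 := by
  refine encard_le_two (p := point 1 ![0, 1, I] (by simp)) (q := point 1 ![0, 1, -I] (by simp)) ?_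
  rintro p ⟨hr, h⟩
  induction p using Projectivization.ind with
  | h v hv =>
    rw [pencilIdeal_IIa] at h
    have h1 := eval_eq_zero_of_localLength hm h
    simp only [map_add, map_pow, eval_X, map_mul, mul_eq_zero] at h1
    rcases base_points_IIa hv h1.1 h1.2 with h | h
    · rw [h] at hr
      exact absurd ((isRealPoint_point _).2 fun j => by fin_cases j <;> simp) hr
    · exact h

end Points


/-! ### Base points of `III`, `IIIa`, `IV` and `V` -/

theorem isRealPoint_of_eq {p : ℙ ℂ (Fin 3 → ℂ)} {k : Fin 3} {v : Fin 3 → ℂ} {hk : v k = 1}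
    (h : p = point k v hk) (hv : ∀ j, (v j).im = 0) : IsRealPoint p := by
  rw [h]
  exact (isRealPoint_point _).2 hv

section Points

open MvPolynomial Complex

local notation "x" => (X 0 : MvPolynomial (Fin 3) ℂ)
local notation "y" => (X 1 : MvPolynomial (Fin 3) ℂ)
local notation "z" => (X 2 : MvPolynomial (Fin 3) ℂ)

theorem base_points_III {v : Fin 3 → ℂ} (hv : v ≠ 0) (h1 : v 0 = 0 ∨ v 2 = 0) (h2 : v 1 = 0) :
    Projectivization.mk ℂ v hv = point 0 ![1, 0, 0] (by simp) ∨
      Projectivization.mk ℂ v hv = point 2 ![0, 0, 1] (by simp) := by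
  rcases h1 with h1 | h1
  · refine Or.inr (mk_eq_point _ _ fun j => ?_)
    fin_cases j <;> simp [h1, h2]
  · refine Or.inl (mk_eq_point _ _ fun j => ?_)
    fin_cases j <;> simp [h1, h2]

theorem imag_count_III {m : ℕ} (hm : 1 ≤ m) : pencilImagCount OrbitName.III.levy m = 0 := by
  rw [pencilImagCount, Set.encard_eq_zero, Set.eq_empty_iff_forall_notMem]
  rintro p ⟨hr, h⟩
  apply hr
  induction p using Projectivization.ind with
  | h v hv =>
    rw [pencilIdeal_III] at h
    have h1 := eval_eq_zero_of_localLength hm h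
    simp only [map_pow, eval_X, map_mul, mul_eq_zero] at h1
    rcases base_points_III hv h1.1 (pow_eq_zero_iff two_ne_zero |>.1 h1.2) with h | h <;>
      exact isRealPoint_of_eq h fun j => by fin_cases j <;> simp

/-- At a base point `y = 0`, and in the direction of `y` the form `xz` is constant while `y²`
vanishes to second order. -/
theorem localLength_III_ne_one (p : ℙ ℂ (Fin 3 → ℂ)) :
    localLength p (pencilIdeal OrbitName.III.levy) ≠ (1 : ℕ) := by
  intro h
  induction p using Projectivization.ind with
  | h v hv =>
    rw [pencilIdeal_III] at h
    have h1 := eval_eq_zero_of_localLength le_rfl h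
    simp only [map_pow, eval_X, map_mul, mul_eq_zero] at h1
    have h2 : v 1 = 0 := pow_eq_zero_iff two_ne_zero |>.1 h1.2
    have h3 : ∃ i, v i ≠ 0 ∧ i ≠ 1 := by
      by_contra! hn
      apply hv
      ext i
      by_cases hi : i = 1
      · rw [hi, h2, Pi.zero_apply]
      · by_contra h0
        exact hi (hn i h0)
    obtain ⟨i, hi, hi1⟩ := h3
    refine localLength_ne_one (w := Pi.single 1 1) hv (i := i) (j := 1) ?_ ?_ ?_ h
    · simpa [hi1] using hi
    · apply TrivSqZeroExt.ext
      · simpa [jet] using h1.1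
      · simp [jet]
    · apply TrivSqZeroExt.ext <;> simp [jet, h2, pow_two]

/-- Both base points of the third pencil have finite multiplicity. -/
theorem localLength_III_finite :
    localLength (point 0 ![1, 0, 0] (by simp)) (pencilIdeal OrbitName.III.levy) ≠ ⊤ ∧
    localLength (point 2 ![0, 0, 1] (by simp)) (pencilIdeal OrbitName.III.levy) ≠ ⊤ := by
  rw [pencilIdeal_III]
  constructor
  · refine localLength_ne_top _ (k := 0) (n := 2) fun j => ?_
    fin_cases j
    · exact ⟨1, by simp, by simp⟩
    · exact ⟨1, by simp, Ideal.mem_span_pair.2 ⟨0, 1, by simp⟩⟩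
    · exact ⟨x, by simp, Ideal.mem_span_pair.2 ⟨z, 0, by simp; ring⟩⟩
  · refine localLength_ne_top _ (k := 2) (n := 2) fun j => ?_
    fin_cases j
    · exact ⟨z, by simp, Ideal.mem_span_pair.2 ⟨x, 0, by simp; ring⟩⟩
    · exact ⟨1, by simp, Ideal.mem_span_pair.2 ⟨0, 1, by simp⟩⟩
    · exact ⟨1, by simp, by simp⟩

/-- The values of `m` and `n` do not matter: two distinct real points with finite positive
multiplicities separate `III` from `IIIa` and `V`. -/
theorem exists_real_points_III : ∃ p q : ℙ ℂ (Fin 3 → ℂ), ∃ m n : ℕ, p ≠ q ∧ 1 ≤ m ∧ 1 ≤ n ∧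
    (IsRealPoint p ∧ localLength p (pencilIdeal OrbitName.III.levy) = m) ∧
    (IsRealPoint q ∧ localLength q (pencilIdeal OrbitName.III.levy) = n) := by
  obtain ⟨h1, h2⟩ := localLength_III_finite
  obtain ⟨m, hm⟩ := ENat.ne_top_iff_exists.1 h1
  obtain ⟨n, hn⟩ := ENat.ne_top_iff_exists.1 h2
  refine ⟨_, _, m, n, point_ne_point (j := 2) (by simp) (by simp) (by simp), ?_, ?_,
    ⟨isRealPoint_of_eq rfl fun j => by fin_cases j <;> simp, hm.symm⟩,
    ⟨isRealPoint_of_eq rfl fun j => by fin_cases j <;> simp, hn.symm⟩⟩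
  · by_contra h0
    obtain rfl : m = 0 := by omega
    refine localLength_eq_zero_iff.1 hm.symm ?_
    rw [pencilIdeal_III]
    exact le_pointIdeal _ (by simp) (by simp)
  · by_contra h0
    obtain rfl : n = 0 := by omega
    refine localLength_eq_zero_iff.1 hn.symm ?_
    rw [pencilIdeal_III]
    exact le_pointIdeal _ (by simp) (by simp)

theorem real_count_IIIa {m : ℕ} (hm : 1 ≤ m) : pencilRealCount OrbitName.IIIa.levy m = 0 := by
  rw [pencilRealCount, Set.encard_eq_zero, Set.eq_empty_iff_forall_notMem]
  rintro p ⟨⟨v, hv, rfl⟩, h⟩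
  rw [pencilIdeal_IIIa] at h
  obtain ⟨h1, h2⟩ := eval_eq_zero_of_localLength hm h
  simp only [map_add, map_pow, eval_X] at h1 h2
  have h1' : v 0 ^ 2 + v 1 ^ 2 = 0 := by exact_mod_cast h1
  have h2' : v 2 ^ 2 = 0 := by exact_mod_cast h2
  have h3 (j : Fin 3) (hj : v j ^ 2 ≤ 0) : v j = 0 := pow_eq_zero_iff two_ne_zero |>.1
    (le_antisymm hj (sq_nonneg _))
  have hv0 := h3 0 (by linarith [sq_nonneg (v 1)])
  have hv1 := h3 1 (by linarith [sq_nonneg (v 0)])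
  have hv2 := h3 2 (by linarith)
  apply hv
  ext j
  fin_cases j <;> simp [hv0, hv1, hv2]

/-- At a base point `z = 0`, and in the direction of `z` the form `x² + y²` is constant while `z²`
vanishes to second order. -/
theorem localLength_IIIa_ne_one (p : ℙ ℂ (Fin 3 → ℂ)) :
    localLength p (pencilIdeal OrbitName.IIIa.levy) ≠ (1 : ℕ) := by
  intro h
  induction p using Projectivization.ind with
  | h v hv =>
    rw [pencilIdeal_IIIa] at h
    have h1 := eval_eq_zero_of_localLength le_rfl h
    simp only [map_add, map_pow, eval_X] at h1
    have h2 : v 2 = 0 := pow_eq_zero_iff two_ne_zero |>.1 h1.2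
    have h3 : ∃ i, v i ≠ 0 ∧ i ≠ 2 := by
      by_contra! hn
      apply hv
      ext i
      by_cases hi : i = 2
      · rw [hi, h2, Pi.zero_apply]
      · by_contra h0
        exact hi (hn i h0)
    obtain ⟨i, hi, hi1⟩ := h3
    refine localLength_ne_one (w := Pi.single 2 1) hv (i := i) (j := 2) ?_ ?_ ?_ h
    · simpa [hi1] using hi
    · apply TrivSqZeroExt.ext
      · simp only [jet, map_add, map_pow, aeval_X]
        simp
        rw [mul_pow, mul_pow, ← add_mul, ← Polynomial.C_pow, ← Polynomial.C_pow,
          ← Polynomial.C_add, h1.1, Polynomial.C_0, zero_mul]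
      · simp [jet]
    · apply TrivSqZeroExt.ext <;> simp [jet, h2, pow_two]

theorem exists_imag_point_IIIa :
    ∃ m : ℕ, 1 ≤ m ∧ pencilImagCount OrbitName.IIIa.levy m ≠ 0 := by
  have hfin : localLength (point 0 ![1, I, 0] (by simp)) (pencilIdeal OrbitName.IIIa.levy) ≠ ⊤ := by
    have hI : (C I : MvPolynomial (Fin 3) ℂ) ^ 2 = -1 := by
      rw [← C_pow, I_sq, C_neg, C_1]
    rw [pencilIdeal_IIIa]
    refine localLength_ne_top _ (k := 0) (n := 2) fun j => ?_
    fin_cases j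
    · exact ⟨1, by simp, by simp⟩
    -- `(y + ix)(y - ix) = x² + y²`, and the first factor does not vanish at `(1, i, 0)`.
    · refine ⟨(y + C I * x) ^ 2, by simp [← two_mul], Ideal.mem_span_pair.2
        ⟨x ^ 2 + y ^ 2, 0, ?_⟩⟩
      simp
      linear_combination (x ^ 2 * (-(C I) ^ 2 * x ^ 2 + 2 * y ^ 2 + x ^ 2)) * hI
    · exact ⟨1, by simp, Ideal.mem_span_pair.2 ⟨0, 1, by simp⟩⟩
  obtain ⟨m, hm⟩ := ENat.ne_top_iff_exists.1 hfin
  refine ⟨m, ?_, ?_⟩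
  · by_contra h0
    obtain rfl : m = 0 := by omega
    refine localLength_eq_zero_iff.1 hm.symm ?_
    rw [pencilIdeal_IIIa]
    refine le_pointIdeal _ (fun c => ?_) (by simp)
    simp
    linear_combination c ^ 2 * I_sq
  · rw [pencilImagCount, Set.encard_ne_zero]
    refine ⟨_, fun h => ?_, hm.symm⟩
    simpa using (isRealPoint_point _).1 h 1

theorem base_points_IV {v : Fin 3 → ℂ} (hv : v ≠ 0) (h1 : v 0 * v 2 - v 1 ^ 2 = 0)
    (h2 : v 0 = 0 ∨ v 1 = 0) :
    Projectivization.mk ℂ v hv = point 0 ![1, 0, 0] (by simp) ∨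
      Projectivization.mk ℂ v hv = point 2 ![0, 0, 1] (by simp) := by
  have h3 : v 1 = 0 := by
    rcases h2 with h2 | h2
    · simpa [h2] using h1
    · exact h2
  have h4 : v 0 = 0 ∨ v 2 = 0 := by simpa [h3] using h1
  exact base_points_III hv h4 h3

theorem imag_count_IV {m : ℕ} (hm : 1 ≤ m) : pencilImagCount OrbitName.IV.levy m = 0 := by
  rw [pencilImagCount, Set.encard_eq_zero, Set.eq_empty_iff_forall_notMem]
  rintro p ⟨hr, h⟩
  apply hr
  induction p using Projectivization.ind with
  | h v hv =>
    rw [pencilIdeal_IV] at h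
    have h1 := eval_eq_zero_of_localLength hm h
    simp only [map_sub, map_pow, eval_X, map_mul, mul_eq_zero] at h1
    rcases base_points_IV hv h1.1 h1.2 with h | h <;>
      exact isRealPoint_of_eq h fun j => by fin_cases j <;> simp

/-- At `(0, 0, 1)` the line pair `xy` is singular and the direction of `y` is tangent to the conic
`xz = y²`. -/
theorem localLength_IV_ne_one :
    localLength (point 2 ![0, 0, 1] (by simp)) (pencilIdeal OrbitName.IV.levy) ≠ (1 : ℕ) := by
  rw [pencilIdeal_IV]
  refine localLength_ne_one (w := ![0, 1, 0]) _ (i := 2) (j := 1) (by simp) ?_ ?_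
  · apply TrivSqZeroExt.ext <;> simp [jet, pow_two]
  · apply TrivSqZeroExt.ext <;> simp [jet]

theorem real_count_IV_le : pencilRealCount OrbitName.IV.levy 1 ≤ 1 := by
  refine encard_le_one (p := point 0 ![1, 0, 0] (by simp)) ?_
  rintro p ⟨-, h⟩
  induction p using Projectivization.ind with
  | h v hv =>
    have h' := h
    rw [pencilIdeal_IV] at h
    have h1 := eval_eq_zero_of_localLength le_rfl h
    simp only [map_sub, map_pow, eval_X, map_mul, mul_eq_zero] at h1
    rcases base_points_IV hv h1.1 h1.2 with h | h
    · exact h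
    · rw [h] at h'
      exact absurd h' localLength_IV_ne_one

theorem real_count_IV_ne_zero : pencilRealCount OrbitName.IV.levy 1 ≠ 0 := by
  rw [pencilRealCount, Set.encard_ne_zero]
  refine ⟨point 0 ![1, 0, 0] (by simp), isRealPoint_of_eq rfl fun j => by fin_cases j <;> simp, ?_⟩
  rw [pencilIdeal_IV]
  refine localLength_eq_one _ (k := 0) (le_pointIdeal _ (by simp) (by simp)) fun j => ?_
  fin_cases j
  · exact ⟨1, by simp, by simp⟩
  · exact ⟨x, by simp, Ideal.mem_span_pair.2 ⟨0, 1, by simp⟩⟩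
  · exact ⟨x ^ 2, by simp, Ideal.mem_span_pair.2 ⟨x, y, by simp; ring⟩⟩

theorem base_points_V {v : Fin 3 → ℂ} (hv : v ≠ 0) (h1 : v 0 * v 2 - v 1 ^ 2 = 0)
    (h2 : v 0 = 0) : Projectivization.mk ℂ v hv = point 2 ![0, 0, 1] (by simp) := by
  have h3 : v 1 = 0 := by simpa [h2] using h1
  refine mk_eq_point _ _ fun j => ?_
  fin_cases j <;> simp [h2, h3]

theorem eq_of_localLength_V {m : ℕ} (hm : 1 ≤ m) {p : ℙ ℂ (Fin 3 → ℂ)}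
    (h : localLength p (pencilIdeal OrbitName.V.levy) = m) : p = point 2 ![0, 0, 1] (by simp) := by
  induction p using Projectivization.ind with
  | h v hv =>
    rw [pencilIdeal_V] at h
    have h1 := eval_eq_zero_of_localLength hm h
    simp only [map_sub, map_pow, eval_X, map_mul] at h1
    exact base_points_V hv h1.1 (pow_eq_zero_iff two_ne_zero |>.1 h1.2)

theorem imag_count_V {m : ℕ} (hm : 1 ≤ m) : pencilImagCount OrbitName.V.levy m = 0 := by
  rw [pencilImagCount, Set.encard_eq_zero, Set.eq_empty_iff_forall_notMem]
  rintro p ⟨hr, h⟩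
  exact hr (isRealPoint_of_eq (eq_of_localLength_V hm h) fun j => by fin_cases j <;> simp)

theorem real_count_V_le {m : ℕ} (hm : 1 ≤ m) : pencilRealCount OrbitName.V.levy m ≤ 1 :=
  encard_le_one fun _ h => eq_of_localLength_V hm h.2

theorem localLength_V_ne_one (p : ℙ ℂ (Fin 3 → ℂ)) :
    localLength p (pencilIdeal OrbitName.V.levy) ≠ (1 : ℕ) := by
  intro h
  rw [eq_of_localLength_V le_rfl h, pencilIdeal_V] at h
  refine localLength_ne_one (w := ![0, 1, 0]) _ (i := 2) (j := 1) (by simp) ?_ ?_ h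
  · apply TrivSqZeroExt.ext <;> simp [jet, pow_two]
  · apply TrivSqZeroExt.ext <;> simp [jet]

end Points

/-! ### Separation of the nine orbits by their base points -/

theorem pencilRealCount_one_eq_zero {W : Submodule ℝ TernaryForm}
    (h : ∀ p, localLength p (pencilIdeal W) ≠ (1 : ℕ)) : pencilRealCount W 1 = 0 := by
  rw [pencilRealCount, Set.encard_eq_zero, Set.eq_empty_iff_forall_notMem]
  exact fun p hp => h p hp.2

theorem pencilImagCount_one_eq_zero {W : Submodule ℝ TernaryForm}
    (h : ∀ p, localLength p (pencilIdeal W) ≠ (1 : ℕ)) : pencilImagCount W 1 = 0 := by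
  rw [pencilImagCount, Set.encard_eq_zero, Set.eq_empty_iff_forall_notMem]
  exact fun p hp => h p hp.2

/-- The pencils `W` and `W'` have base points of the same types. -/
def SameBasePoints (W W' : Submodule ℝ TernaryForm) : Prop :=
  ∀ m : ℕ, 1 ≤ m → pencilRealCount W m = pencilRealCount W' m ∧
    pencilImagCount W m = pencilImagCount W' m

theorem SameBasePoints.symm {W W' : Submodule ℝ TernaryForm} (h : SameBasePoints W W') :
    SameBasePoints W' W := fun m hm => ⟨(h m hm).1.symm, (h m hm).2.symm⟩

/-- The only base point of `V` would have to match both real base points of `III`. These would then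
have the same multiplicity `m`, and `III` would have two real points of multiplicity `m` against at
most one. -/
theorem not_sameBasePoints_III_V : ¬ SameBasePoints OrbitName.III.levy OrbitName.V.levy := by
  intro h
  obtain ⟨p, q, m, n, hpq, hm, hn, hp, hq⟩ := exists_real_points_III
  have key {m : ℕ} (hm : 1 ≤ m) {p : ℙ ℂ (Fin 3 → ℂ)} (hp : IsRealPoint p ∧
      localLength p (pencilIdeal OrbitName.III.levy) = m) :
      localLength (point 2 ![0, 0, 1] (by simp)) (pencilIdeal OrbitName.V.levy) = m := by
    have h1 : pencilRealCount OrbitName.V.levy m ≠ 0 := by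
      rw [← (h m hm).1, pencilRealCount, Set.encard_ne_zero]
      exact ⟨p, hp⟩
    rw [pencilRealCount, Set.encard_ne_zero] at h1
    obtain ⟨r, -, hr⟩ := h1
    rwa [← eq_of_localLength_V hm hr]
  obtain rfl : m = n := by exact_mod_cast (key hm hp).symm.trans (key hn hq)
  have h1 := real_count_V_le hm
  rw [← (h m hm).1, pencilRealCount, Set.encard_le_one_iff] at h1
  exact hpq (h1 p q hp hq)

/-- A lower bound for the number of simple real base points. -/
def OrbitName.realLower : OrbitName → ℕ∞
  | .I => 4 | .Ia => 0 | .Ib => 2 | .II => 2 | .IIa => 0 | .III => 0 | .IIIa => 0 | .IV => 1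
  | .V => 0

/-- An upper bound for the number of simple real base points. -/
def OrbitName.realUpper : OrbitName → ℕ∞
  | .I => ⊤ | .Ia => 0 | .Ib => 2 | .II => 3 | .IIa => 1 | .III => 0 | .IIIa => 0 | .IV => 1
  | .V => 0

/-- A lower bound for the number of simple imaginary base points. -/
def OrbitName.imagLower : OrbitName → ℕ∞
  | .I => 0 | .Ia => 4 | .Ib => 2 | .II => 0 | .IIa => 2 | .III => 0 | .IIIa => 0 | .IV => 0
  | .V => 0

/-- An upper bound for the number of simple imaginary base points. -/
def OrbitName.imagUpper : OrbitName → ℕ∞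
  | .I => ⊤ | .Ia => ⊤ | .Ib => 2 | .II => 0 | .IIa => 2 | .III => 0 | .IIIa => 0 | .IV => 0
  | .V => 0

theorem OrbitName.realLower_le (o : OrbitName) : o.realLower ≤ pencilRealCount o.levy 1 := by
  cases o
  · exact real_count_I
  · exact zero_le
  · exact real_count_Ib_ge
  · exact real_count_II_ge
  · exact zero_le
  · exact zero_le
  · exact zero_le
  · exact Order.one_le_iff_ne_zero.2 real_count_IV_ne_zero
  · exact zero_le

theorem OrbitName.le_realUpper (o : OrbitName) : pencilRealCount o.levy 1 ≤ o.realUpper := by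
  cases o
  · exact le_top
  · exact (real_count_Ia le_rfl).le
  · exact real_count_Ib_le le_rfl
  · exact real_count_II_le le_rfl
  · exact real_count_IIa_le le_rfl
  · exact (pencilRealCount_one_eq_zero localLength_III_ne_one).le
  · exact (real_count_IIIa le_rfl).le
  · exact real_count_IV_le
  · exact (pencilRealCount_one_eq_zero localLength_V_ne_one).le

theorem OrbitName.imagLower_le (o : OrbitName) : o.imagLower ≤ pencilImagCount o.levy 1 := by
  cases o
  · exact zero_le
  · exact imag_count_Ia
  · exact imag_count_Ib_ge
  · exact zero_le
  · exact imag_count_IIa_ge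
  · exact zero_le
  · exact zero_le
  · exact zero_le
  · exact zero_le

theorem OrbitName.le_imagUpper (o : OrbitName) : pencilImagCount o.levy 1 ≤ o.imagUpper := by
  cases o
  · exact le_top
  · exact le_top
  · exact imag_count_Ib_le le_rfl
  · exact (imag_count_II le_rfl).le
  · exact imag_count_IIa_le le_rfl
  · exact (imag_count_III le_rfl).le
  · exact (pencilImagCount_one_eq_zero localLength_IIIa_ne_one).le
  · exact (imag_count_IV le_rfl).le
  · exact (imag_count_V le_rfl).le

theorem not_sameBasePoints_III_IIIa :
    ¬ SameBasePoints OrbitName.III.levy OrbitName.IIIa.levy := by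
  intro h
  obtain ⟨p, -, m, -, -, hm, -, hp, -⟩ := exists_real_points_III
  have h1 : pencilRealCount OrbitName.III.levy m ≠ 0 := by
    rw [pencilRealCount, Set.encard_ne_zero]
    exact ⟨p, hp⟩
  exact h1 ((h m hm).1.trans (real_count_IIIa hm))

theorem not_sameBasePoints_IIIa_V : ¬ SameBasePoints OrbitName.IIIa.levy OrbitName.V.levy := by
  intro h
  obtain ⟨m, hm, h1⟩ := exists_imag_point_IIIa
  exact h1 ((h m hm).2.trans (imag_count_V hm))

/-- The types of the base points distinguish the nine orbits of pencils. -/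
theorem OrbitName.eq_of_sameBasePoints {o o' : OrbitName} (h : SameBasePoints o.levy o'.levy) :
    o = o' := by
  obtain ⟨hR, hI⟩ := h 1 le_rfl
  have h1 := o.realLower_le.trans (hR.trans_le o'.le_realUpper)
  have h2 := o'.realLower_le.trans (hR.symm.trans_le o.le_realUpper)
  have h3 := o.imagLower_le.trans (hI.trans_le o'.le_imagUpper)
  have h4 := o'.imagLower_le.trans (hI.symm.trans_le o.le_imagUpper)
  -- The orbits `III`, `IIIa` and `V` have no simple base points, so the counts for `m = 1` do not
  -- separate them from each other; all remaining pairs of orbits differ in these counts.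
  have n1 : ¬ (o = .III ∧ o' = .IIIa) := by
    rintro ⟨rfl, rfl⟩
    exact not_sameBasePoints_III_IIIa h
  have n2 : ¬ (o = .IIIa ∧ o' = .III) := by
    rintro ⟨rfl, rfl⟩
    exact not_sameBasePoints_III_IIIa h.symm
  have n3 : ¬ (o = .III ∧ o' = .V) := by
    rintro ⟨rfl, rfl⟩
    exact not_sameBasePoints_III_V h
  have n4 : ¬ (o = .V ∧ o' = .III) := by
    rintro ⟨rfl, rfl⟩
    exact not_sameBasePoints_III_V h.symm
  have n5 : ¬ (o = .IIIa ∧ o' = .V) := by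
    rintro ⟨rfl, rfl⟩
    exact not_sameBasePoints_IIIa_V h
  have n6 : ¬ (o = .V ∧ o' = .IIIa) := by
    rintro ⟨rfl, rfl⟩
    exact not_sameBasePoints_IIIa_V h.symm
  clear hR hI h
  cases o <;> cases o' <;> first
    | rfl
    | (exfalso; norm_num [realLower, realUpper] at h1; done)
    | (exfalso; norm_num [realLower, realUpper] at h2; done)
    | (exfalso; norm_num [imagLower, imagUpper] at h3; done)
    | (exfalso; norm_num [imagLower, imagUpper] at h4; done)
    | simp at n1 n2 n3 n4 n5 n6

theorem SameOrbit.sameBasePoints {W W' : Submodule ℝ TernaryForm} (h : SameOrbit W W') :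
    SameBasePoints W W' := fun m _ => ⟨h.pencilRealCount_eq m, h.pencilImagCount_eq m⟩

theorem OrbitName.eq_of_sameOrbit {o o' : OrbitName} (h : SameOrbit o.levy o'.levy) : o = o' :=
  eq_of_sameBasePoints h.sameBasePoints

theorem sameIntersections_iff {C D C' D' : Conic} :
    SameIntersections (C, D) (C', D') ↔
      SameBasePoints (C.submodule ⊔ D.submodule) (C'.submodule ⊔ D'.submodule) := by
  simp only [SameIntersections, SameBasePoints, realCount_eq, imagCount_eq]

/-- Nondegenerate pencils whose base points have the same types are in the same orbit. -/
theorem SameBasePoints.sameOrbit {W W' : Submodule ℝ TernaryForm}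
    (hW : IsNondegeneratePencil W) (hW' : IsNondegeneratePencil W') (h : SameBasePoints W W') :
    SameOrbit W W' := by
  obtain ⟨o, ho⟩ := exists_sameOrbit_levy hW
  obtain ⟨o', ho'⟩ := exists_sameOrbit_levy hW'
  have key : o = o' := OrbitName.eq_of_sameBasePoints fun m hm => by
    rw [← ho.pencilRealCount_eq, ← ho.pencilImagCount_eq, ← ho'.pencilRealCount_eq,
      ← ho'.pencilImagCount_eq]
    exact h m hm
  subst key
  exact ho.trans ho'.symm


/-! ### Conics of nondegenerate forms, and rigid isotopies -/

/-- The proper conic of a nondegenerate form. -/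
noncomputable abbrev conic (q : TernaryForm) (h : disc q ≠ 0) : Conic :=
  Projectivization.mk ℝ q (ne_zero_of_disc h)

/-- The saturation of an open set is the union of its multiples by nonzero scalars. Openness of the
map, and not only the quotient topology, makes products of two such maps quotient maps again. -/
theorem isOpenQuotientMap_mk :
    IsOpenQuotientMap (fun v : {v : TernaryForm // v ≠ 0} => Projectivization.mk ℝ v.1 v.2) where
  surjective := fun C => ⟨⟨C.rep, C.rep_nonzero⟩, C.mk_rep⟩
  continuous := continuous_quotient_mk'
  isOpenMap := by
    intro U hU
    have hq : Topology.IsQuotientMap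
      (fun v : {v : TernaryForm // v ≠ 0} => Projectivization.mk ℝ v.1 v.2) :=
      isQuotientMap_quotient_mk'
    rw [← hq.isOpen_preimage]
    have : (fun v : {v : TernaryForm // v ≠ 0} => Projectivization.mk ℝ v.1 v.2) ⁻¹'
        ((fun v : {v : TernaryForm // v ≠ 0} => Projectivization.mk ℝ v.1 v.2) '' U) =
        ⋃ a : ℝˣ, (fun v : {v : TernaryForm // v ≠ 0} =>
          (⟨a • v.1, (smul_ne_zero_iff_ne a).2 v.2⟩ : {v : TernaryForm // v ≠ 0})) ⁻¹' U := by
      ext v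
      simp only [Set.mem_preimage, Set.mem_image, Set.mem_iUnion]
      constructor
      · rintro ⟨w, hw, h⟩
        obtain ⟨a, ha⟩ := (Projectivization.mk_eq_mk_iff ℝ _ _ w.2 v.2).1 h
        refine ⟨a, ?_⟩
        convert hw
      · rintro ⟨a, ha⟩
        exact ⟨_, ha, (Projectivization.mk_eq_mk_iff ℝ _ _ _ v.2).2 ⟨a, rfl⟩⟩
    rw [this]
    refine isOpen_iUnion fun a => hU.preimage ?_
    exact Continuous.subtype_mk (continuous_subtype_val.const_smul a) _

theorem continuous_conic {X : Type*} [TopologicalSpace X] {F : X → TernaryForm}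
    (hF : Continuous F) (h : ∀ t, disc (F t) ≠ 0) : Continuous fun t => conic (F t) (h t) :=
  isOpenQuotientMap_mk.continuous.comp (hF.subtype_mk fun t => ne_zero_of_disc (h t))

theorem conic_smul {q : TernaryForm} (h : disc q ≠ 0) {a : ℝ} (ha : disc (a • q) ≠ 0) :
    conic (a • q) ha = conic q h :=
  (Projectivization.mk_eq_mk_iff' ℝ _ _ _ _).2 ⟨a, rfl⟩

theorem conic_rep {C : Conic} (h : IsProper C) : conic C.rep h = C := C.mk_rep

theorem linearIndependent_pair_of_ne {f g : TernaryForm} (hf : f ≠ 0) (hg : g ≠ 0)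
    (h : Projectivization.mk ℝ f hf ≠ Projectivization.mk ℝ g hg) :
    LinearIndependent ℝ ![f, g] := by
  rw [LinearIndependent.pair_iff' hf]
  intro a ha
  exact h ((Projectivization.mk_eq_mk_iff' ℝ _ _ _ _).2 (by
    have ha0 : a ≠ 0 := by
      rintro rfl
      exact hg (by rw [← ha, zero_smul])
    exact ⟨a⁻¹, by rw [← ha, inv_smul_smul₀ ha0]⟩))

theorem mk_ne_mk_of_linearIndependent {f g : TernaryForm} (hf : f ≠ 0) (hg : g ≠ 0)
    (h : LinearIndependent ℝ ![f, g]) :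
    Projectivization.mk ℝ f hf ≠ Projectivization.mk ℝ g hg := by
  intro e
  obtain ⟨a, ha⟩ := (Projectivization.mk_eq_mk_iff' ℝ _ _ _ _).1 e.symm
  exact (LinearIndependent.pair_iff' hf).1 h a ha

theorem conic_submodule_sup {f g : TernaryForm} (hf : disc f ≠ 0) (hg : disc g ≠ 0) :
    (conic f hf).submodule ⊔ (conic g hg).submodule = span₂ f g := by
  rw [Projectivization.submodule_mk, Projectivization.submodule_mk, ← Submodule.span_union,
    Set.singleton_union]

/-- A path of pairs of forms whose pencils stay in one orbit gives a rigid isotopy. -/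
theorem rigidlyIsotopic_of_path {F G : unitInterval → TernaryForm} (hF : Continuous F)
    (hG : Continuous G) (hF' : ∀ t, disc (F t) ≠ 0) (hG' : ∀ t, disc (G t) ≠ 0)
    (hi : ∀ t, LinearIndependent ℝ ![F t, G t])
    (ho : ∀ t, SameOrbit (span₂ (F 0) (G 0)) (span₂ (F t) (G t))) :
    RigidlyIsotopic (conic (F 0) (hF' 0), conic (G 0) (hG' 0))
      (conic (F 1) (hF' 1), conic (G 1) (hG' 1)) := by
  refine ⟨⟨⟨fun t => (conic (F t) (hF' t), conic (G t) (hG' t)),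
    (continuous_conic hF hF').prodMk (continuous_conic hG hG')⟩, rfl, rfl⟩, fun t => ⟨⟨?_, ?_, ?_⟩, ?_⟩⟩
  · exact mk_ne_mk_of_linearIndependent _ _ (hi t)
  · exact isProper_mk (hF' t)
  · exact isProper_mk (hG' t)
  · refine sameIntersections_of_sameOrbit ?_
    rw [conic_submodule_sup]
    refine (ho t).trans ?_
    rw [conic_submodule_sup]
    exact SameOrbit.refl _

/-! ### Changes of variables are rigid isotopies -/

theorem disc_subst_ne_zero {M : Matrix (Fin 3) (Fin 3) ℝ} (hM : M.det ≠ 0) {q : TernaryForm}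
    (h : disc q ≠ 0) : disc (subst M q) ≠ 0 := by
  rw [disc_subst]
  exact mul_ne_zero (pow_ne_zero _ hM) h

theorem linearIndependent_subst {M : Matrix (Fin 3) (Fin 3) ℝ} (hM : M.det ≠ 0)
    {f g : TernaryForm} (h : LinearIndependent ℝ ![f, g]) :
    LinearIndependent ℝ ![subst M f, subst M g] := by
  rw [LinearIndependent.pair_iff] at h ⊢
  intro a b hab
  apply h a b
  by_contra hn
  rw [← subst_smul, ← subst_smul, ← subst_add] at hab
  exact subst_ne_zero hM hn hab

/-- The substitution `M` moves all pairs of proper conics by rigid isotopies. -/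
def IsIsotopicMove (M : Matrix (Fin 3) (Fin 3) ℝ) : Prop :=
  ∀ (f g : TernaryForm) (hf : disc f ≠ 0) (hg : disc g ≠ 0) (hf' : disc (subst M f) ≠ 0)
    (hg' : disc (subst M g) ≠ 0), LinearIndependent ℝ ![f, g] →
    RigidlyIsotopic (conic f hf, conic g hg) (conic (subst M f) hf', conic (subst M g) hg')

theorem IsIsotopicMove.mul {M N : Matrix (Fin 3) (Fin 3) ℝ} (hM0 : M.det ≠ 0)
    (hM : IsIsotopicMove M) (hN : IsIsotopicMove N) : IsIsotopicMove (M * N) := by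
  intro f g hf hg hf' hg' hi
  have h1 := hM f g hf hg (disc_subst_ne_zero hM0 hf) (disc_subst_ne_zero hM0 hg) hi
  have h2 := hN (subst M f) (subst M g) (disc_subst_ne_zero hM0 hf) (disc_subst_ne_zero hM0 hg)
    (by rwa [subst_subst]) (by rwa [subst_subst]) (linearIndependent_subst hM0 hi)
  simp only [subst_subst] at h2
  exact h1.trans h2

theorem subst_neg (M : Matrix (Fin 3) (Fin 3) ℝ) (q : TernaryForm) :
    subst (-M) q = subst M q := Subtype.ext (by simp [subst])

/-- Quadratic forms do not see the sign of a substitution. As `-1` has determinant `-1` in dimension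
three, this connects the two components of `GL(3, ℝ)` for the present purpose. -/
theorem IsIsotopicMove.of_neg {M : Matrix (Fin 3) (Fin 3) ℝ} (h : IsIsotopicMove (-M)) :
    IsIsotopicMove M := by
  intro f g hf hg
  have := h f g hf hg
  simpa only [subst_neg] using this

theorem continuous_subst {X : Type*} [TopologicalSpace X] {M : X → Matrix (Fin 3) (Fin 3) ℝ}
    (hM : Continuous M) (q : TernaryForm) : Continuous fun t => subst (M t) q :=
  ((hM.matrix_transpose.matrix_mul continuous_const).matrix_mul hM).subtype_mk _

theorem isIsotopicMove_of_path {M : unitInterval → Matrix (Fin 3) (Fin 3) ℝ} (hM : Continuous M)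
    (h0 : M 0 = 1) (hd : ∀ t, (M t).det ≠ 0) : IsIsotopicMove (M 1) := by
  intro f g hf hg hf' hg' hi
  have := rigidlyIsotopic_of_path (continuous_subst hM f) (continuous_subst hM g)
    (fun t => disc_subst_ne_zero (hd t) hf) (fun t => disc_subst_ne_zero (hd t) hg)
    (fun t => linearIndependent_subst (hd t) hi) (fun t => by
      rw [h0, subst_one, subst_one]
      exact sameOrbit_span₂_subst (hd t) f g)
  simpa only [h0, subst_one] using this

theorem isIsotopicMove_transvection {i j : Fin 3} (hij : i ≠ j) (c : ℝ) :
    IsIsotopicMove (Matrix.transvection i j c) := by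
  have := isIsotopicMove_of_path
    (M := fun t : unitInterval => Matrix.transvection i j ((t : ℝ) * c)) ?_ ?_ ?_
  · simpa using this
  · have h : Continuous fun c : ℝ => Matrix.transvection i j c := by
      simp only [Matrix.transvection]
      refine continuous_const.add ?_
      refine continuous_matrix fun a b => ?_
      simp only [Matrix.single_apply]
      split_ifs
      · exact continuous_id
      · exact continuous_const
    exact h.comp (continuous_subtype_val.mul continuous_const)
  · simp
  · intro t
    rw [Matrix.det_transvection_of_ne _ _ hij]
    exact one_ne_zero

theorem isIsotopicMove_diagonal_of_pos {d : Fin 3 → ℝ} (hd : ∀ i, 0 < d i) :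
    IsIsotopicMove (Matrix.diagonal d) := by
  have := isIsotopicMove_of_path
    (M := fun t : unitInterval => Matrix.diagonal fun i => 1 - (t : ℝ) + t * d i) ?_ ?_ ?_
  · simpa using this
  · refine Continuous.matrix_diagonal (continuous_pi fun i => ?_)
    fun_prop
  · simp
  · intro t
    rw [Matrix.det_diagonal]
    refine Finset.prod_ne_zero_iff.2 fun i _ => ne_of_gt ?_
    have h0 := t.2.1
    have h1 := t.2.2
    rcases h0.eq_or_lt with h | h
    · rw [← h]
      norm_num
    · have := mul_pos h (hd i)
      linarith

/-- Minus the reflection of the `i`-th axis is the half-turn about that axis, which rotations join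
to the identity. -/
theorem isIsotopicMove_flip (i : Fin 3) :
    IsIsotopicMove (Matrix.diagonal (Function.update 1 i (-1))) := by
  have hc : Continuous fun t : unitInterval => Real.cos (Real.pi * (t : ℝ)) :=
    Real.continuous_cos.comp (continuous_const.mul continuous_subtype_val)
  have hs : Continuous fun t : unitInterval => Real.sin (Real.pi * (t : ℝ)) :=
    Real.continuous_sin.comp (continuous_const.mul continuous_subtype_val)
  have key (t : unitInterval) : Real.cos (Real.pi * (t : ℝ)) * Real.cos (Real.pi * (t : ℝ)) +
      Real.sin (Real.pi * (t : ℝ)) * Real.sin (Real.pi * (t : ℝ)) = 1 := by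
    have := Real.sin_sq_add_cos_sq (Real.pi * (t : ℝ))
    linarith
  apply IsIsotopicMove.of_neg
  fin_cases i
  · have := isIsotopicMove_of_path (M := fun t : unitInterval =>
      !![1, 0, 0; 0, Real.cos (Real.pi * (t : ℝ)), -Real.sin (Real.pi * (t : ℝ));
        0, Real.sin (Real.pi * (t : ℝ)), Real.cos (Real.pi * (t : ℝ))]) ?_ ?_ ?_
    · convert this using 1
      ext a b
      fin_cases a <;> fin_cases b <;> simp
    · refine continuous_matrix fun a b => ?_
      fin_cases a <;> fin_cases b <;> simp <;> fun_prop
    · ext a b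
      fin_cases a <;> fin_cases b <;> simp
    · intro t
      simp [Matrix.det_fin_three, key]
  · have := isIsotopicMove_of_path (M := fun t : unitInterval =>
      !![Real.cos (Real.pi * (t : ℝ)), 0, -Real.sin (Real.pi * (t : ℝ)); 0, 1, 0;
        Real.sin (Real.pi * (t : ℝ)), 0, Real.cos (Real.pi * (t : ℝ))]) ?_ ?_ ?_
    · convert this using 1
      ext a b
      fin_cases a <;> fin_cases b <;> simp
    · refine continuous_matrix fun a b => ?_
      fin_cases a <;> fin_cases b <;> simp <;> fun_prop
    · ext a b
      fin_cases a <;> fin_cases b <;> simp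
    · intro t
      simp [Matrix.det_fin_three, key]
  · have := isIsotopicMove_of_path (M := fun t : unitInterval =>
      !![Real.cos (Real.pi * (t : ℝ)), -Real.sin (Real.pi * (t : ℝ)), 0;
        Real.sin (Real.pi * (t : ℝ)), Real.cos (Real.pi * (t : ℝ)), 0; 0, 0, 1]) ?_ ?_ ?_
    · convert this using 1
      ext a b
      fin_cases a <;> fin_cases b <;> simp
    · refine continuous_matrix fun a b => ?_
      fin_cases a <;> fin_cases b <;> simp <;> fun_prop
    · ext a b
      fin_cases a <;> fin_cases b <;> simp
    · intro t
      simp [Matrix.det_fin_three, key]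

theorem isIsotopicMove_one : IsIsotopicMove 1 :=
  isIsotopicMove_of_path (M := fun _ => 1) continuous_const rfl (by simp)

theorem isIsotopicMove_sign {d : Fin 3 → ℝ} (hd : ∀ i, d i = 1 ∨ d i = -1) :
    IsIsotopicMove (Matrix.diagonal d) := by
  have hdet (i : Fin 3) : (Matrix.diagonal (Function.update (1 : Fin 3 → ℝ) i (-1))).det ≠ 0 := by
    rw [Matrix.det_diagonal]
    refine Finset.prod_ne_zero_iff.2 fun j _ => ?_
    by_cases h : j = i
    · subst h
      simp
    · simp [h]
  have key (i : Fin 3) : ∃ M, M.det ≠ 0 ∧ IsIsotopicMove M ∧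
      M = Matrix.diagonal (Function.update (1 : Fin 3 → ℝ) i (d i)) := by
    rcases hd i with h | h
    · refine ⟨1, by simp, isIsotopicMove_one, ?_⟩
      have h1 : Function.update (1 : Fin 3 → ℝ) i 1 = 1 := Function.update_eq_self i 1
      rw [h, h1]
      exact Matrix.diagonal_one.symm
    · exact ⟨_, hdet i, isIsotopicMove_flip i, by rw [h]⟩
  obtain ⟨M, hM, hM', rfl⟩ := key 0
  obtain ⟨N, hN, hN', rfl⟩ := key 1
  obtain ⟨K, hK, hK', rfl⟩ := key 2
  convert (hM'.mul hM hN').mul (by rw [Matrix.det_mul]; exact mul_ne_zero hM hN) hK' using 1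
  rw [Matrix.diagonal_mul_diagonal, Matrix.diagonal_mul_diagonal]
  congr 1
  ext i
  fin_cases i <;> simp

/-- Gaussian elimination: an invertible matrix is a product of transvections and of a diagonal
matrix, and the latter splits into its absolute values and its signs. -/
theorem isIsotopicMove {M : Matrix (Fin 3) (Fin 3) ℝ} (hM : M.det ≠ 0) : IsIsotopicMove M := by
  refine Matrix.diagonal_transvection_induction_of_det_ne_zero IsIsotopicMove M hM ?_ ?_ ?_
  · intro d hd
    rw [Matrix.det_diagonal, Finset.prod_ne_zero_iff] at hd
    have h1 : Matrix.diagonal d = Matrix.diagonal (fun i => |d i|) *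
        Matrix.diagonal (fun i => if 0 < d i then (1 : ℝ) else -1) := by
      rw [Matrix.diagonal_mul_diagonal]
      congr 1
      ext i
      split_ifs with h
      · rw [abs_of_pos h, mul_one]
      · rw [abs_of_nonpos (not_lt.1 h)]
        ring
    rw [h1]
    refine IsIsotopicMove.mul ?_
      (isIsotopicMove_diagonal_of_pos fun i => abs_pos.2 (hd i (Finset.mem_univ i)))
      (isIsotopicMove_sign fun i => ?_)
    · rw [Matrix.det_diagonal]
      exact Finset.prod_ne_zero_iff.2 fun i hi => abs_ne_zero.2 (hd i hi)
    · split_ifs <;> simp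
  · intro t
    exact isIsotopicMove_transvection t.hij t.c
  · intro A B hA _ h1 h2
    exact h1.mul hA h2


/-! ### Open sets of conics -/

/-- `C.rep` is a chosen form that need not depend continuously on `C`; invariance of the condition
under nonzero factors makes the choice irrelevant. -/
theorem isOpen_setOf_rep {φ : TernaryForm → ℝ} (hφ : Continuous φ)
    (h : ∀ (a : ℝ) (q : TernaryForm), a ≠ 0 → 0 < φ q → 0 < φ (a • q)) :
    IsOpen {C : Conic | 0 < φ C.rep} := by
  rw [← isOpenQuotientMap_mk.isQuotientMap.isOpen_preimage]
  convert isOpen_lt continuous_const (hφ.comp continuous_subtype_val) using 1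
  ext ⟨v, hv⟩
  obtain ⟨a, ha⟩ := Projectivization.exists_smul_eq_mk_rep ℝ v hv
  show 0 < φ (Projectivization.mk ℝ v hv).rep ↔ 0 < φ v
  rw [← ha, Units.smul_def]
  constructor
  · intro h'
    have := h (a : ℝ)⁻¹ _ (inv_ne_zero a.ne_zero) h'
    rwa [inv_smul_smul₀ a.ne_zero] at this
  · exact h _ _ a.ne_zero

theorem isOpen_setOf_rep_prod {φ : TernaryForm → TernaryForm → ℝ}
    (hφ : Continuous fun z : TernaryForm × TernaryForm => φ z.1 z.2)
    (h : ∀ (a b : ℝ) (q r : TernaryForm), a ≠ 0 → b ≠ 0 → 0 < φ q r → 0 < φ (a • q) (b • r)) :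
    IsOpen {z : Conic × Conic | 0 < φ z.1.rep z.2.rep} := by
  have hq := (isOpenQuotientMap_mk.prodMap isOpenQuotientMap_mk).isQuotientMap
  rw [← hq.isOpen_preimage]
  convert isOpen_lt continuous_const (hφ.comp
    (continuous_subtype_val.prodMap continuous_subtype_val)) using 1
  ext ⟨⟨v, hv⟩, ⟨w, hw⟩⟩
  obtain ⟨a, ha⟩ := Projectivization.exists_smul_eq_mk_rep ℝ v hv
  obtain ⟨b, hb⟩ := Projectivization.exists_smul_eq_mk_rep ℝ w hw
  show 0 < φ (Projectivization.mk ℝ v hv).rep (Projectivization.mk ℝ w hw).rep ↔ 0 < φ v w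
  rw [← ha, ← hb, Units.smul_def, Units.smul_def]
  constructor
  · intro h'
    have := h (a : ℝ)⁻¹ (b : ℝ)⁻¹ _ _ (inv_ne_zero a.ne_zero) (inv_ne_zero b.ne_zero) h'
    rwa [inv_smul_smul₀ a.ne_zero, inv_smul_smul₀ b.ne_zero] at this
  · exact h _ _ _ _ a.ne_zero b.ne_zero

/-! ### Arcs of pencils whose discriminant splits into linear factors -/

/-- On `W` the discriminant is a multiple of the product of the linear functionals `ℓ i`. -/
def Splits (W : Submodule ℝ TernaryForm) (ℓ : Fin 3 → TernaryForm →ₗ[ℝ] ℝ) : Prop :=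
  ∃ κ : ℝ, ∀ q ∈ W, disc q = κ * ∏ i, ℓ i q

/-- On `W` the discriminant has the same zeros as the linear functional `ℓ`. -/
def HasOneArc (W : Submodule ℝ TernaryForm) (ℓ : TernaryForm →ₗ[ℝ] ℝ) : Prop :=
  ∀ q ∈ W, disc q = 0 ↔ ℓ q = 0

theorem Splits.exists_of_sameOrbit {W W' : Submodule ℝ TernaryForm} (h : SameOrbit W' W)
    {ℓ : Fin 3 → TernaryForm →ₗ[ℝ] ℝ} (hℓ : Splits W ℓ) : ∃ ℓ', Splits W' ℓ' := by
  obtain ⟨P, rfl⟩ := h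
  obtain ⟨κ, hκ⟩ := hℓ
  refine ⟨fun i => (ℓ i).comp (changeVars P), κ / P.1.det ^ 2, fun q hq => ?_⟩
  have hP : P.1.det ≠ 0 := P.det.ne_zero
  have := hκ _ (Submodule.mem_map_of_mem hq)
  rw [changeVars_eq_subst, disc_subst] at this
  rw [div_mul_eq_mul_div, eq_div_iff (pow_ne_zero _ hP), mul_comm, this]
  rfl

theorem HasOneArc.exists_of_sameOrbit {W W' : Submodule ℝ TernaryForm} (h : SameOrbit W' W)
    {ℓ : TernaryForm →ₗ[ℝ] ℝ} (hℓ : HasOneArc W ℓ) : ∃ ℓ', HasOneArc W' ℓ' := by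
  obtain ⟨P, rfl⟩ := h
  refine ⟨ℓ.comp (changeVars P), fun q hq => ?_⟩
  have hP : P.1.det ≠ 0 := P.det.ne_zero
  have := hℓ _ (Submodule.mem_map_of_mem hq)
  rw [changeVars_eq_subst, disc_subst] at this
  rw [LinearMap.comp_apply, changeVars_eq_subst, ← this, mul_eq_zero]
  simp [hP]

theorem Splits.apply_ne_zero {W : Submodule ℝ TernaryForm} {ℓ : Fin 3 → TernaryForm →ₗ[ℝ] ℝ}
    (hℓ : Splits W ℓ) {q : TernaryForm} (hq : q ∈ W) (hd : disc q ≠ 0) (i : Fin 3) :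
    ℓ i q ≠ 0 := by
  obtain ⟨κ, hκ⟩ := hℓ
  rw [hκ q hq] at hd
  exact Finset.prod_ne_zero_iff.1 (right_ne_zero_of_mul hd) i (Finset.mem_univ i)

theorem rep_mem_of_submodule_le {C : Conic} {W : Submodule ℝ TernaryForm}
    (h : C.submodule ≤ W) : C.rep ∈ W := by
  apply h
  rw [Projectivization.submodule_eq]
  exact Submodule.mem_span_singleton_self _

theorem conic_mem_properConics {q : TernaryForm} (hd : disc q ≠ 0) {W : Submodule ℝ TernaryForm}
    (hq : q ∈ W) : conic q hd ∈ properConics W := by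
  refine ⟨?_, isProper_mk hd⟩
  rw [Projectivization.submodule_mk, Submodule.span_singleton_le_iff_mem]
  exact hq

/-- Conics that are joined by a path of proper conics of the pencil are on the same arc. -/
theorem mem_connectedComponentIn_of_path {W : Submodule ℝ TernaryForm}
    {F : unitInterval → TernaryForm} (hF : Continuous F) (hW : ∀ t, F t ∈ W)
    (hd : ∀ t, disc (F t) ≠ 0) :
    conic (F 1) (hd 1) ∈ connectedComponentIn (properConics W) (conic (F 0) (hd 0)) := by
  have h := (isPreconnected_range (continuous_conic hF hd)).subset_connectedComponentIn
    (Set.mem_range_self (0 : unitInterval)) (F := properConics W)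
    (by rintro _ ⟨t, rfl⟩; exact conic_mem_properConics _ (hW t))
  exact h (Set.mem_range_self (1 : unitInterval))

/-- A continuous function of even weight without zeros on the proper conics of a pencil has
constant sign on each arc. -/
theorem mul_pos_of_mem_connectedComponentIn {W : Submodule ℝ TernaryForm} {φ : TernaryForm → ℝ}
    (hφ : Continuous φ) (h : ∀ (a : ℝ) (q : TernaryForm), φ (a • q) = a ^ 2 * φ q)
    (h0 : ∀ q ∈ W, disc q ≠ 0 → φ q ≠ 0) {C D : Conic} (hC : C ∈ properConics W)
    (hD : D ∈ connectedComponentIn (properConics W) C) : 0 < φ C.rep * φ D.rep := by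
  by_contra hn
  have hD' := connectedComponentIn_subset _ _ hD
  have hC0 := h0 _ (rep_mem_of_submodule_le hC.1) hC.2
  have hD0 := h0 _ (rep_mem_of_submodule_le hD'.1) hD'.2
  have hpos : IsOpen {E : Conic | 0 < φ E.rep} := isOpen_setOf_rep hφ fun a q ha hq => by
    rw [h]
    positivity
  have hneg : IsOpen {E : Conic | 0 < -φ E.rep} :=
    isOpen_setOf_rep (φ := fun q => -φ q) hφ.neg fun a q ha hq => by
      rw [h, ← mul_neg]
      positivity
  have hsub : connectedComponentIn (properConics W) C ⊆
      {E : Conic | 0 < φ E.rep} ∪ {E : Conic | 0 < -φ E.rep} := by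
    intro E hE
    have hE' := connectedComponentIn_subset _ _ hE
    have := h0 _ (rep_mem_of_submodule_le hE'.1) hE'.2
    rcases lt_or_gt_of_ne this with h | h
    · exact Or.inr (neg_pos.2 h)
    · exact Or.inl h
  have hpre : IsPreconnected (connectedComponentIn (properConics W) C) :=
    isPreconnected_connectedComponentIn
  have hCm := mem_connectedComponentIn hC
  obtain ⟨E, -, h1, h2⟩ := hpre _ _ hpos hneg hsub (by
    rcases lt_or_gt_of_ne hC0 with h | h
    · refine ⟨D, hD, ?_⟩
      rcases lt_or_gt_of_ne hD0 with h' | h'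
      · exact absurd (mul_pos_of_neg_of_neg h h') hn
      · exact h'
    · exact ⟨C, hCm, h⟩) (by
    rcases lt_or_gt_of_ne hC0 with h | h
    · exact ⟨C, hCm, neg_pos.2 h⟩
    · refine ⟨D, hD, ?_⟩
      rcases lt_or_gt_of_ne hD0 with h' | h'
      · exact neg_pos.2 h'
      · exact absurd (mul_pos h h') hn)
  have h1' : 0 < φ E.rep := h1
  have h2' : 0 < -φ E.rep := h2
  linarith

/-- If a segment from `C` to a multiple of `D` avoids degenerate forms, the conics are on the
same arc. -/
theorem mem_connectedComponentIn_of_segment {W : Submodule ℝ TernaryForm} {C D : Conic}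
    (hC : C ∈ properConics W) (hD : D ∈ properConics W) {a : ℝ}
    (hd : ∀ t : unitInterval,
      disc ((1 - (t : ℝ)) • C.rep + (t : ℝ) • (a • D.rep)) ≠ 0) :
    D ∈ connectedComponentIn (properConics W) C := by
  have h := mem_connectedComponentIn_of_path (W := W)
    (F := fun t : unitInterval => (1 - (t : ℝ)) • C.rep + (t : ℝ) • (a • D.rep))
    (by fun_prop) (fun t => W.add_mem (W.smul_mem _ (rep_mem_of_submodule_le hC.1))
      (W.smul_mem _ (W.smul_mem _ (rep_mem_of_submodule_le hD.1)))) hd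
  have h0 : conic _ (hd 0) = C := by
    refine Eq.trans ?_ (conic_rep hC.2)
    congr 1
    simp
  have h1 : conic _ (hd 1) = D := by
    have ha : disc (a • D.rep) ≠ 0 := by
      have := hd 1
      simpa using this
    refine Eq.trans ?_ ((conic_smul hD.2 ha).trans (conic_rep hD.2))
    congr 1
    simp
  rw [h0, h1] at h
  exact h

theorem segment_ne_zero {x y : ℝ} (h : 0 < x * y) (t : unitInterval) :
    (1 - (t : ℝ)) * x + t * y ≠ 0 := by
  have h0 := t.2.1
  have h1 := t.2.2
  rcases pos_and_pos_or_neg_and_neg_of_mul_pos h with ⟨hx, hy⟩ | ⟨hx, hy⟩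
  · apply ne_of_gt
    rcases h0.eq_or_lt with h | h
    · rw [← h]
      linarith
    · have := mul_pos h hy
      have := mul_nonneg (sub_nonneg.2 h1) hx.le
      linarith
  · apply ne_of_lt
    rcases h0.eq_or_lt with h | h
    · rw [← h]
      linarith
    · have := mul_neg_of_pos_of_neg h hy
      have := mul_nonpos_of_nonneg_of_nonpos (sub_nonneg.2 h1) hx.le
      linarith

/-- The arc criterion for pencils whose discriminant splits. -/
theorem Splits.mem_connectedComponentIn_iff {W : Submodule ℝ TernaryForm}
    {ℓ : Fin 3 → TernaryForm →ₗ[ℝ] ℝ} (hℓ : Splits W ℓ) {C D : Conic}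
    (hC : C ∈ properConics W) (hD : D ∈ properConics W) :
    D ∈ connectedComponentIn (properConics W) C ↔
      ∀ i j, 0 < (ℓ i C.rep * ℓ j C.rep) * (ℓ i D.rep * ℓ j D.rep) := by
  have hCm := rep_mem_of_submodule_le hC.1
  have hDm := rep_mem_of_submodule_le hD.1
  constructor
  · intro h i j
    -- The sign of one `ℓ i` is not defined on conics, but that of a product of two is.
    refine mul_pos_of_mem_connectedComponentIn (φ := fun q => ℓ i q * ℓ j q)
      ((LinearMap.continuous_of_finiteDimensional _).mul
        (LinearMap.continuous_of_finiteDimensional _)) (fun a q => ?_) (fun q hq hd => ?_) hC h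
    · simp only [map_smul, smul_eq_mul]
      ring
    · exact mul_ne_zero (hℓ.apply_ne_zero hq hd i) (hℓ.apply_ne_zero hq hd j)
  · intro h
    have hx0 : ℓ 0 C.rep * ℓ 0 D.rep ≠ 0 :=
      mul_ne_zero (hℓ.apply_ne_zero hCm hC.2 0) (hℓ.apply_ne_zero hDm hD.2 0)
    -- The factor gives `ℓ 0` the same sign at both ends; the hypothesis then does so for every `ℓ
    -- i`, and none vanishes on the segment.
    refine mem_connectedComponentIn_of_segment hC hD (a := ℓ 0 C.rep * ℓ 0 D.rep) fun t => ?_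
    have hmem : (1 - (t : ℝ)) • C.rep + (t : ℝ) • ((ℓ 0 C.rep * ℓ 0 D.rep) • D.rep) ∈ W :=
      W.add_mem (W.smul_mem _ hCm) (W.smul_mem _ (W.smul_mem _ hDm))
    obtain ⟨κ, hκ⟩ := hℓ
    rw [hκ _ hmem]
    have hκ0 : κ ≠ 0 := by
      rintro rfl
      apply hC.2
      rw [hκ _ hCm, zero_mul]
    refine mul_ne_zero hκ0 (Finset.prod_ne_zero_iff.2 fun i _ => ?_)
    simp only [map_add, map_smul, smul_eq_mul]
    refine segment_ne_zero ?_ t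
    have := h 0 i
    calc _ < _ := this
      _ = _ := by ring

/-- A projective line minus the one point `ℓ = 0` is connected. -/
theorem HasOneArc.mem_connectedComponentIn {W : Submodule ℝ TernaryForm}
    {ℓ : TernaryForm →ₗ[ℝ] ℝ} (hℓ : HasOneArc W ℓ) {C D : Conic}
    (hC : C ∈ properConics W) (hD : D ∈ properConics W) :
    D ∈ connectedComponentIn (properConics W) C := by
  have hCm := rep_mem_of_submodule_le hC.1
  have hDm := rep_mem_of_submodule_le hD.1
  have hC0 : ℓ C.rep ≠ 0 := fun h => hC.2 ((hℓ _ hCm).2 h)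
  have hD0 : ℓ D.rep ≠ 0 := fun h => hD.2 ((hℓ _ hDm).2 h)
  refine mem_connectedComponentIn_of_segment hC hD (a := ℓ C.rep * ℓ D.rep) fun t h => ?_
  have hmem : (1 - (t : ℝ)) • C.rep + (t : ℝ) • ((ℓ C.rep * ℓ D.rep) • D.rep) ∈ W :=
    W.add_mem (W.smul_mem _ hCm) (W.smul_mem _ (W.smul_mem _ hDm))
  rw [hℓ _ hmem] at h
  simp only [map_add, map_smul, smul_eq_mul] at h
  refine segment_ne_zero ?_ t h
  have : 0 < (ℓ C.rep * ℓ D.rep) ^ 2 := by positivity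
  calc _ < _ := this
    _ = _ := by ring

/-! ### The mixed discriminant -/

/-- The coefficient of `s` in `disc (f + s g)`. -/
noncomputable def mixedDisc (f g : TernaryForm) : ℝ :=
  -- The odd part of the cubic `disc (f + s g)` at `s = 1` is the sum of the coefficients of `s` and
  -- `s³`, and the latter is `disc g`.
  (disc (f + g) - disc (f - g)) / 2 - disc g

theorem mixedDisc_smul (a b : ℝ) (f g : TernaryForm) :
    mixedDisc (a • f) (b • g) = a ^ 2 * b * mixedDisc f g := by
  have h1 (i j : Fin 3) : (a • f + b • g).1 i j = a * f.1 i j + b * g.1 i j := rfl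
  have h2 (i j : Fin 3) : (a • f - b • g).1 i j = a * f.1 i j - b * g.1 i j := rfl
  have h3 (i j : Fin 3) : (f + g).1 i j = f.1 i j + g.1 i j := rfl
  have h4 (i j : Fin 3) : (f - g).1 i j = f.1 i j - g.1 i j := rfl
  have h5 (i j : Fin 3) : (b • g).1 i j = b * g.1 i j := rfl
  simp only [mixedDisc, disc, Matrix.det_fin_three, h1, h2, h3, h4, h5]
  ring

theorem continuous_mixedDisc :
    Continuous fun z : TernaryForm × TernaryForm => mixedDisc z.1 z.2 := by
  have h := continuous_disc
  unfold mixedDisc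
  fun_prop

/-- The coefficients of `disc (f + s g)` satisfy the sign conditions for having no positive
root, when `disc f` and `disc g` are normalized to have the same sign. -/
def Aligned (z : Conic × Conic) : Prop :=
  0 < mixedDisc z.2.rep z.1.rep * disc z.1.rep ∧ 0 < mixedDisc z.1.rep z.2.rep * disc z.2.rep

theorem isOpen_aligned : IsOpen {z | Aligned z} := by
  have hm := continuous_mixedDisc
  have hd := continuous_disc
  refine IsOpen.inter
    (isOpen_setOf_rep_prod (φ := fun f g => mixedDisc g f * disc f) ?_ ?_)
    (isOpen_setOf_rep_prod (φ := fun f g => mixedDisc f g * disc g) ?_ ?_)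
  · exact (hm.comp continuous_swap).mul (hd.comp continuous_fst)
  · intro a b q r ha hb h
    simp only [mixedDisc_smul, disc_smul]
    calc 0 < (a ^ 2 * b) ^ 2 * (mixedDisc r q * disc q) := by positivity
      _ = _ := by ring
  · exact hm.mul (hd.comp continuous_snd)
  · intro a b q r ha hb h
    simp only [mixedDisc_smul, disc_smul]
    calc 0 < (a * b ^ 2) ^ 2 * (mixedDisc q r * disc r) := by positivity
      _ = _ := by ring

/-- One of the two sign conditions fails strictly. -/
def Misaligned (z : Conic × Conic) : Prop :=
  0 < -(mixedDisc z.2.rep z.1.rep * disc z.1.rep) ∨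
    0 < -(mixedDisc z.1.rep z.2.rep * disc z.2.rep)

theorem isOpen_misaligned : IsOpen {z | Misaligned z} := by
  have hm := continuous_mixedDisc
  have hd := continuous_disc
  refine IsOpen.union
    (isOpen_setOf_rep_prod (φ := fun f g => -(mixedDisc g f * disc f)) ?_ ?_)
    (isOpen_setOf_rep_prod (φ := fun f g => -(mixedDisc f g * disc g)) ?_ ?_)
  · exact ((hm.comp continuous_swap).mul (hd.comp continuous_fst)).neg
  · intro a b q r ha hb h
    simp only [mixedDisc_smul, disc_smul]
    calc 0 < (a ^ 2 * b) ^ 2 * -(mixedDisc r q * disc q) := by positivity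
      _ = _ := by ring
  · exact (hm.mul (hd.comp continuous_snd)).neg
  · intro a b q r ha hb h
    simp only [mixedDisc_smul, disc_smul]
    calc 0 < (a * b ^ 2) ^ 2 * -(mixedDisc q r * disc r) := by positivity
      _ = _ := by ring

/-- The `r i` are the roots of `t³ - e₁t² + e₂t - e₃`, with `e₃ ≠ 0`. If `e₁, e₂ ≥ 0` and `e₃ > 0`,
this is negative for `t ≤ 0`, so all roots are positive; the other sign of `e₃` is symmetric. Weak
inequalities for `e₁` and `e₂` suffice. -/
theorem mul_pos_of_esymm_nonneg {r : Fin 3 → ℝ} (hr : ∀ i, r i ≠ 0)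
    (h1 : 0 ≤ (r 0 + r 1 + r 2) * (r 0 * r 1 * r 2))
    (h2 : 0 ≤ r 0 * r 1 + r 0 * r 2 + r 1 * r 2) (i j : Fin 3) : 0 < r i * r j := by
  have hroot (i : Fin 3) : r i ^ 3 - (r 0 + r 1 + r 2) * r i ^ 2 +
      (r 0 * r 1 + r 0 * r 2 + r 1 * r 2) * r i - r 0 * r 1 * r 2 = 0 := by
    fin_cases i <;> simp <;> ring
  have h3 : r 0 * r 1 * r 2 ≠ 0 := mul_ne_zero (mul_ne_zero (hr 0) (hr 1)) (hr 2)
  rcases lt_or_gt_of_ne h3 with h3 | h3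
  · have he1 : r 0 + r 1 + r 2 ≤ 0 := by
      by_contra hn
      exact absurd (mul_neg_of_pos_of_neg (not_le.1 hn) h3) (not_lt.2 h1)
    have hneg (i : Fin 3) : r i < 0 := by
      by_contra hn
      have hi := not_lt.1 hn
      have := hroot i
      have := pow_nonneg hi 3
      have := mul_nonneg (neg_nonneg.2 he1) (pow_nonneg hi 2)
      have := mul_nonneg h2 hi
      linarith
    exact mul_pos_of_neg_of_neg (hneg i) (hneg j)
  · have he1 : 0 ≤ r 0 + r 1 + r 2 := by
      by_contra hn
      exact absurd (mul_neg_of_neg_of_pos (not_le.1 hn) h3) (not_lt.2 h1)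
    have hpos (i : Fin 3) : 0 < r i := by
      by_contra hn
      have hi : 0 ≤ -r i := by linarith [not_lt.1 hn]
      have := hroot i
      have := pow_nonneg hi 3
      have := mul_nonneg he1 (pow_nonneg hi 2)
      have := mul_nonneg h2 hi
      nlinarith
    exact mul_pos (hpos i) (hpos j)

/-- In terms of the ratios `r i = ℓ i C / ℓ i D`, the two quantities in `Aligned` are `e₁e₃` and
`e₂`, up to a positive factor. Since weak and strict inequalities are equivalent here, two open
conditions that do not mention `ℓ` are complementary, and they detect whether the `r i` have the
same sign. -/
theorem Splits.aligned_tfae {C D : Conic} (hC : IsProper C) (hD : IsProper D)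
    {ℓ : Fin 3 → TernaryForm →ₗ[ℝ] ℝ} (hℓ : Splits (C.submodule ⊔ D.submodule) ℓ) :
    [Aligned (C, D), ¬ Misaligned (C, D),
      ∀ i j, 0 < (ℓ i C.rep * ℓ j C.rep) * (ℓ i D.rep * ℓ j D.rep)].TFAE := by
  have hCm : C.rep ∈ C.submodule ⊔ D.submodule := rep_mem_of_submodule_le le_sup_left
  have hDm : D.rep ∈ C.submodule ⊔ D.submodule := rep_mem_of_submodule_le le_sup_right
  have hp (i : Fin 3) := hℓ.apply_ne_zero hCm hC i
  have hq (i : Fin 3) := hℓ.apply_ne_zero hDm hD i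
  obtain ⟨κ, hκ⟩ := hℓ
  have hκ0 : κ ≠ 0 := by
    rintro rfl
    apply hC
    rw [hκ _ hCm, zero_mul]
  set p : Fin 3 → ℝ := fun i => ℓ i C.rep with hpdef
  set q : Fin 3 → ℝ := fun i => ℓ i D.rep with hqdef
  obtain ⟨r, hr⟩ : ∃ r : Fin 3 → ℝ, ∀ i, p i = r i * q i :=
    ⟨fun i => p i / q i, fun i => (div_mul_cancel₀ _ (hq i)).symm⟩
  have hr0 (i : Fin 3) : r i ≠ 0 := by
    intro h
    apply hp i
    show p i = 0
    rw [hr, h, zero_mul]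
  have hc0 : disc C.rep = κ * (p 0 * p 1 * p 2) := by
    rw [hκ _ hCm, Fin.prod_univ_three]
  have hc3 : disc D.rep = κ * (q 0 * q 1 * q 2) := by
    rw [hκ _ hDm, Fin.prod_univ_three]
  have hadd : disc (C.rep + D.rep) = κ * ((p 0 + q 0) * (p 1 + q 1) * (p 2 + q 2)) := by
    rw [hκ _ (Submodule.add_mem _ hCm hDm), Fin.prod_univ_three]
    simp only [map_add, hpdef, hqdef]
  have hsub : disc (C.rep - D.rep) = κ * ((p 0 - q 0) * (p 1 - q 1) * (p 2 - q 2)) := by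
    rw [hκ _ (Submodule.sub_mem _ hCm hDm), Fin.prod_univ_three]
    simp only [map_sub, hpdef, hqdef]
  have hadd' : disc (D.rep + C.rep) = κ * ((p 0 + q 0) * (p 1 + q 1) * (p 2 + q 2)) := by
    rw [add_comm, hadd]
  have hsub' : disc (D.rep - C.rep) = κ * ((q 0 - p 0) * (q 1 - p 1) * (q 2 - p 2)) := by
    rw [hκ _ (Submodule.sub_mem _ hDm hCm), Fin.prod_univ_three]
    simp only [map_sub, hpdef, hqdef]
  have hQ : 0 < (κ * (q 0 * q 1 * q 2)) ^ 2 := by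
    have h0 : q 0 ≠ 0 := hq 0
    have h1 : q 1 ≠ 0 := hq 1
    have h2 : q 2 ≠ 0 := hq 2
    positivity
  have e1 : mixedDisc D.rep C.rep * disc C.rep =
      (κ * (q 0 * q 1 * q 2)) ^ 2 * ((r 0 + r 1 + r 2) * (r 0 * r 1 * r 2)) := by
    rw [mixedDisc, hadd', hsub', hc0, hr, hr, hr]
    ring
  have e2 : mixedDisc C.rep D.rep * disc D.rep =
      (κ * (q 0 * q 1 * q 2)) ^ 2 * (r 0 * r 1 + r 0 * r 2 + r 1 * r 2) := by
    rw [mixedDisc, hadd, hsub, hc3, hr, hr, hr]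
    ring
  have e3 (i j : Fin 3) : (p i * p j) * (q i * q j) = (q i * q j) ^ 2 * (r i * r j) := by
    rw [hr, hr]
    ring
  have hqq (i j : Fin 3) : 0 < (q i * q j) ^ 2 := by
    have hi : q i ≠ 0 := hq i
    have hj : q j ≠ 0 := hq j
    positivity
  tfae_have 1 → 2 := by
    rintro ⟨h1, h2⟩ (h | h)
    · have h1' : 0 < mixedDisc D.rep C.rep * disc C.rep := h1
      have h' : 0 < -(mixedDisc D.rep C.rep * disc C.rep) := h
      linarith
    · have h1' : 0 < mixedDisc C.rep D.rep * disc D.rep := h2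
      have h' : 0 < -(mixedDisc C.rep D.rep * disc D.rep) := h
      linarith
  tfae_have 2 → 3 := by
    intro h i j
    have h1 : ¬ 0 < -(mixedDisc D.rep C.rep * disc C.rep) := fun h' => h (Or.inl h')
    have h2 : ¬ 0 < -(mixedDisc C.rep D.rep * disc D.rep) := fun h' => h (Or.inr h')
    rw [not_lt, neg_nonpos] at h1 h2
    rw [e1, mul_nonneg_iff_of_pos_left hQ] at h1
    rw [e2, mul_nonneg_iff_of_pos_left hQ] at h2
    have := e3 i j
    simp only [hpdef, hqdef] at this
    rw [this]
    exact mul_pos (hqq i j) (mul_pos_of_esymm_nonneg hr0 h1 h2 i j)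
  tfae_have 3 → 1 := by
    intro h
    have h' (i j : Fin 3) : 0 < r i * r j := by
      have h1 : 0 < (p i * p j) * (q i * q j) := h i j
      rw [e3] at h1
      exact (mul_pos_iff_of_pos_left (hqq i j)).1 h1
    constructor
    · show 0 < mixedDisc D.rep C.rep * disc C.rep
      rw [e1]
      refine mul_pos hQ ?_
      have h01 := mul_pos (h' 0 1) (h' 0 2)
      have h11 := mul_pos (h' 0 1) (h' 1 2)
      have h12 := mul_pos (h' 0 2) (h' 1 2)
      nlinarith
    · show 0 < mixedDisc C.rep D.rep * disc D.rep
      rw [e2]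
      exact mul_pos hQ (add_pos (add_pos (h' 0 1) (h' 0 2)) (h' 1 2))
  tfae_finish


/-! ### Arcs and couples of conics -/

/-- The pencil of two conics. -/
noncomputable abbrev couplePencil (z : Conic × Conic) : Submodule ℝ TernaryForm :=
  z.1.submodule ⊔ z.2.submodule

/-- The two conics are on the same arc of their pencil. -/
def SameArc (z : Conic × Conic) : Prop :=
  z.2 ∈ connectedComponentIn (properConics (couplePencil z)) z.1

theorem pencil_eq {s : ConicPair} {C D : Conic} (h : s.1 = s(C, D)) :
    pencil s = couplePencil (C, D) := by
  rw [pencil, h]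
  simp [Sym2.mem_iff, iSup_or, iSup_sup_eq, couplePencil]

theorem isNondegeneratePencil_couplePencil {C D : Conic} (hne : C ≠ D) (hC : IsProper C) :
    IsNondegeneratePencil (couplePencil (C, D)) := by
  have e : couplePencil (C, D) = span₂ C.rep D.rep := submodule_sup_eq_span₂ C D
  refine ⟨?_, C.rep, rep_mem_of_submodule_le le_sup_left, hC⟩
  rw [e]
  apply finrank_span₂
  apply linearIndependent_pair_of_ne C.rep_nonzero D.rep_nonzero
  rwa [C.mk_rep, D.mk_rep]

theorem left_mem_properConics {C D : Conic} (hC : IsProper C) :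
    C ∈ properConics (couplePencil (C, D)) := ⟨le_sup_left, hC⟩

theorem right_mem_properConics {C D : Conic} (hD : IsProper D) :
    D ∈ properConics (couplePencil (C, D)) := ⟨le_sup_right, hD⟩

theorem arc_eq {W : Submodule ℝ TernaryForm} {A : Set Conic} (hA : A ∈ arcs W) {C : Conic}
    (hC : C ∈ A) : A = connectedComponentIn (properConics W) C := by
  obtain ⟨E, hE, rfl⟩ := hA
  exact connectedComponentIn_eq hC

theorem ConicPair.exists_couple (s : ConicPair) :
    ∃ C D, s.1 = s(C, D) ∧ C ≠ D ∧ IsProper C ∧ IsProper D ∧ IsNonempty C ∧ IsNonempty D := by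
  obtain ⟨s, hs, hs'⟩ := s
  induction s using Sym2.ind with
  | _ C D =>
    have hC := hs' C (Sym2.mem_mk_left C D)
    have hD := hs' D (Sym2.mem_mk_right C D)
    exact ⟨C, D, rfl, by simpa using hs, hC.1, hD.1, hC.2, hD.2⟩

theorem isProper_of_eq {s : ConicPair} {C D : Conic} (h : s.1 = s(C, D)) :
    C ≠ D ∧ IsProper C ∧ IsProper D := by
  obtain ⟨s, hs, hs'⟩ := s
  subst h
  exact ⟨by simpa using hs, (hs' C (Sym2.mem_mk_left C D)).1, (hs' D (Sym2.mem_mk_right C D)).1⟩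

theorem isNondegeneratePencil_pencil (s : ConicPair) : IsNondegeneratePencil (pencil s) := by
  obtain ⟨C, D, h, hne, hC, -⟩ := s.exists_couple
  rw [pencil_eq h]
  exact isNondegeneratePencil_couplePencil hne hC

theorem onSameArc_iff {s : ConicPair} {C D : Conic} (h : s.1 = s(C, D)) :
    OnSameArc s ↔ SameArc (C, D) := by
  obtain ⟨-, hC, hD⟩ := isProper_of_eq h
  rw [OnSameArc, pencil_eq h, h]
  constructor
  · rintro ⟨A, hA, hm⟩
    have h1 := hm C (Sym2.mem_mk_left C D)
    have h2 := hm D (Sym2.mem_mk_right C D)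
    rw [arc_eq hA h1] at h2
    exact h2
  · intro h
    refine ⟨_, ⟨C, left_mem_properConics hC, rfl⟩, fun E hE => ?_⟩
    rcases Sym2.mem_iff.1 hE with rfl | rfl
    · exact mem_connectedComponentIn (left_mem_properConics hC)
    · exact h

theorem onDistinctArcs_iff (s : ConicPair) : OnDistinctArcs s ↔ ¬ OnSameArc s := by
  constructor
  · rintro ⟨C, D, h, A, hA, B, hB, hne, hC, hD⟩ ⟨A', hA', hm⟩
    rw [h] at hm
    have h1 := hm C (Sym2.mem_mk_left C D)
    have h2 := hm D (Sym2.mem_mk_right C D)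
    apply hne
    rw [arc_eq hA hC, arc_eq hB hD, ← arc_eq hA' h1, ← arc_eq hA' h2]
  · intro hn
    obtain ⟨C, D, h, -, hC, hD, -⟩ := s.exists_couple
    have hC' : C ∈ properConics (pencil s) := by
      rw [pencil_eq h]
      exact left_mem_properConics hC
    have hD' : D ∈ properConics (pencil s) := by
      rw [pencil_eq h]
      exact right_mem_properConics hD
    refine ⟨C, D, h, _, ⟨C, hC', rfl⟩, _, ⟨D, hD', rfl⟩, fun he => hn ?_,
      mem_connectedComponentIn hC', mem_connectedComponentIn hD'⟩
    refine ⟨_, ⟨C, hC', rfl⟩, fun E hE => ?_⟩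
    rw [h] at hE
    rcases Sym2.mem_iff.1 hE with rfl | rfl
    · exact mem_connectedComponentIn hC'
    · rw [he]
      exact mem_connectedComponentIn hD'

/-! ### Arcs of the named pencils -/

/-- An entry of the matrix, as a linear functional. -/
noncomputable def entry (i j : Fin 3) : TernaryForm →ₗ[ℝ] ℝ where
  toFun q := q.1 i j
  map_add' _ _ := rfl
  map_smul' _ _ := rfl

theorem entry_apply (i j : Fin 3) (q : TernaryForm) : entry i j q = q.1 i j := rfl

/-- Linear functionals of which the discriminant is a multiple of the product. -/
noncomputable def OrbitName.factors : OrbitName → Fin 3 → TernaryForm →ₗ[ℝ] ℝ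
  | .I => ![entry 0 0, entry 1 1, entry 2 2]
  | .Ia => ![entry 1 1, entry 0 0 - entry 0 2, entry 0 0 + entry 0 2]
  -- A default value: on this pencil the discriminant has only one real linear factor, and
  -- `HasOneArc` is used instead.
  | .Ib => 0
  | .II => ![entry 1 2, entry 0 1, entry 0 2]
  | .IIa => ![entry 1 1, entry 0 2, entry 0 2]
  | .III => ![entry 0 2, entry 0 2, entry 1 1]
  | .IIIa => ![entry 0 0, entry 1 1, entry 2 2]
  | .IV => ![entry 1 1, entry 0 2, entry 0 2]
  | .V => ![entry 1 1, entry 0 2, entry 0 2]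

theorem OrbitName.splits_levy {o : OrbitName} (ho : o ≠ .Ib) : Splits o.levy o.factors := by
  cases o <;> try (exact absurd rfl ho)
  case I => exact ⟨1, fun q hq => by
    obtain ⟨a, b, rfl⟩ := mem_span₂.1 hq
    simp only [smul_form, form_add_form, disc_form]
    simp [factors, Fin.prod_univ_three, entry_apply, form]⟩
  case Ia => exact ⟨1, fun q hq => by
    obtain ⟨a, b, rfl⟩ := mem_span₂.1 hq
    simp only [smul_form, form_add_form, disc_form]
    simp [factors, Fin.prod_univ_three, entry_apply, form]
    ring⟩
  case II => exact ⟨2, fun q hq => by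
    obtain ⟨a, b, rfl⟩ := mem_span₂.1 hq
    simp only [smul_form, form_add_form, disc_form]
    simp [factors, Fin.prod_univ_three, entry_apply, form]
    ring⟩
  case IIa => exact ⟨-1, fun q hq => by
    obtain ⟨a, b, rfl⟩ := mem_span₂.1 hq
    simp only [smul_form, form_add_form, disc_form]
    simp [factors, Fin.prod_univ_three, entry_apply, form]
    ring⟩
  case III => exact ⟨-1, fun q hq => by
    obtain ⟨a, b, rfl⟩ := mem_span₂.1 hq
    simp only [smul_form, form_add_form, disc_form]
    simp [factors, Fin.prod_univ_three, entry_apply, form]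
    ring⟩
  case IIIa => exact ⟨1, fun q hq => by
    obtain ⟨a, b, rfl⟩ := mem_span₂.1 hq
    simp only [smul_form, form_add_form, disc_form]
    simp [factors, Fin.prod_univ_three, entry_apply, form]⟩
  case IV => exact ⟨-1, fun q hq => by
    obtain ⟨a, b, rfl⟩ := mem_span₂.1 hq
    simp only [smul_form, form_add_form, disc_form]
    simp [factors, Fin.prod_univ_three, entry_apply, form]
    ring⟩
  case V => exact ⟨-1, fun q hq => by
    obtain ⟨a, b, rfl⟩ := mem_span₂.1 hq
    simp only [smul_form, form_add_form, disc_form]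
    simp [factors, Fin.prod_univ_three, entry_apply, form]
    ring⟩

theorem hasOneArc_levy_Ib : HasOneArc OrbitName.Ib.levy (entry 0 0) := by
  intro q hq
  obtain ⟨a, b, rfl⟩ := mem_span₂.1 hq
  have h : disc (a • form 1 1 (-1) 0 0 0 + b • form 0 0 0 0 1 0) = -(a * (a ^ 2 + b ^ 2 / 4)) := by
    simp only [smul_form, form_add_form, disc_form]
    ring
  have h' : entry 0 0 (a • form 1 1 (-1) 0 0 0 + b • form 0 0 0 0 1 0) = a := by
    simp [entry_apply, form]
  rw [h, h', neg_eq_zero, mul_eq_zero]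
  constructor
  · rintro (h | h)
    · exact h
    · nlinarith [sq_nonneg a, sq_nonneg b]
  · exact Or.inl

theorem IsNondegeneratePencil.splits_or_hasOneArc {W : Submodule ℝ TernaryForm}
    (hW : IsNondegeneratePencil W) : (∃ ℓ, Splits W ℓ) ∨ ∃ ℓ, HasOneArc W ℓ := by
  obtain ⟨o, ho⟩ := exists_sameOrbit_levy hW
  by_cases h : o = .Ib
  · subst h
    exact Or.inr (hasOneArc_levy_Ib.exists_of_sameOrbit ho)
  · exact Or.inl ((OrbitName.splits_levy h).exists_of_sameOrbit ho)

/-! ### Invariance of the pencil orbit and of the position under rigid isotopy -/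

/-- Only the two ends of the path matter: their base points have the same types, which determine the
orbit. -/
theorem RigidlyIsotopic.sameOrbit {x y : Conic × Conic} (h : RigidlyIsotopic x y) :
    SameOrbit (couplePencil x) (couplePencil y) := by
  obtain ⟨γ, hγ⟩ := h
  have h0 := (hγ 0).1
  have h1 := hγ 1
  rw [γ.source] at h0
  rw [γ.target] at h1
  exact SameBasePoints.sameOrbit (isNondegeneratePencil_couplePencil h0.1 h0.2.1)
    (isNondegeneratePencil_couplePencil h1.1.1 h1.1.2.1) (sameIntersections_iff.1 h1.2)

theorem Splits.sameArc_iff {C D : Conic} (hC : IsProper C) (hD : IsProper D)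
    {ℓ : Fin 3 → TernaryForm →ₗ[ℝ] ℝ} (hℓ : Splits (couplePencil (C, D)) ℓ) :
    SameArc (C, D) ↔ ∀ i j, 0 < (ℓ i C.rep * ℓ j C.rep) * (ℓ i D.rep * ℓ j D.rep) :=
  hℓ.mem_connectedComponentIn_iff (left_mem_properConics hC) (right_mem_properConics hD)

/-- All pencils along the path lie in one orbit. If their discriminants split, the times at which
the couple is aligned form a closed and open subset of the interval; otherwise each pencil has a
single arc. -/
theorem SameArc.of_rigidlyIsotopic {x y : Conic × Conic} (h : RigidlyIsotopic x y)
    (hx : SameArc x) : SameArc y := by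
  obtain ⟨γ, hγ⟩ := h
  have h0 := (hγ 0).1
  have h1 := (hγ 1).1
  have hnd (t : unitInterval) : IsNondegeneratePencil (couplePencil (γ t)) :=
    isNondegeneratePencil_couplePencil (hγ t).1.1 (hγ t).1.2.1
  have hx0 : IsNondegeneratePencil (couplePencil x) := by
    have := hnd 0
    rwa [γ.source] at this
  have horb (t : unitInterval) : SameOrbit (couplePencil (γ t)) (couplePencil x) :=
    (SameBasePoints.sameOrbit hx0 (hnd t) (sameIntersections_iff.1 (hγ t).2)).symm
  rcases hx0.splits_or_hasOneArc with ⟨ℓ, hℓ⟩ | ⟨ℓ, hℓ⟩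
  · have key (t : unitInterval) : (Aligned (γ t) ↔ ¬ Misaligned (γ t)) ∧
        (SameArc (γ t) ↔ Aligned (γ t)) := by
      obtain ⟨ℓ', hℓ'⟩ := hℓ.exists_of_sameOrbit (horb t)
      have ht := Splits.aligned_tfae (hγ t).1.2.1 (hγ t).1.2.2 hℓ'
      exact ⟨ht.out 0 1, (Splits.sameArc_iff (hγ t).1.2.1 (hγ t).1.2.2 hℓ').trans (ht.out 2 0)⟩
    have hclopen : IsClopen {t : unitInterval | Aligned (γ t)} := by
      refine ⟨⟨?_⟩, isOpen_aligned.preimage γ.continuous⟩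
      convert isOpen_misaligned.preimage γ.continuous using 1
      ext t
      show ¬ Aligned (γ t) ↔ Misaligned (γ t)
      rw [(key t).1, not_not]
    have h0m : (0 : unitInterval) ∈ {t : unitInterval | Aligned (γ t)} := by
      show Aligned (γ 0)
      rw [← (key 0).2, γ.source]
      exact hx
    have huniv := hclopen.eq_univ ⟨0, h0m⟩
    have h1m : (1 : unitInterval) ∈ {t : unitInterval | Aligned (γ t)} := by
      rw [huniv]
      trivial
    have := (key 1).2.2 h1m
    rwa [γ.target] at this
  · obtain ⟨ℓ', hℓ'⟩ := hℓ.exists_of_sameOrbit (horb 1)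
    have := hℓ'.mem_connectedComponentIn (left_mem_properConics h1.2.1)
      (right_mem_properConics h1.2.2)
    rw [← γ.target]
    exact this

theorem sameOrbit_pencil_of_equiv {s t : ConicPair} (h : s ≈ t) :
    SameOrbit (pencil s) (pencil t) := by
  obtain ⟨C, D, C', D', hs, ht, h⟩ := h
  rw [pencil_eq hs, pencil_eq ht]
  exact h.sameOrbit

theorem onSameArc_iff_of_equiv {s t : ConicPair} (h : s ≈ t) : OnSameArc s ↔ OnSameArc t := by
  obtain ⟨C, D, C', D', hs, ht, h⟩ := h
  rw [onSameArc_iff hs, onSameArc_iff ht]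
  exact ⟨fun h' => h'.of_rigidlyIsotopic h, fun h' => h'.of_rigidlyIsotopic h.symm⟩

/-! ### Arcs of non-empty conics -/

theorem isNonempty_iff {C : Conic} : IsNonempty C ↔ ∃ v : Fin 3 → ℝ, v ≠ 0 ∧ value C.rep v = 0 := by
  constructor
  · rintro ⟨p, hp⟩
    exact ⟨p.rep, p.rep_nonzero, hp⟩
  · rintro ⟨v, hv, h⟩
    have := isNonempty_mk C.rep_nonzero hv h
    rwa [C.mk_rep] at this

theorem isNonempty_conic_iff {q : TernaryForm} (hq : disc q ≠ 0) :
    IsNonempty (conic q hq) ↔ ∃ v : Fin 3 → ℝ, v ≠ 0 ∧ value q v = 0 := by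
  constructor
  · intro h
    obtain ⟨v, hv, h⟩ := isNonempty_iff.1 h
    obtain ⟨a, ha⟩ := Projectivization.exists_smul_eq_mk_rep ℝ q (ne_zero_of_disc hq)
    rw [← ha, Units.smul_def, value_smul] at h
    exact ⟨v, hv, (mul_eq_zero.1 h).resolve_left a.ne_zero⟩
  · rintro ⟨v, hv, h⟩
    exact isNonempty_mk _ hv h

theorem value_smul_add_smul (q : TernaryForm) (a b : ℝ) (v w : Fin 3 → ℝ) :
    value q (a • v + b • w) =
      a ^ 2 * value q v + 2 * (a * b) * (v ⬝ᵥ q.1.mulVec w) + b ^ 2 * value q w := by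
  have h : ∀ i j, q.1 i j = q.1 j i := fun i j => congrFun (congrFun q.2 j) i
  simp only [value, dotProduct, Matrix.mulVec, Fin.sum_univ_three, Pi.add_apply, Pi.smul_apply,
    smul_eq_mul, h 1 0, h 2 0, h 2 1]
  ring

/-- The form takes values of both signs. -/
def IsIndefinite (q : TernaryForm) : Prop := ∃ v w, 0 < -(value q v * value q w)

/-- On the line through `v` and `w` a zero is given by a quadratic equation whose discriminant is
nonnegative, as the values at `v` and `w` have opposite signs. -/
theorem IsIndefinite.exists_zero {q : TernaryForm} (h : IsIndefinite q) :
    ∃ v : Fin 3 → ℝ, v ≠ 0 ∧ value q v = 0 := by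
  obtain ⟨v, w, h⟩ := h
  have hw : value q w ≠ 0 := by
    intro h0
    simp [h0] at h
  set b := v ⬝ᵥ q.1.mulVec w with hb
  have hD : 0 ≤ b ^ 2 - value q v * value q w := by nlinarith [sq_nonneg b]
  set t := (-b + √(b ^ 2 - value q v * value q w)) / value q w with ht
  refine ⟨(1 : ℝ) • v + t • w, fun h0 => ?_, ?_⟩
  · have hv : v = (-t) • w := by
      rw [neg_smul, ← add_eq_zero_iff_eq_neg]
      simpa using h0
    rw [hv, value_smul_vec] at h
    nlinarith [mul_nonneg (sq_nonneg t) (sq_nonneg (value q w))]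
  · rw [value_smul_add_smul, ← hb]
    have e : t * value q w = -b + √(b ^ 2 - value q v * value q w) := by
      rw [ht, div_mul_cancel₀ _ hw]
    have hs := Real.sq_sqrt hD
    have : value q w * (1 ^ 2 * value q v + 2 * (1 * t) * b + t ^ 2 * value q w) = 0 := by
      calc _ = value q w * value q v + 2 * (t * value q w) * b + (t * value q w) ^ 2 := by ring
        _ = √(b ^ 2 - value q v * value q w) ^ 2 - (b ^ 2 - value q v * value q w) := by
          rw [e]
          ring
        _ = 0 := by rw [hs, sub_self]
    exact (mul_eq_zero.1 this).resolve_left hw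

/-- On the line `t v + A v`, where `A` is the matrix of the form, the form is affine in `t` with
slope `2 |A v|² ≠ 0`; the two vectors chosen give it the values `1` and `-1`. -/
theorem isIndefinite_of_value_eq_zero {q : TernaryForm} (hq : disc q ≠ 0) {v : Fin 3 → ℝ}
    (hv : v ≠ 0) (h : value q v = 0) : IsIndefinite q := by
  set w := q.1.mulVec v with hw
  have hw0 : w ≠ 0 := by
    intro h0
    exact hv (Matrix.eq_zero_of_mulVec_eq_zero hq h0)
  have hsymm : q.1.transpose = q.1 := q.2
  have hb : v ⬝ᵥ q.1.mulVec w = w ⬝ᵥ w := by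
    rw [Matrix.dotProduct_mulVec, ← Matrix.mulVec_transpose, hsymm]
  have hpos : 0 < w ⬝ᵥ w := by
    rw [← Matrix.dotProduct_star_self_pos_iff (v := w)] at hw0
    simpa using hw0
  have key (t : ℝ) : value q (t • v + (1 : ℝ) • w) = 2 * t * (w ⬝ᵥ w) + value q w := by
    rw [value_smul_add_smul, h, hb]
    ring
  refine ⟨((1 - value q w) / (2 * (w ⬝ᵥ w))) • v + (1 : ℝ) • w,
    ((-1 - value q w) / (2 * (w ⬝ᵥ w))) • v + (1 : ℝ) • w, ?_⟩
  rw [key, key]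
  field_simp
  norm_num

theorem isOpen_isIndefinite : IsOpen {C : Conic | IsIndefinite C.rep} := by
  have : {C : Conic | IsIndefinite C.rep} =
      ⋃ v, ⋃ w, {C : Conic | 0 < -(value C.rep v * value C.rep w)} := by
    ext C
    simp [IsIndefinite]
  rw [this]
  refine isOpen_iUnion fun v => isOpen_iUnion fun w =>
    isOpen_setOf_rep (φ := fun q => -(value q v * value q w)) ?_ fun a q ha h => ?_
  · unfold value
    fun_prop
  · rw [value_smul, value_smul]
    calc 0 < a ^ 2 * -(value q v * value q w) := by positivity
      _ = _ := by ring

/-- Sylvester's criterion, up to the sign of the form. -/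
def IsDefinite (q : TernaryForm) : Prop :=
  0 < q.1 0 0 * disc q ∧ 0 < q.1 0 0 * q.1 1 1 - q.1 0 1 ^ 2

theorem isOpen_isDefinite : IsOpen {C : Conic | IsDefinite C.rep} := by
  have hd := continuous_disc
  have hc (i j : Fin 3) : Continuous fun q : TernaryForm => q.1 i j :=
    continuous_subtype_val.matrix_elem i j
  refine IsOpen.inter (isOpen_setOf_rep (φ := fun q => q.1 0 0 * disc q) ((hc 0 0).mul hd)
    fun a q ha h => ?_)
    (isOpen_setOf_rep (φ := fun q => q.1 0 0 * q.1 1 1 - q.1 0 1 ^ 2)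
    (((hc 0 0).mul (hc 1 1)).sub ((hc 0 1).pow 2))
    fun a q ha h => ?_)
  · have e : (a • q).1 0 0 = a * q.1 0 0 := rfl
    rw [e, disc_smul]
    calc 0 < (a ^ 2) ^ 2 * (q.1 0 0 * disc q) := by positivity
      _ = _ := by ring
  · have e (i j : Fin 3) : (a • q).1 i j = a * q.1 i j := rfl
    rw [e, e, e]
    calc 0 < a ^ 2 * (q.1 0 0 * q.1 1 1 - q.1 0 1 ^ 2) := by positivity
      _ = _ := by ring

theorem IsDefinite.not_isIndefinite {q : TernaryForm} (h : IsDefinite q) : ¬ IsIndefinite q := by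
  obtain ⟨a, b, c, d, e, k, rfl⟩ := exists_eq_form q
  obtain ⟨h1, h2⟩ := h
  rw [disc_form] at h1
  simp only [form, Matrix.of_apply, Matrix.cons_val', Matrix.cons_val_zero, Matrix.cons_val_one,
    Matrix.cons_val_fin_one] at h1 h2
  rintro ⟨v, w, h⟩
  set m := a * b - (d / 2) ^ 2 with hm
  have ha : a ≠ 0 := by
    rintro rfl
    simp at h1
  -- Lagrange's reduction to squares, multiplied by `a` and by the minor `m` to clear denominators.
  have key (x : Fin 3 → ℝ) : m * (a * value (form a b c d e k) x) =
      m * (a * x 0 + d / 2 * x 1 + e / 2 * x 2) ^ 2 +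
        (m * x 1 + (a * k / 2 - d * e / 4) * x 2) ^ 2 +
        (a * (a * b * c + d * e * k / 4 - a * k ^ 2 / 4 - b * e ^ 2 / 4 - c * d ^ 2 / 4)) *
          x 2 ^ 2 := by
    have hx : x = ![x 0, x 1, x 2] := by
      ext i
      fin_cases i <;> rfl
    rw [hx, value_form, hm]
    simp only [Matrix.cons_val_zero, Matrix.cons_val_one, Matrix.cons_val]
    ring
  have hnn (x : Fin 3 → ℝ) : 0 ≤ a * value (form a b c d e k) x := by
    have : 0 ≤ m * (a * value (form a b c d e k) x) := by
      rw [key]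
      have := mul_nonneg h1.le (sq_nonneg (x 2))
      positivity
    exact (mul_nonneg_iff_of_pos_left h2).1 this
  have h3 := mul_nonneg (hnn v) (hnn w)
  have h4 : 0 < a ^ 2 * -(value (form a b c d e k) v * value (form a b c d e k) w) := by positivity
  nlinarith

theorem isDefinite_of_not_isIndefinite {q : TernaryForm} (hq : disc q ≠ 0)
    (h : ¬ IsIndefinite q) : IsDefinite q := by
  have hsame (v w : Fin 3 → ℝ) (hv : v ≠ 0) (hw : w ≠ 0) : 0 < value q v * value q w := by
    have h1 : value q v ≠ 0 := fun h0 => h (isIndefinite_of_value_eq_zero hq hv h0)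
    have h2 : value q w ≠ 0 := fun h0 => h (isIndefinite_of_value_eq_zero hq hw h0)
    by_contra hn
    have h3 := lt_of_le_of_ne (not_lt.1 hn) (mul_ne_zero h1 h2)
    exact h ⟨v, w, by linarith⟩
  obtain ⟨a, b, c, d, e, k, rfl⟩ := exists_eq_form q
  have e1 : value (form a b c d e k) ![1, 0, 0] = a := by
    rw [value_form]
    ring
  have e2 : value (form a b c d e k) ![-(d / 2), a, 0] = a * (a * b - (d / 2) ^ 2) := by
    rw [value_form]
    ring
  -- The vector is the third column of the adjugate matrix, so the value is the determinant times
  -- the minor `ab - (d/2)²`.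
  have e3 : value (form a b c d e k) ![d * k / 4 - b * e / 2, d * e / 4 - a * k / 2,
      a * b - (d / 2) ^ 2] =
      disc (form a b c d e k) * (a * b - (d / 2) ^ 2) := by
    rw [value_form, disc_form]
    ring
  have ha : a ≠ 0 := by
    have := hsame ![1, 0, 0] ![1, 0, 0] (vec_ne_zero (by norm_num)) (vec_ne_zero (by norm_num))
    rw [e1] at this
    rintro rfl
    simp at this
  have hm : 0 < a * b - (d / 2) ^ 2 := by
    have := hsame ![1, 0, 0] ![-(d / 2), a, 0] (vec_ne_zero (by norm_num))
      (vec_ne_zero (by simp [ha]))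
    rw [e1, e2, ← mul_assoc] at this
    exact (mul_pos_iff_of_pos_left (mul_self_pos.2 ha)).1 this
  have hd := hsame ![1, 0, 0] ![d * k / 4 - b * e / 2, d * e / 4 - a * k / 2,
      a * b - (d / 2) ^ 2] (vec_ne_zero (by norm_num)) (vec_ne_zero (Or.inr (Or.inr hm.ne')))
  rw [e1, e3, ← mul_assoc] at hd
  exact ⟨(mul_pos_iff_of_pos_right hm).1 hd, hm⟩

theorem IsProper.isNonempty_iff_isIndefinite {C : Conic} (hC : IsProper C) :
    IsNonempty C ↔ IsIndefinite C.rep := by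
  rw [isNonempty_iff]
  exact ⟨fun ⟨v, hv, h⟩ => isIndefinite_of_value_eq_zero hC hv h, fun h => h.exists_zero⟩

/-- The indefinite and the definite forms give two disjoint open sets of conics that cover the arc,
which is connected. -/
theorem IsNonempty.of_mem_connectedComponentIn {W : Submodule ℝ TernaryForm} {C D : Conic}
    (hC : C ∈ properConics W) (hne : IsNonempty C)
    (hD : D ∈ connectedComponentIn (properConics W) C) : IsNonempty D := by
  have hpre : IsPreconnected (connectedComponentIn (properConics W) C) :=
    isPreconnected_connectedComponentIn
  have hsub := connectedComponentIn_subset (properConics W) C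
  by_contra hn
  rw [(hsub hD).2.isNonempty_iff_isIndefinite] at hn
  obtain ⟨E, -, h1, h2⟩ := hpre _ _ isOpen_isIndefinite isOpen_isDefinite (fun E hE => by
      by_cases h : IsIndefinite E.rep
      · exact Or.inl h
      · exact Or.inr (isDefinite_of_not_isIndefinite (hsub hE).2 h))
    ⟨C, mem_connectedComponentIn hC, hC.2.isNonempty_iff_isIndefinite.1 hne⟩
    ⟨D, hD, isDefinite_of_not_isIndefinite (hsub hD).2 hn⟩
  exact IsDefinite.not_isIndefinite h2 h1

/-! ### Non-empty arcs and separated pairs -/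

theorem couplePencil_eq {W : Submodule ℝ TernaryForm} (hW : IsNondegeneratePencil W)
    {C D : Conic} (hne : C ≠ D) (hC : C.submodule ≤ W) (hD : D.submodule ≤ W) :
    couplePencil (C, D) = W := by
  rw [eq_span₂ hW.1 (rep_mem_of_submodule_le hC) (rep_mem_of_submodule_le hD)]
  · exact submodule_sup_eq_span₂ C D
  · apply linearIndependent_pair_of_ne C.rep_nonzero D.rep_nonzero
    rwa [C.mk_rep, D.mk_rep]

/-- The pair of two distinct proper non-empty conics. -/
def ConicPair.mk {C D : Conic} (hne : C ≠ D) (hC : IsProper C ∧ IsNonempty C)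
    (hD : IsProper D ∧ IsNonempty D) : ConicPair :=
  ⟨s(C, D), by simpa using hne, fun E hE => by
    rcases Sym2.mem_iff.1 hE with rfl | rfl
    · exact hC
    · exact hD⟩

/-- Picking one conic on each of two non-empty arcs gives a separated pair. Conversely the arcs of a
separated pair are non-empty because each contains a non-empty conic. -/
theorem two_le_encard_nonemptyArcs_iff {W : Submodule ℝ TernaryForm}
    (hW : IsNondegeneratePencil W) :
    2 ≤ (nonemptyArcs W).encard ↔ ∃ s, pencil s = W ∧ ¬ OnSameArc s := by
  have h2 : (2 : ℕ∞) ≤ (nonemptyArcs W).encard ↔ 1 < (nonemptyArcs W).encard := by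
    rw [← one_add_one_eq_two, ENat.add_one_le_iff ENat.one_ne_top]
  rw [h2, Set.one_lt_encard_iff]
  constructor
  · rintro ⟨A, B, ⟨hA, hA'⟩, ⟨hB, hB'⟩, hAB⟩
    obtain ⟨C, hC, rfl⟩ := hA
    obtain ⟨D, hD, rfl⟩ := hB
    have hCm := mem_connectedComponentIn hC
    have hDm := mem_connectedComponentIn hD
    have hne : C ≠ D := by
      rintro rfl
      exact hAB rfl
    refine ⟨ConicPair.mk hne ⟨hC.2, hA' C hCm⟩ ⟨hD.2, hB' D hDm⟩, ?_, fun h => hAB ?_⟩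
    · rw [pencil_eq rfl]
      exact couplePencil_eq hW hne hC.1 hD.1
    · rw [onSameArc_iff rfl, SameArc, couplePencil_eq hW hne hC.1 hD.1] at h
      exact connectedComponentIn_eq h
  · rintro ⟨s, rfl, hs⟩
    obtain ⟨C, D, h, -, hC, hD, hC', hD'⟩ := s.exists_couple
    rw [pencil_eq h]
    have hCm := left_mem_properConics (D := D) hC
    have hDm := right_mem_properConics (C := C) hD
    refine ⟨_, _, ⟨⟨C, hCm, rfl⟩, fun E hE => hC'.of_mem_connectedComponentIn hCm hE⟩,
      ⟨⟨D, hDm, rfl⟩, fun E hE => hD'.of_mem_connectedComponentIn hDm hE⟩, fun he => hs ?_⟩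
    rw [onSameArc_iff h, SameArc]
    exact he ▸ mem_connectedComponentIn hDm


/-! ### Equivalence of pairs of forms -/

/-- The conics of the forms are rigidly isotopic, possibly after an exchange. -/
def FormEquiv (f g f' g' : TernaryForm) : Prop :=
  ∃ (hf : disc f ≠ 0) (hg : disc g ≠ 0) (hf' : disc f' ≠ 0) (hg' : disc g' ≠ 0),
    RigidlyIsotopic (conic f hf, conic g hg) (conic f' hf', conic g' hg') ∨
      RigidlyIsotopic (conic f hf, conic g hg) (conic g' hg', conic f' hf')

theorem FormEquiv.swap_right {f g f' g' : TernaryForm} (h : FormEquiv f g f' g') :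
    FormEquiv f g g' f' := by
  obtain ⟨hf, hg, hf', hg', h⟩ := h
  exact ⟨hf, hg, hg', hf', h.symm⟩

theorem FormEquiv.swap_left {f g f' g' : TernaryForm} (h : FormEquiv f g f' g') :
    FormEquiv g f f' g' := by
  obtain ⟨hf, hg, hf', hg', h⟩ := h
  exact ⟨hg, hf, hf', hg', h.symm.imp (fun h => h.swap) (fun h => h.swap)⟩

theorem FormEquiv.trans {f g f' g' f'' g'' : TernaryForm} (h : FormEquiv f g f' g')
    (h' : FormEquiv f' g' f'' g'') : FormEquiv f g f'' g'' := by
  obtain ⟨hf, hg, hf', hg', h⟩ := h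
  obtain ⟨_, _, hf'', hg'', h'⟩ := h'
  refine ⟨hf, hg, hf'', hg'', ?_⟩
  rcases h with h | h <;> rcases h' with h' | h'
  · exact Or.inl (h.trans h')
  · exact Or.inr (h.trans h')
  · exact Or.inr (h.trans h'.swap)
  · exact Or.inl (h.trans h'.swap)

theorem formEquiv_smul {f g : TernaryForm} (hf : disc f ≠ 0) (hg : disc g ≠ 0)
    (hi : LinearIndependent ℝ ![f, g]) {a b : ℝ} (ha : a ≠ 0) (hb : b ≠ 0) :
    FormEquiv (a • f) (b • g) f g := by
  have haf : disc (a • f) ≠ 0 := by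
    rw [disc_smul]
    exact mul_ne_zero (pow_ne_zero _ ha) hf
  have hbg : disc (b • g) ≠ 0 := by
    rw [disc_smul]
    exact mul_ne_zero (pow_ne_zero _ hb) hg
  refine ⟨haf, hbg, hf, hg, Or.inl ?_⟩
  rw [conic_smul hf, conic_smul hg]
  exact RigidlyIsotopic.refl
    ⟨mk_ne_mk_of_linearIndependent _ _ hi, isProper_mk hf, isProper_mk hg⟩

theorem formEquiv_subst {M : Matrix (Fin 3) (Fin 3) ℝ} (hM : M.det ≠ 0) {f g : TernaryForm}
    (hf : disc f ≠ 0) (hg : disc g ≠ 0) (hi : LinearIndependent ℝ ![f, g]) :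
    FormEquiv f g (subst M f) (subst M g) :=
  ⟨hf, hg, disc_subst_ne_zero hM hf, disc_subst_ne_zero hM hg,
    Or.inl (isIsotopicMove hM _ _ _ _ _ _ hi)⟩

theorem linearIndependent_chart {A B : TernaryForm} (hAB : LinearIndependent ℝ ![A, B]) {u v : ℝ}
    (h : u ≠ v) : LinearIndependent ℝ ![A + u • B, A + v • B] := by
  rw [LinearIndependent.pair_iff] at hAB ⊢
  intro a b hab
  have := hAB (a + b) (a * u + b * v) (by
    rw [← hab]
    module)
  have h1 : b * (v - u) = 0 := by linear_combination this.2 - u * this.1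
  have hb : b = 0 := (mul_eq_zero.1 h1).resolve_right (sub_ne_zero.2 h.symm)
  exact ⟨by simpa [hb] using this.1, hb⟩

theorem span₂_chart (A B : TernaryForm) {u v : ℝ} (h : u ≠ v) :
    span₂ (A + u • B) (A + v • B) = span₂ A B :=
  span₂_eq_of_combination (a := 1) (b := u) (c := 1) (d := v)
    (by simpa using sub_ne_zero.2 h.symm) (by rw [one_smul]) (by rw [one_smul])

/-- Moving the parameters of two members of a pencil along intervals, in the same order. -/
theorem formEquiv_of_lt {A B : TernaryForm} (hAB : LinearIndependent ℝ ![A, B]) {J J' : Set ℝ}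
    (hJ : Convex ℝ J) (hJ' : Convex ℝ J') (hd : ∀ u ∈ J, disc (A + u • B) ≠ 0)
    (hd' : ∀ v ∈ J', disc (A + v • B) ≠ 0) {u v u' v' : ℝ} (hu : u ∈ J) (hu' : u' ∈ J)
    (hv : v ∈ J') (hv' : v' ∈ J') (h : u < v) (h' : u' < v') :
    FormEquiv (A + u • B) (A + v • B) (A + u' • B) (A + v' • B) := by
  -- Linear interpolation keeps the order of the two parameters, so the two conics never meet.
  have hlt (t : unitInterval) :
      (1 - (t : ℝ)) • u + (t : ℝ) • u' < (1 - (t : ℝ)) • v + (t : ℝ) • v' := by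
    have := segment_ne_zero (mul_pos (sub_pos.2 h) (sub_pos.2 h')) t
    have h0 := mul_nonneg t.2.1 (sub_pos.2 h').le
    have h1 := mul_nonneg (sub_nonneg.2 t.2.2) (sub_pos.2 h).le
    have h2 := lt_of_le_of_ne (add_nonneg h1 h0) this.symm
    simp only [smul_eq_mul]
    linarith
  have key := rigidlyIsotopic_of_path
    (F := fun t : unitInterval => A + ((1 - (t : ℝ)) • u + (t : ℝ) • u') • B)
    (G := fun t : unitInterval => A + ((1 - (t : ℝ)) • v + (t : ℝ) • v') • B)
    (by fun_prop) (by fun_prop)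
    (fun t => hd _ (hJ hu hu' (sub_nonneg.2 t.2.2) t.2.1 (by ring)))
    (fun t => hd' _ (hJ' hv hv' (sub_nonneg.2 t.2.2) t.2.1 (by ring)))
    (fun t => linearIndependent_chart hAB (hlt t).ne)
    (fun t => by
      rw [span₂_chart A B (hlt 0).ne, span₂_chart A B (hlt t).ne]
      exact SameOrbit.refl _)
  refine ⟨hd u hu, hd' v hv, hd u' hu', hd' v' hv', Or.inl ?_⟩
  simpa using key

/-- Within one interval the order of the parameters is irrelevant, since the conics may be
exchanged. -/
theorem formEquiv_of_ne {A B : TernaryForm} (hAB : LinearIndependent ℝ ![A, B]) {J : Set ℝ}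
    (hJ : Convex ℝ J) (hd : ∀ u ∈ J, disc (A + u • B) ≠ 0) {u v u' v' : ℝ} (hu : u ∈ J)
    (hv : v ∈ J) (hu' : u' ∈ J) (hv' : v' ∈ J) (h : u ≠ v) (h' : u' ≠ v') :
    FormEquiv (A + u • B) (A + v • B) (A + u' • B) (A + v' • B) := by
  rcases lt_or_gt_of_ne h with h | h <;> rcases lt_or_gt_of_ne h' with h' | h'
  · exact formEquiv_of_lt hAB hJ hJ hd hd hu hu' hv hv' h h'
  · exact (formEquiv_of_lt hAB hJ hJ hd hd hu hv' hv hu' h h').swap_right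
  · exact (formEquiv_of_lt hAB hJ hJ hd hd hv hu' hu hv' h h').swap_left
  · exact (formEquiv_of_lt hAB hJ hJ hd hd hv hv' hu hu' h h').swap_left.swap_right

/-- Pencils with a symmetry that changes the sign of the parameter. -/
theorem formEquiv_of_flip {A B : TernaryForm} (hAB : LinearIndependent ℝ ![A, B])
    {M : Matrix (Fin 3) (Fin 3) ℝ} (hM : M.det ≠ 0) {ε : ℝ} (hε : ε ≠ 0)
    (hA : subst M A = ε • A) (hB : subst M B = -ε • B) {r : ℝ} (hr : 0 ≤ r)
    (hd : ∀ u, r < |u| → disc (A + u • B) ≠ 0) {u v u₀ v₀ w : ℝ} (hu : r < |u|) (hv : r < |v|)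
    (huv : u ≠ v) (hu₀ : r < u₀) (hv₀ : r < v₀) (h₀ : u₀ ≠ v₀) (hw : r < w) :
    FormEquiv (A + u • B) (A + v • B) (A + u₀ • B) (A + v₀ • B) ∨
      FormEquiv (A + u • B) (A + v • B) (A + w • B) (A + (-w) • B) := by
  have hpos {u : ℝ} (h : u ∈ Set.Ioi r) : disc (A + u • B) ≠ 0 :=
    hd u (h.trans_le (le_abs_self u))
  have hneg {u : ℝ} (h : u ∈ Set.Iio (-r)) : disc (A + u • B) ≠ 0 :=
    hd u (lt_of_lt_of_le (lt_neg_of_lt_neg h) (neg_le_abs u))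
  have hflip (u : ℝ) : subst M (A + u • B) = ε • (A + (-u) • B) := by
    rw [subst_add, subst_smul, hA, hB]
    module
  have cross {u v : ℝ} (hu : u < -r) (hv : r < v) :
      FormEquiv (A + u • B) (A + v • B) (A + w • B) (A + (-w) • B) :=
    (formEquiv_of_lt hAB (convex_Iio (-r)) (convex_Ioi r) (fun _ => hneg) (fun _ => hpos)
      hu (neg_lt_neg hw : -w < -r) hv hw (by linarith) (by linarith)).swap_right
  rcases lt_abs.1 hu with hu' | hu' <;> rcases lt_abs.1 hv with hv' | hv'
  · exact Or.inl (formEquiv_of_ne hAB (convex_Ioi r) (fun _ => hpos) hu' hv' hu₀ hv₀ huv h₀)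
  · exact Or.inr (cross (by linarith) hu').swap_left
  · exact Or.inr (cross (by linarith) hv')
  · left
    -- Both parameters are below `-r`; the symmetry `M` carries them to the positive side.
    have h1 := formEquiv_subst hM (hd u hu) (hd v hv) (linearIndependent_chart hAB huv)
    rw [hflip, hflip] at h1
    have huv' : -u ≠ -v := fun h => huv (neg_injective h)
    refine (h1.trans (formEquiv_smul (hpos hu') (hpos hv') (linearIndependent_chart hAB huv')
      hε hε)).trans ?_
    exact formEquiv_of_ne hAB (convex_Ioi r) (fun _ => hpos) hu' hv' hu₀ hv₀ huv' h₀

/-! ### Every pair is equivalent to a representative -/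

/-- All pairs of proper non-empty conics of the pencil are equivalent to representatives. -/
def IsRepresented (W : Submodule ℝ TernaryForm) : Prop :=
  ∀ f ∈ W, ∀ g ∈ W, disc f ≠ 0 → disc g ≠ 0 → LinearIndependent ℝ ![f, g] →
    IsIndefinite f → IsIndefinite g → ∃ c : ClassName, FormEquiv f g c.f c.g

theorem IsIndefinite.of_smul {a : ℝ} {q : TernaryForm} (h : IsIndefinite (a • q)) :
    IsIndefinite q := by
  obtain ⟨v, w, h⟩ := h
  rw [value_smul, value_smul] at h
  refine ⟨v, w, ?_⟩
  have : 0 < a ^ 2 * -(value q v * value q w) := by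
    calc 0 < _ := h
      _ = _ := by ring
  exact pos_of_mul_pos_right this (sq_nonneg a)

theorem IsIndefinite.subst {M : Matrix (Fin 3) (Fin 3) ℝ} (hM : M.det ≠ 0) {q : TernaryForm}
    (h : IsIndefinite q) : IsIndefinite (subst M q) := by
  obtain ⟨v, w, h⟩ := h
  refine ⟨M⁻¹.mulVec v, M⁻¹.mulVec w, ?_⟩
  have hu : IsUnit M.det := isUnit_iff_ne_zero.2 hM
  rwa [value_subst, value_subst, Matrix.mulVec_mulVec, Matrix.mulVec_mulVec,
    Matrix.mul_nonsing_inv _ hu, Matrix.one_mulVec, Matrix.one_mulVec]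

/-- In a pencil spanned by `A` and a degenerate `B`, the proper conics are the `A + u B`. -/
theorem isRepresented_span₂ {A B : TernaryForm} (hAB : LinearIndependent ℝ ![A, B])
    (hB : disc B = 0)
    (h : ∀ u v : ℝ, u ≠ v → disc (A + u • B) ≠ 0 → disc (A + v • B) ≠ 0 →
      IsIndefinite (A + u • B) → IsIndefinite (A + v • B) →
      ∃ c : ClassName, FormEquiv (A + u • B) (A + v • B) c.f c.g) :
    IsRepresented (span₂ A B) := by
  have chart {q : TernaryForm} (hq : q ∈ span₂ A B) (hd : disc q ≠ 0) :
      ∃ a u : ℝ, a ≠ 0 ∧ q = a • (A + u • B) := by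
    obtain ⟨a, b, rfl⟩ := mem_span₂.1 hq
    have ha : a ≠ 0 := by
      rintro rfl
      rw [zero_smul, zero_add, disc_smul, hB, mul_zero] at hd
      exact hd rfl
    refine ⟨a, b / a, ha, ?_⟩
    rw [smul_add, smul_smul, mul_div_cancel₀ _ ha]
  intro f hf g hg hdf hdg hi hf' hg'
  obtain ⟨a, u, ha, rfl⟩ := chart hf hdf
  obtain ⟨b, v, hb, rfl⟩ := chart hg hdg
  rw [disc_smul] at hdf hdg
  have huv : u ≠ v := by
    rintro rfl
    have := LinearIndependent.pair_iff.1 hi b (-a) (by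
      rw [smul_smul, smul_smul]
      module)
    exact hb this.1
  obtain ⟨c, hc⟩ := h u v huv (right_ne_zero_of_mul hdf) (right_ne_zero_of_mul hdg)
    hf'.of_smul hg'.of_smul
  exact ⟨c, (formEquiv_smul (right_ne_zero_of_mul hdf) (right_ne_zero_of_mul hdg)
    (linearIndependent_chart hAB huv) ha hb).trans hc⟩


/-! ### The representatives in the named pencils -/

theorem linearIndependent_form {a b c d e k a' b' c' d' e' k' : ℝ}
    (h : ∀ s t : ℝ, s * a + t * a' = 0 → s * b + t * b' = 0 → s * c + t * c' = 0 →
      s * d + t * d' = 0 → s * e + t * e' = 0 → s * k + t * k' = 0 → s = 0 ∧ t = 0) :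
    LinearIndependent ℝ ![form a b c d e k, form a' b' c' d' e' k'] := by
  rw [LinearIndependent.pair_iff]
  intro s t hst
  rw [smul_form, smul_form, form_add_form, form_eq_zero] at hst
  obtain ⟨h1, h2, h3, h4, h5, h6⟩ := hst
  exact h s t h1 h2 h3 h4 h5 h6

theorem form_add_smul_form (a b c d e k a' b' c' d' e' k' u : ℝ) :
    form a b c d e k + u • form a' b' c' d' e' k' =
      form (a + u * a') (b + u * b') (c + u * c') (d + u * d') (e + u * e') (k + u * k') := by
  rw [smul_form, form_add_form]

theorem isDefinite_form {a b c d e k : ℝ} (h : 0 < a * disc (form a b c d e k))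
    (h' : 0 < a * b - (d / 2) ^ 2) : IsDefinite (form a b c d e k) := by
  refine ⟨?_, ?_⟩
  · simpa [form] using h
  · simpa [form] using h'

/-- The degenerate parameters are `±2` and infinity, and the forms between `-2` and `2` are
definite. The reflection `z ↦ -z` exchanges the two remaining arcs. -/
theorem isRepresented_Ia : IsRepresented OrbitName.Ia.levy := by
  have hi : LinearIndependent ℝ ![form 1 1 1 0 0 0, form 0 0 0 0 1 0] :=
    linearIndependent_form fun s t h _ _ _ h' _ => ⟨by linarith, by linarith⟩
  have hdisc (u : ℝ) : disc (form 1 1 1 0 0 0 + u • form 0 0 0 0 1 0) = 1 - u ^ 2 / 4 := by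
    rw [form_add_smul_form, disc_form]
    ring
  have hlt {u : ℝ} (h0 : disc (form 1 1 1 0 0 0 + u • form 0 0 0 0 1 0) ≠ 0)
      (h : IsIndefinite (form 1 1 1 0 0 0 + u • form 0 0 0 0 1 0)) : 2 < |u| := by
    rw [← abs_of_pos (zero_lt_two' ℝ), ← sq_lt_sq]
    by_contra hn
    rw [hdisc] at h0
    have h1 : u ^ 2 ≠ 2 ^ 2 := fun h => h0 (by rw [h]; norm_num)
    have h2 := lt_of_le_of_ne (not_lt.1 hn) h1
    revert h
    rw [form_add_smul_form]
    refine (isDefinite_form ?_ (by norm_num)).not_isIndefinite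
    rw [← form_add_smul_form, hdisc]
    linarith
  refine isRepresented_span₂ hi (by rw [disc_form]; ring) fun u v huv hu hv hu' hv' => ?_
  rcases formEquiv_of_flip hi (M := !![1, 0, 0; 0, 1, 0; 0, 0, -1]) (ε := 1) (r := 2)
    (u₀ := 3) (v₀ := 4) (w := 3) (by simp [Matrix.det_fin_three]) one_ne_zero
    (by rw [subst_form, one_smul]; congr 1 <;> norm_num)
    (by rw [subst_form, smul_form]; congr 1 <;> norm_num) zero_le_two
    (fun u hu => by
      rw [hdisc]
      have := sq_lt_sq.2 (by rwa [abs_of_pos (zero_lt_two' ℝ)] : |(2 : ℝ)| < |u|)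
      intro h
      linarith)
    (hlt hu hu') (hlt hv hv') huv (by norm_num) (by norm_num) (by norm_num) (by norm_num)
    with h | h
  · refine ⟨.IaN, ?_⟩
    simpa [form_add_smul_form, form_add_form, ClassName.f, ClassName.g] using h
  · refine ⟨.IaS, ?_⟩
    simpa [form_add_smul_form, form_add_form, ClassName.f, ClassName.g] using h

theorem isRepresented_Ib : IsRepresented OrbitName.Ib.levy := by
  have hi : LinearIndependent ℝ ![form 1 1 (-1) 0 0 0, form 0 0 0 0 1 0] :=
    linearIndependent_form fun s t h _ _ _ h' _ => ⟨by linarith, by linarith⟩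
  refine isRepresented_span₂ hi (by rw [disc_form]; ring) fun u v huv _ _ _ _ => ?_
  refine ⟨.IbN, ?_⟩
  simpa [form_add_smul_form, form_add_form, ClassName.f, ClassName.g] using formEquiv_of_ne hi convex_univ (fun u _ => by
      rw [form_add_smul_form, disc_form]
      nlinarith [sq_nonneg u]) (Set.mem_univ u) (Set.mem_univ v) (Set.mem_univ 1)
      (Set.mem_univ (-1)) huv (by norm_num)

/-- The degenerate parameters are `0` and infinity; `x ↦ -x` exchanges the two arcs. -/
theorem isRepresented_II : IsRepresented OrbitName.II.levy := by
  have hi : LinearIndependent ℝ ![form 0 0 0 0 0 1, form 0 0 0 1 (-1) 0] :=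
    linearIndependent_form fun s t _ _ _ h' _ h => ⟨by linarith, by linarith⟩
  have hdisc (u : ℝ) : disc (form 0 0 0 0 0 1 + u • form 0 0 0 1 (-1) 0) = -u ^ 2 / 4 := by
    rw [form_add_smul_form, disc_form]
    ring
  have hlt {u : ℝ} (h0 : disc (form 0 0 0 0 0 1 + u • form 0 0 0 1 (-1) 0) ≠ 0) : 0 < |u| := by
    rw [abs_pos]
    rintro rfl
    rw [hdisc] at h0
    norm_num at h0
  refine isRepresented_span₂ hi (by rw [disc_form]; ring) fun u v huv hu hv hu' hv' => ?_
  rcases formEquiv_of_flip hi (M := !![-1, 0, 0; 0, 1, 0; 0, 0, 1]) (ε := 1) (r := 0)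
    (u₀ := 1) (v₀ := 2) (w := 1) (by simp [Matrix.det_fin_three]) one_ne_zero
    (by rw [subst_form, one_smul]; congr 1 <;> norm_num)
    (by rw [subst_form, smul_form]; congr 1 <;> norm_num) le_rfl
    (fun u hu => by
      rw [hdisc]
      simpa using hu)
    (hlt hu) (hlt hv) huv (by norm_num) (by norm_num) (by norm_num) (by norm_num)
    with h | h
  · refine ⟨.IIN, ?_⟩
    simpa [form_add_smul_form, form_add_form, ClassName.f, ClassName.g] using h
  · refine ⟨.IIS, ?_⟩
    simpa [form_add_smul_form, form_add_form, ClassName.f, ClassName.g] using h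

theorem isRepresented_IIa : IsRepresented OrbitName.IIa.levy := by
  have hi : LinearIndependent ℝ ![form 0 1 1 0 0 0, form 0 0 0 0 1 0] :=
    linearIndependent_form fun s t _ h _ _ h' _ => ⟨by linarith, by linarith⟩
  have hdisc (u : ℝ) : disc (form 0 1 1 0 0 0 + u • form 0 0 0 0 1 0) = -u ^ 2 / 4 := by
    rw [form_add_smul_form, disc_form]
    ring
  have hlt {u : ℝ} (h0 : disc (form 0 1 1 0 0 0 + u • form 0 0 0 0 1 0) ≠ 0) : 0 < |u| := by
    rw [abs_pos]
    rintro rfl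
    rw [hdisc] at h0
    norm_num at h0
  refine isRepresented_span₂ hi (by rw [disc_form]; ring) fun u v huv hu hv hu' hv' => ?_
  rcases formEquiv_of_flip hi (M := !![-1, 0, 0; 0, 1, 0; 0, 0, 1]) (ε := 1) (r := 0)
    (u₀ := 1) (v₀ := 2) (w := 1) (by simp [Matrix.det_fin_three]) one_ne_zero
    (by rw [subst_form, one_smul]; congr 1 <;> norm_num)
    (by rw [subst_form, smul_form]; congr 1 <;> norm_num) le_rfl
    (fun u hu => by
      rw [hdisc]
      simpa using hu)
    (hlt hu) (hlt hv) huv (by norm_num) (by norm_num) (by norm_num) (by norm_num)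
    with h | h
  · refine ⟨.IIaN, ?_⟩
    simpa [form_add_smul_form, form_add_form, ClassName.f, ClassName.g] using h
  · refine ⟨.IIaS, ?_⟩
    simpa [form_add_smul_form, form_add_form, ClassName.f, ClassName.g] using h

theorem isRepresented_III : IsRepresented OrbitName.III.levy := by
  have hi : LinearIndependent ℝ ![form 0 0 0 0 1 0, form 0 1 0 0 0 0] :=
    linearIndependent_form fun s t _ h _ _ h' _ => ⟨by linarith, by linarith⟩
  have hdisc (u : ℝ) : disc (form 0 0 0 0 1 0 + u • form 0 1 0 0 0 0) = -u / 4 := by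
    rw [form_add_smul_form, disc_form]
    ring
  have hlt {u : ℝ} (h0 : disc (form 0 0 0 0 1 0 + u • form 0 1 0 0 0 0) ≠ 0) : 0 < |u| := by
    rw [abs_pos]
    rintro rfl
    rw [hdisc] at h0
    norm_num at h0
  refine isRepresented_span₂ hi (by rw [disc_form]; ring) fun u v huv hu hv hu' hv' => ?_
  -- Here the reflection changes the sign of `xz` and fixes `y²`, so the parameter changes sign only
  -- after division by `ε = -1`.
  rcases formEquiv_of_flip hi (M := !![-1, 0, 0; 0, 1, 0; 0, 0, 1]) (ε := -1) (r := 0)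
    (u₀ := 1) (v₀ := 2) (w := 1) (by simp [Matrix.det_fin_three]) (by norm_num)
    (by rw [subst_form, smul_form]; congr 1 <;> norm_num)
    (by rw [subst_form, smul_form]; congr 1 <;> norm_num) le_rfl
    (fun u hu => by
      rw [hdisc]
      simpa using hu)
    (hlt hu) (hlt hv) huv (by norm_num) (by norm_num) (by norm_num) (by norm_num)
    with h | h
  · refine ⟨.IIIN, ?_⟩
    simpa [form_add_smul_form, form_add_form, ClassName.f, ClassName.g] using h
  · refine ⟨.IIIS, ?_⟩
    simpa [form_add_smul_form, form_add_form, ClassName.f, ClassName.g] using h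

/-- The degenerate parameters are `0` and infinity, but the forms with positive parameter are
definite, so only one arc counts. -/
theorem isRepresented_IIIa : IsRepresented OrbitName.IIIa.levy := by
  have hi : LinearIndependent ℝ ![form 1 1 0 0 0 0, form 0 0 1 0 0 0] :=
    linearIndependent_form fun s t _ h h' _ _ _ => ⟨by linarith, by linarith⟩
  have hdisc (u : ℝ) : disc (form 1 1 0 0 0 0 + u • form 0 0 1 0 0 0) = u := by
    rw [form_add_smul_form, disc_form]
    ring
  have hlt {u : ℝ} (h0 : disc (form 1 1 0 0 0 0 + u • form 0 0 1 0 0 0) ≠ 0)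
      (h : IsIndefinite (form 1 1 0 0 0 0 + u • form 0 0 1 0 0 0)) : u ∈ Set.Iio 0 := by
    by_contra hn
    rw [hdisc] at h0
    have h1 := lt_of_le_of_ne (not_lt.1 hn) h0.symm
    revert h
    rw [form_add_smul_form]
    refine (isDefinite_form ?_ (by norm_num)).not_isIndefinite
    rw [← form_add_smul_form, hdisc]
    linarith
  refine isRepresented_span₂ hi (by rw [disc_form]; ring) fun u v huv hu hv hu' hv' => ?_
  refine ⟨.IIIaN, ?_⟩
  simpa [form_add_smul_form, form_add_form, ClassName.f, ClassName.g] using formEquiv_of_ne hi (convex_Iio 0) (fun u hu => by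
      rw [hdisc]
      exact ne_of_lt hu) (hlt hu hu') (hlt hv hv') (u' := -1) (v' := -2) (by simp) (by simp) huv
      (by norm_num)

/-- The discriminant is a nonzero constant in the parameter, so all real parameters form one arc. -/
theorem isRepresented_IV : IsRepresented OrbitName.IV.levy := by
  have hi : LinearIndependent ℝ ![form 0 (-1) 0 0 1 0, form 0 0 0 1 0 0] :=
    linearIndependent_form fun s t _ _ _ h h' _ => ⟨by linarith, by linarith⟩
  refine isRepresented_span₂ hi (by rw [disc_form]; ring) fun u v huv _ _ _ _ => ?_
  refine ⟨.IVN, ?_⟩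
  simpa [form_add_smul_form, form_add_form, ClassName.f, ClassName.g] using formEquiv_of_ne hi convex_univ (fun u _ => by
      rw [form_add_smul_form, disc_form]
      norm_num) (Set.mem_univ u) (Set.mem_univ v) (Set.mem_univ 1)
      (Set.mem_univ (-2)) huv (by norm_num)

theorem isRepresented_V : IsRepresented OrbitName.V.levy := by
  have hi : LinearIndependent ℝ ![form 0 (-1) 0 0 1 0, form 1 0 0 0 0 0] :=
    linearIndependent_form fun s t h _ _ _ h' _ => ⟨by linarith, by linarith⟩
  refine isRepresented_span₂ hi (by rw [disc_form]; ring) fun u v huv _ _ _ _ => ?_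
  refine ⟨.VN, ?_⟩
  simpa [form_add_smul_form, form_add_form, ClassName.f, ClassName.g] using formEquiv_of_ne hi convex_univ (fun u _ => by
      rw [form_add_smul_form, disc_form]
      norm_num) (Set.mem_univ u) (Set.mem_univ v) (Set.mem_univ (-1))
      (Set.mem_univ 1) huv (by norm_num)

/-- The members `x² - u y² - (1 - u) z²` of the pencil with four real base points. -/
noncomputable def diagForm (u : ℝ) : TernaryForm := form 1 (-u) (u - 1) 0 0 0

theorem diagForm_eq (u : ℝ) : diagForm u = form 1 0 (-1) 0 0 0 + u • form 0 (-1) 1 0 0 0 := by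
  rw [form_add_smul_form, diagForm]
  congr 1 <;> ring

theorem linearIndependent_diagForm {u v : ℝ} (h : u ≠ v) :
    LinearIndependent ℝ ![diagForm u, diagForm v] := by
  rw [diagForm_eq, diagForm_eq]
  exact linearIndependent_chart
    (linearIndependent_form fun s t h h' _ _ _ _ => ⟨by linarith, by linarith⟩) h

theorem disc_diagForm (u : ℝ) : disc (diagForm u) = u * (1 - u) := by
  rw [diagForm, disc_form]
  ring

theorem disc_diagForm_ne_zero {u : ℝ} (h : u ≠ 0) (h' : u ≠ 1) : disc (diagForm u) ≠ 0 := by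
  rw [disc_diagForm]
  exact mul_ne_zero h (sub_ne_zero.2 h'.symm)

theorem formEquiv_diagForm_of_lt {J J' : Set ℝ}
    (hJ : Convex ℝ J) (hJ' : Convex ℝ J') (hd : ∀ u ∈ J, u ≠ 0 ∧ u ≠ 1)
    (hd' : ∀ v ∈ J', v ≠ 0 ∧ v ≠ 1) {u v u' v' : ℝ} (hu : u ∈ J) (hu' : u' ∈ J)
    (hv : v ∈ J') (hv' : v' ∈ J') (h : u < v) (h' : u' < v') :
    FormEquiv (diagForm u) (diagForm v) (diagForm u') (diagForm v') := by
  simp only [diagForm_eq]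
  refine formEquiv_of_lt
    (linearIndependent_form fun s t h h' _ _ _ _ => ⟨by linarith, by linarith⟩) hJ hJ'
    (fun u hu => ?_) (fun v hv => ?_) hu hu' hv hv' h h'
  · rw [← diagForm_eq]
    exact disc_diagForm_ne_zero (hd u hu).1 (hd u hu).2
  · rw [← diagForm_eq]
    exact disc_diagForm_ne_zero (hd' v hv).1 (hd' v hv).2

theorem formEquiv_diagForm_one_sub {u v : ℝ} (h : u ≠ v) (hu : u ≠ 0) (hu' : u ≠ 1) (hv : v ≠ 0)
    (hv' : v ≠ 1) :
    FormEquiv (diagForm u) (diagForm v) (diagForm (1 - u)) (diagForm (1 - v)) := by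
  have key (u : ℝ) : subst !![1, 0, 0; 0, 0, 1; 0, 1, 0] (diagForm u) = diagForm (1 - u) := by
    rw [diagForm, subst_form, diagForm]
    congr 1 <;> ring
  rw [← key, ← key]
  exact formEquiv_subst (by simp [Matrix.det_fin_three]) (disc_diagForm_ne_zero hu hu')
    (disc_diagForm_ne_zero hv hv') (linearIndependent_diagForm h)

theorem formEquiv_diagForm_inv {u v : ℝ} (h : u ≠ v) (hu : u ≠ 0) (hu' : u ≠ 1) (hv : v ≠ 0)
    (hv' : v ≠ 1) :
    FormEquiv (diagForm u) (diagForm v) (diagForm u⁻¹) (diagForm v⁻¹) := by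
  have key {u : ℝ} (hu : u ≠ 0) :
      subst !![0, 1, 0; 1, 0, 0; 0, 0, 1] (diagForm u) = (-u) • diagForm u⁻¹ := by
    rw [diagForm, subst_form, diagForm, smul_form]
    congr 1 <;> field_simp <;> ring
  have h1 := formEquiv_subst (M := !![0, 1, 0; 1, 0, 0; 0, 0, 1]) (by simp [Matrix.det_fin_three])
    (disc_diagForm_ne_zero hu hu') (disc_diagForm_ne_zero hv hv') (linearIndependent_diagForm h)
  rw [key hu, key hv] at h1
  exact h1.trans (formEquiv_smul (disc_diagForm_ne_zero (inv_ne_zero hu) (inv_ne_one.2 hu'))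
    (disc_diagForm_ne_zero (inv_ne_zero hv) (inv_ne_one.2 hv'))
    (linearIndependent_diagForm fun h' => h (inv_injective h')) (neg_ne_zero.2 hu)
    (neg_ne_zero.2 hv))

/-- The degenerate parameters are `0`, `1` and infinity. The permutations of the coordinates act by
`u ↦ 1 - u` and `u ↦ 1/u`, which permute the three arcs transitively; every arc is brought to `(0,
1)`, and `2/3`, `1/3` are the parameters of the representative. -/
theorem formEquiv_diagForm_IN {u v : ℝ} (huv : u < v) (hu : u ≠ 0) (hu' : u ≠ 1) (hv : v ≠ 0)
    (hv' : v ≠ 1) (h : v < 0 ∨ 0 < u ∧ v < 1 ∨ 1 < u) :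
    FormEquiv (diagForm u) (diagForm v) (diagForm (2 / 3)) (diagForm (1 / 3)) := by
  have mid {u v : ℝ} (huv : u < v) (h0 : 0 < u) (h1 : v < 1) :
      FormEquiv (diagForm u) (diagForm v) (diagForm (2 / 3)) (diagForm (1 / 3)) :=
    (formEquiv_diagForm_of_lt (convex_Ioo 0 1) (convex_Ioo 0 1)
      (fun u hu => ⟨hu.1.ne', hu.2.ne⟩) (fun u hu => ⟨hu.1.ne', hu.2.ne⟩) ⟨h0, huv.trans h1⟩
      ⟨by norm_num, by norm_num⟩ ⟨h0.trans huv, h1⟩ ⟨by norm_num, by norm_num⟩ huv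
      (by norm_num)).swap_right
  have big {u v : ℝ} (huv : u < v) (h0 : 1 < u) :
      FormEquiv (diagForm u) (diagForm v) (diagForm (2 / 3)) (diagForm (1 / 3)) :=
    (formEquiv_diagForm_inv huv.ne (by linarith) h0.ne' (by linarith) (by linarith)).trans
      (mid (inv_strictAnti₀ (by linarith) huv) (inv_pos.2 (by linarith))
        (inv_lt_one_of_one_lt₀ h0)).swap_left
  rcases h with h | h | h
  · exact (formEquiv_diagForm_one_sub huv.ne hu hu' hv hv').trans
      (big (by linarith) (by linarith)).swap_left
  · exact mid huv h.1 h.2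
  · exact big huv h

/-- The same two symmetries permute the three pairs of arcs transitively; each is brought to `(0,
1)` and `(1, ∞)`, where the representative has the parameters `2/3` and `2`. -/
theorem formEquiv_diagForm_IS {u v : ℝ} (huv : u < v) (hu : u ≠ 0) (hu' : u ≠ 1) (hv : v ≠ 0)
    (hv' : v ≠ 1) (h : ¬ (v < 0 ∨ 0 < u ∧ v < 1 ∨ 1 < u)) :
    FormEquiv (diagForm u) (diagForm v) (diagForm (2 / 3)) (diagForm 2) := by
  have right {u v : ℝ} (h0 : 0 < u) (h1 : u < 1) (h2 : 1 < v) :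
      FormEquiv (diagForm u) (diagForm v) (diagForm (2 / 3)) (diagForm 2) :=
    formEquiv_diagForm_of_lt (convex_Ioo 0 1) (convex_Ioi 1)
      (fun u hu => ⟨hu.1.ne', hu.2.ne⟩)
      (fun u hu => ⟨(zero_lt_one.trans (Set.mem_Ioi.1 hu)).ne', (Set.mem_Ioi.1 hu).ne'⟩) ⟨h0, h1⟩
      ⟨by norm_num, by norm_num⟩ h2 (by simp) (h1.trans h2) (by norm_num)
  have left {u v : ℝ} (h0 : u < 0) (h1 : 0 < v) (h2 : v < 1) :
      FormEquiv (diagForm u) (diagForm v) (diagForm (2 / 3)) (diagForm 2) :=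
    (formEquiv_diagForm_one_sub (h0.trans h1).ne h0.ne (by linarith) h1.ne' h2.ne).trans
      (right (by linarith) (by linarith) (by linarith)).swap_left
  push Not at h
  obtain ⟨h1, h2, h3⟩ := h
  have h1' := lt_of_le_of_ne h1 hv.symm
  have h3' := lt_of_le_of_ne h3 hu'
  rcases lt_or_gt_of_ne hu with h0 | h0
  · rcases lt_or_gt_of_ne hv' with h4 | h4
    · exact left h0 h1' h4
    · exact (formEquiv_diagForm_inv huv.ne hu hu' hv hv').trans
        (left (inv_neg''.2 h0) (inv_pos.2 h1') (inv_lt_one_of_one_lt₀ h4))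
  · exact right h0 h3' (lt_of_le_of_ne (h2 h0) hv'.symm)

theorem ClassName.formEquiv_IN :
    FormEquiv (diagForm (2 / 3)) (diagForm (1 / 3)) ClassName.IN.f ClassName.IN.g := by
  have h := formEquiv_smul (a := 1 / 3) (b := 1 / 3) ClassName.IN.disc_f ClassName.IN.disc_g
    (linearIndependent_form fun s t h h' _ _ _ _ => ⟨by linarith, by linarith⟩) (by norm_num)
    (by norm_num)
  convert h using 1
  · rw [ClassName.f, smul_form, diagForm]
    congr 1 <;> norm_num
  · rw [ClassName.g, smul_form, diagForm]
    congr 1 <;> norm_num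

theorem ClassName.formEquiv_IS :
    FormEquiv (diagForm (2 / 3)) (diagForm 2) ClassName.IS.f ClassName.IS.g := by
  have h := formEquiv_smul (a := 1 / 3) (b := 1) ClassName.IS.disc_f ClassName.IS.disc_g
    (linearIndependent_form fun s t h h' _ _ _ _ => ⟨by linarith, by linarith⟩) (by norm_num)
    (by norm_num)
  convert h using 1
  · rw [ClassName.f, smul_form, diagForm]
    congr 1 <;> norm_num
  · rw [ClassName.g, smul_form, diagForm]
    congr 1 <;> norm_num

theorem isRepresented_I : IsRepresented OrbitName.I.levy := by
  -- In this basis the parameter of `isRepresented_span₂` is that of `diagForm`.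
  have hspan : OrbitName.I.levy = span₂ (form 1 0 (-1) 0 0 0) (form 0 (-1) 1 0 0 0) :=
    span₂_eq_of_combination (a := 1) (b := 1) (c := 1) (d := 0) (by norm_num)
      (by rw [smul_form, smul_form, form_add_form]; congr 1 <;> norm_num)
      (by rw [smul_form, smul_form, form_add_form]; congr 1 <;> norm_num)
  rw [hspan]
  have hlt {u v : ℝ} (huv : u < v) (hu : disc (diagForm u) ≠ 0) (hv : disc (diagForm v) ≠ 0) :
      ∃ c : ClassName, FormEquiv (diagForm u) (diagForm v) c.f c.g := by
    rw [disc_diagForm] at hu hv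
    have hu0 := left_ne_zero_of_mul hu
    have hu1 := (sub_ne_zero.1 (right_ne_zero_of_mul hu)).symm
    have hv0 := left_ne_zero_of_mul hv
    have hv1 := (sub_ne_zero.1 (right_ne_zero_of_mul hv)).symm
    by_cases h : v < 0 ∨ 0 < u ∧ v < 1 ∨ 1 < u
    · exact ⟨.IN, (formEquiv_diagForm_IN huv hu0 hu1 hv0 hv1 h).trans ClassName.formEquiv_IN⟩
    · exact ⟨.IS, (formEquiv_diagForm_IS huv hu0 hu1 hv0 hv1 h).trans ClassName.formEquiv_IS⟩
  refine isRepresented_span₂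
    (linearIndependent_form fun s t h h' _ _ _ _ => ⟨by linarith, by linarith⟩)
    (by rw [disc_form]; ring) fun u v huv hu hv _ _ => ?_
  rw [← diagForm_eq] at hu hv
  rw [← diagForm_eq, ← diagForm_eq]
  rcases lt_or_gt_of_ne huv with h | h
  · exact hlt h hu hv
  · obtain ⟨c, hc⟩ := hlt h hv hu
    exact ⟨c, hc.swap_left⟩

theorem isRepresented_levy (o : OrbitName) : IsRepresented o.levy := by
  cases o
  · exact isRepresented_I
  · exact isRepresented_Ia
  · exact isRepresented_Ib
  · exact isRepresented_II
  · exact isRepresented_IIa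
  · exact isRepresented_III
  · exact isRepresented_IIIa
  · exact isRepresented_IV
  · exact isRepresented_V


/-! ### Orbits and positions of the representatives -/

theorem ClassName.span₂_f_g (c : ClassName) : span₂ c.f c.g = c.orbit.levy := by
  cases c
  case IN =>
    exact span₂_eq_of_combination (a := 2) (b := 1) (c := 1) (d := 2) (by norm_num)
      (by simp only [f, smul_form, form_add_form]; congr 1 <;> norm_num)
      (by simp only [g, smul_form, form_add_form]; congr 1 <;> norm_num)
  case IS =>
    exact span₂_eq_of_combination (a := 2) (b := 1) (c := 2) (d := -1) (by norm_num)
      (by simp only [f, smul_form, form_add_form]; congr 1 <;> norm_num)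
      (by simp only [g, smul_form, form_add_form]; congr 1 <;> norm_num)
  case IaN =>
    exact span₂_eq_of_combination (a := 1) (b := 3) (c := 1) (d := 4) (by norm_num)
      (by simp only [f, smul_form, form_add_form]; congr 1 <;> norm_num)
      (by simp only [g, smul_form, form_add_form]; congr 1 <;> norm_num)
  case IaS =>
    exact span₂_eq_of_combination (a := 1) (b := 3) (c := 1) (d := -3) (by norm_num)
      (by simp only [f, smul_form, form_add_form]; congr 1 <;> norm_num)
      (by simp only [g, smul_form, form_add_form]; congr 1 <;> norm_num)
  case IIIaN =>
    exact span₂_eq_of_combination (a := 1) (b := -1) (c := 1) (d := -2) (by norm_num)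
      (by simp only [f, smul_form, form_add_form]; congr 1 <;> norm_num)
      (by simp only [g, smul_form, form_add_form]; congr 1 <;> norm_num)
  case IVN =>
    exact span₂_eq_of_combination (a := 1) (b := 1) (c := 1) (d := -2) (by norm_num)
      (by simp only [f, smul_form, form_add_form]; congr 1 <;> norm_num)
      (by simp only [g, smul_form, form_add_form]; congr 1 <;> norm_num)
  case VN =>
    exact span₂_eq_of_combination (a := 1) (b := -1) (c := 1) (d := 1) (by norm_num)
      (by simp only [f, smul_form, form_add_form]; congr 1 <;> norm_num)
      (by simp only [g, smul_form, form_add_form]; congr 1 <;> norm_num)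
  case IIN | IIaN | IIIN =>
    exact span₂_eq_of_combination (a := 1) (b := 1) (c := 1) (d := 2) (by norm_num)
      (by simp only [f, smul_form, form_add_form]; congr 1 <;> norm_num)
      (by simp only [g, smul_form, form_add_form]; congr 1 <;> norm_num)
  case IbN | IIS | IIaS | IIIS =>
    exact span₂_eq_of_combination (a := 1) (b := 1) (c := 1) (d := -1) (by norm_num)
      (by simp only [f, smul_form, form_add_form]; congr 1 <;> norm_num)
      (by simp only [g, smul_form, form_add_form]; congr 1 <;> norm_num)

theorem ClassName.pencil_rep (c : ClassName) : pencil c.rep = c.orbit.levy := by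
  rw [← c.span₂_f_g, pencil_eq (C := conic c.f c.disc_f) (D := conic c.g c.disc_g) rfl]
  exact conic_submodule_sup c.disc_f c.disc_g

theorem Splits.sameArc_conic_iff {f g : TernaryForm} (hf : disc f ≠ 0) (hg : disc g ≠ 0)
    {ℓ : Fin 3 → TernaryForm →ₗ[ℝ] ℝ} (hℓ : Splits (span₂ f g) ℓ) :
    SameArc (conic f hf, conic g hg) ↔
      ∀ i j, 0 < (ℓ i f * ℓ j f) * (ℓ i g * ℓ j g) := by
  rw [← conic_submodule_sup hf hg] at hℓ
  rw [hℓ.sameArc_iff (isProper_mk hf) (isProper_mk hg)]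
  obtain ⟨a, ha⟩ := Projectivization.exists_smul_eq_mk_rep ℝ f (ne_zero_of_disc hf)
  obtain ⟨b, hb⟩ := Projectivization.exists_smul_eq_mk_rep ℝ g (ne_zero_of_disc hg)
  refine forall_congr' fun i => forall_congr' fun j => ?_
  rw [← ha, ← hb]
  simp only [Units.smul_def, map_smul, smul_eq_mul]
  have hab : 0 < ((a : ℝ) * b) ^ 2 := by
    have := a.ne_zero
    have := b.ne_zero
    positivity
  refine Iff.trans ?_ (mul_pos_iff_of_pos_left hab)
  ring_nf

theorem ClassName.onSameArc_rep (c : ClassName) : OnSameArc c.rep ↔ ¬ c.IsSeparated := by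
  rw [onSameArc_iff (C := conic c.f c.disc_f) (D := conic c.g c.disc_g) rfl]
  by_cases hc : c = .IbN
  · subst hc
    refine ⟨fun _ h => h, fun _ => ?_⟩
    refine HasOneArc.mem_connectedComponentIn (ℓ := entry 0 0) ?_
      (left_mem_properConics (isProper_mk ClassName.IbN.disc_f))
      (right_mem_properConics (isProper_mk ClassName.IbN.disc_g))
    have e : couplePencil (conic ClassName.IbN.f ClassName.IbN.disc_f,
        conic ClassName.IbN.g ClassName.IbN.disc_g) = OrbitName.Ib.levy :=
      (conic_submodule_sup ClassName.IbN.disc_f ClassName.IbN.disc_g).trans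
        ClassName.IbN.span₂_f_g
    rw [e]
    exact hasOneArc_levy_Ib
  · have ho : c.orbit ≠ .Ib := by
      cases c <;> simp [orbit] at hc ⊢
    have hs := OrbitName.splits_levy ho
    rw [← c.span₂_f_g] at hs
    rw [hs.sameArc_conic_iff c.disc_f c.disc_g]
    cases c
    case IbN => exact absurd rfl hc
    all_goals
      simp only [Fin.forall_fin_succ, IsEmpty.forall_iff, orbit, OrbitName.factors, f, g,
        IsSeparated]
      simp [entry_apply, form] <;> norm_num

/-! ### The classification of pairs -/

theorem ConicPair.isIndefinite {s : ConicPair} {C D : Conic} (h : s.1 = s(C, D)) :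
    IsIndefinite C.rep ∧ IsIndefinite D.rep := by
  obtain ⟨s, hs, hs'⟩ := s
  subst h
  have hC := hs' C (Sym2.mem_mk_left C D)
  have hD := hs' D (Sym2.mem_mk_right C D)
  exact ⟨hC.1.isNonempty_iff_isIndefinite.1 hC.2, hD.1.isNonempty_iff_isIndefinite.1 hD.2⟩

/-- A pair can be moved to any pencil in the orbit of its pencil. -/
theorem exists_equiv_of_sameOrbit {s : ConicPair} {W : Submodule ℝ TernaryForm}
    (h : SameOrbit (pencil s) W) : ∃ t : ConicPair, s ≈ t ∧ pencil t = W := by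
  obtain ⟨P, rfl⟩ := h
  obtain ⟨C, D, hs, hne, hC, hD, hC', hD'⟩ := s.exists_couple
  obtain ⟨iC, iD⟩ := ConicPair.isIndefinite hs
  have hP : P.1.det ≠ 0 := P.det.ne_zero
  have hi : LinearIndependent ℝ ![C.rep, D.rep] :=
    linearIndependent_pair_of_ne C.rep_nonzero D.rep_nonzero (by rwa [C.mk_rep, D.mk_rep])
  have hi' := linearIndependent_subst hP hi
  have h1 := disc_subst_ne_zero hP hC
  have h2 := disc_subst_ne_zero hP hD
  refine ⟨ConicPair.mk (mk_ne_mk_of_linearIndependent (ne_zero_of_disc h1) (ne_zero_of_disc h2) hi')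
    ⟨isProper_mk h1, (isNonempty_conic_iff h1).2 (iC.subst hP).exists_zero⟩
    ⟨isProper_mk h2, (isNonempty_conic_iff h2).2 (iD.subst hP).exists_zero⟩, ?_, ?_⟩
  · have := isIsotopicMove hP C.rep D.rep hC hD h1 h2 hi
    rw [conic_rep hC, conic_rep hD] at this
    exact ⟨C, D, _, _, hs, rfl, this⟩
  · have e : couplePencil (C, D) = span₂ C.rep D.rep := submodule_sup_eq_span₂ C D
    rw [pencil_eq hs, e, map_changeVars_span₂,
      pencil_eq (C := conic _ h1) (D := conic _ h2) rfl]
    exact conic_submodule_sup h1 h2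

/-- A change of variables first moves the pair to one of the named pencils; the representative is
then found inside that pencil. -/
theorem exists_equiv_rep (s : ConicPair) : ∃ c : ClassName, s ≈ c.rep := by
  obtain ⟨o, ho⟩ := exists_sameOrbit_levy (isNondegeneratePencil_pencil s)
  obtain ⟨t, hst, ht⟩ := exists_equiv_of_sameOrbit ho
  obtain ⟨C, D, hCD, hne, hC, hD, -⟩ := t.exists_couple
  obtain ⟨iC, iD⟩ := ConicPair.isIndefinite hCD
  have hi : LinearIndependent ℝ ![C.rep, D.rep] :=
    linearIndependent_pair_of_ne C.rep_nonzero D.rep_nonzero (by rwa [C.mk_rep, D.mk_rep])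
  rw [pencil_eq hCD] at ht
  have hCm : C.rep ∈ o.levy := ht ▸ rep_mem_of_submodule_le le_sup_left
  have hDm : D.rep ∈ o.levy := ht ▸ rep_mem_of_submodule_le le_sup_right
  obtain ⟨c, hf, hg, hf', hg', h⟩ := isRepresented_levy o C.rep hCm D.rep hDm hC hD hi iC iD
  refine ⟨c, Setoid.trans hst ?_⟩
  rw [conic_rep hf, conic_rep hg] at h
  rcases h with h | h
  · exact ⟨C, D, _, _, hCD, rfl, h⟩
  · exact ⟨C, D, _, _, hCD, Sym2.eq_swap, h⟩

theorem ClassName.eq_of_orbit_eq {c c' : ClassName} (h : c.orbit = c'.orbit)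
    (h' : c.IsSeparated ↔ c'.IsSeparated) : c = c' := by
  cases c <;> cases c' <;> simp [orbit, IsSeparated] at h h' ⊢

/-- Completeness of the two invariants: each pair is equivalent to a representative, and a
representative is determined by its orbit and its position. -/
theorem equiv_iff {s t : ConicPair} :
    s ≈ t ↔ SameOrbit (pencil s) (pencil t) ∧ (OnSameArc s ↔ OnSameArc t) := by
  refine ⟨fun h => ⟨sameOrbit_pencil_of_equiv h, onSameArc_iff_of_equiv h⟩, fun ⟨h, h'⟩ => ?_⟩
  obtain ⟨c, hc⟩ := exists_equiv_rep s
  obtain ⟨c', hc'⟩ := exists_equiv_rep t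
  have ho : c.orbit = c'.orbit := by
    apply OrbitName.eq_of_sameOrbit
    rw [← c.pencil_rep, ← c'.pencil_rep]
    exact (sameOrbit_pencil_of_equiv hc).symm.trans (h.trans (sameOrbit_pencil_of_equiv hc'))
  have hs : c.IsSeparated ↔ c'.IsSeparated := by
    rw [← not_iff_not, ← c.onSameArc_rep, ← c'.onSameArc_rep, ← onSameArc_iff_of_equiv hc,
      ← onSameArc_iff_of_equiv hc', h']
  obtain rfl := ClassName.eq_of_orbit_eq ho hs
  exact Setoid.trans hc (Setoid.symm hc')

theorem ClassName.bijective_mk_rep :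
    Function.Bijective fun c : ClassName => (⟦c.rep⟧ : PairClass) := by
  constructor
  · intro c c' h
    obtain ⟨h1, h2⟩ := equiv_iff.1 (Quotient.exact h)
    rw [c.pencil_rep, c'.pencil_rep] at h1
    rw [c.onSameArc_rep, c'.onSameArc_rep, not_iff_not] at h2
    exact ClassName.eq_of_orbit_eq (OrbitName.eq_of_sameOrbit h1) h2
  · intro k
    induction k using Quotient.ind with
    | _ s =>
      obtain ⟨c, hc⟩ := exists_equiv_rep s
      exact ⟨c, (Quotient.sound hc).symm⟩

instance : Fintype ClassName where
  elems := ⟨([.IN, .IS, .IaN, .IaS, .IbN, .IIN, .IIS, .IIaN, .IIaS, .IIIN, .IIIS, .IIIaN, .IVN,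
    .VN] : List ClassName), by simp⟩
  complete c := by cases c <;> simp

theorem card_pairClass : Nat.card PairClass = 14 := by
  rw [← Nat.card_congr (Equiv.ofBijective _ ClassName.bijective_mk_rep),
    Nat.card_eq_fintype_card]
  rfl

theorem OrbitName.exists_neighbors (o : OrbitName) :
    ∃ c : ClassName, c.orbit = o ∧ ¬ c.IsSeparated := by
  cases o
  · exact ⟨.IN, rfl, id⟩
  · exact ⟨.IaN, rfl, id⟩
  · exact ⟨.IbN, rfl, id⟩
  · exact ⟨.IIN, rfl, id⟩
  · exact ⟨.IIaN, rfl, id⟩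
  · exact ⟨.IIIN, rfl, id⟩
  · exact ⟨.IIIaN, rfl, id⟩
  · exact ⟨.IVN, rfl, id⟩
  · exact ⟨.VN, rfl, id⟩

theorem IsNondegeneratePencil.exists_onSameArc {W : Submodule ℝ TernaryForm}
    (hW : IsNondegeneratePencil W) : ∃ s, pencil s = W ∧ OnSameArc s := by
  obtain ⟨o, ho⟩ := exists_sameOrbit_levy hW
  obtain ⟨c, rfl, hc⟩ := o.exists_neighbors
  rw [← c.pencil_rep] at ho
  obtain ⟨t, hst, ht⟩ := exists_equiv_of_sameOrbit ho.symm
  exact ⟨t, ht, (onSameArc_iff_of_equiv hst).1 (c.onSameArc_rep.2 hc)⟩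

end TwoConics

theorem mainTheorem4 :
    -- there are 14 classes of pairs
    Nat.card TwoConics.PairClass = 14 ∧
    -- the 14 listed pairs represent each class exactly once
    Function.Bijective (fun c : TwoConics.ClassName => (⟦c.rep⟧ : TwoConics.PairClass)) ∧
    -- each listed pair has the orbit of pencils and the position that its name says
    (∀ c : TwoConics.ClassName,
      TwoConics.SameOrbit (TwoConics.pencil c.rep) c.orbit.levy ∧
      (c.IsSeparated → TwoConics.OnDistinctArcs c.rep) ∧
      (¬ c.IsSeparated → TwoConics.OnSameArc c.rep)) ∧
    -- the classes that belong to the orbit of a given pencil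
    (∀ W : Submodule ℝ TwoConics.TernaryForm, TwoConics.IsNondegeneratePencil W →
      (2 ≤ (TwoConics.nonemptyArcs W).encard →
        ∃ N S : TwoConics.PairClass, N ≠ S ∧
          (∀ s : TwoConics.ConicPair, ⟦s⟧ = N ↔
            TwoConics.SameOrbit (TwoConics.pencil s) W ∧ TwoConics.OnSameArc s) ∧
          (∀ s : TwoConics.ConicPair, ⟦s⟧ = S ↔
            TwoConics.SameOrbit (TwoConics.pencil s) W ∧ TwoConics.OnDistinctArcs s) ∧
          {k : TwoConics.PairClass | ∃ s, TwoConics.pencil s = W ∧ ⟦s⟧ = k} = {N, S}) ∧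
      (¬ 2 ≤ (TwoConics.nonemptyArcs W).encard →
        ∃ N : TwoConics.PairClass,
          (∀ s : TwoConics.ConicPair, ⟦s⟧ = N ↔
            TwoConics.SameOrbit (TwoConics.pencil s) W) ∧
          {k : TwoConics.PairClass | ∃ s, TwoConics.pencil s = W ∧ ⟦s⟧ = k} = {N})) := by
  refine ⟨TwoConics.card_pairClass, TwoConics.ClassName.bijective_mk_rep, fun c => ⟨?_, ?_, ?_⟩,
    fun W hW => ⟨fun h2 => ?_, fun h2 => ?_⟩⟩
  · rw [c.pencil_rep]
    exact TwoConics.SameOrbit.refl _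
  · rw [TwoConics.onDistinctArcs_iff, c.onSameArc_rep, not_not]
    exact id
  · exact c.onSameArc_rep.2
  · obtain ⟨n, hn, hn'⟩ := hW.exists_onSameArc
    obtain ⟨d, hd, hd'⟩ := (TwoConics.two_le_encard_nonemptyArcs_iff hW).1 h2
    have keyN (s : TwoConics.ConicPair) : (⟦s⟧ : TwoConics.PairClass) = ⟦n⟧ ↔
        TwoConics.SameOrbit (TwoConics.pencil s) W ∧ TwoConics.OnSameArc s := by
      rw [Quotient.eq]
      refine TwoConics.equiv_iff.trans ?_
      rw [hn, iff_true_right hn']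
    have keyS (s : TwoConics.ConicPair) : (⟦s⟧ : TwoConics.PairClass) = ⟦d⟧ ↔
        TwoConics.SameOrbit (TwoConics.pencil s) W ∧ TwoConics.OnDistinctArcs s := by
      rw [Quotient.eq]
      refine TwoConics.equiv_iff.trans ?_
      rw [hd, iff_false_right hd', TwoConics.onDistinctArcs_iff]
    refine ⟨⟦n⟧, ⟦d⟧, fun h => hd' ((keyN d).1 h.symm).2, keyN, keyS, ?_⟩
    ext k
    simp only [Set.mem_ofPred_eq, Set.mem_insert_iff, Set.mem_singleton_iff]
    constructor
    · rintro ⟨s, rfl, rfl⟩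
      rw [keyN, keyS, TwoConics.onDistinctArcs_iff, ← and_or_left]
      exact ⟨TwoConics.SameOrbit.refl _, em _⟩
    · rintro (rfl | rfl)
      · exact ⟨n, hn, rfl⟩
      · exact ⟨d, hd, rfl⟩
  · obtain ⟨n, hn, hn'⟩ := hW.exists_onSameArc
    have key (s : TwoConics.ConicPair) : (⟦s⟧ : TwoConics.PairClass) = ⟦n⟧ ↔
        TwoConics.SameOrbit (TwoConics.pencil s) W := by
      rw [Quotient.eq]
      refine TwoConics.equiv_iff.trans ?_
      rw [hn, iff_true_right hn', and_iff_left_iff_imp]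
      intro hs
      -- A separated pair in the orbit could be moved to one that generates `W`, which would then
      -- have two non-empty arcs.
      by_contra hd
      obtain ⟨t, hst, ht⟩ := TwoConics.exists_equiv_of_sameOrbit hs
      exact h2 ((TwoConics.two_le_encard_nonemptyArcs_iff hW).2
        ⟨t, ht, fun h => hd ((TwoConics.onSameArc_iff_of_equiv hst).2 h)⟩)
    refine ⟨⟦n⟧, key, ?_⟩
    ext k
    simp only [Set.mem_ofPred_eq, Set.mem_singleton_iff]
    constructor
    · rintro ⟨s, rfl, rfl⟩
      exact (key s).2 (TwoConics.SameOrbit.refl _)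
    · rintro rfl
      exact ⟨n, hn, rfl⟩
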